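/- Let $n\ge 0$ and let either $\mathfrak g_k=\mathfrak{sp}_{2k}$ with $N_k=2k$ (symplectic case) or $\mathfrak g_k=\mathfrak o_{2k+1}$ with $N_k=2k+1$ (orthogonal case), over $\mathbb C$. Index the rows and columns of $\mathfrak{gl}_{N_n}$ by $-n,\dots,-1,1,\dots,n$ (symplectic case) or $-n,\dots,n$ (orthogonal case). Put $F_{ij}=E_{ij}-\theta_{ij}E_{-j,-i}$, with $\theta_{ij}=\operatorname{sgn}(i)\operatorname{sgn}(j)$ in the symplectic case and $\theta_{ij}=1$ in the orthogonal case. For $k\le n$, the Lie algebra $\mathfrak g_k\subseteq\mathfrak g_n$ is spanned by the $F_{ij}$ with $|i|,|j|\le k$, and $U(\mathfrak g_k)\subseteq U(\mathfrak g_n)$. Let $\mathcal F^{(k)}=(F_{ij})_{|i|,|j|\le k}$, a matrix over $U(\mathfrak g_k)$, and let $S_m^{(k)}=\operatorname{Tr}(\mathcal F^{(k)})^{2m}$, an element of the center of $U(\mathfrak g_k)$. Let $\chi_k(u)=1+\sum_{r\ge1}\chi_{k,r}u^{-r}$ be the series with coefficients in the center of $U(\mathfrak g_k)$ whose Harish-Chandra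 image is $$\prod_{i=1}^k\frac{(u+1/2)^2-l_i^2}{(u+1/2)^2-\rho_i^2},\qquad l_i=\lambda_i+\rho_i,$$ where $\lambda_i$ is the eigenvalue of $F_{ii}$ on a highest weight vector (a vector killed by all $F_{ij}$ with $i<j$), and $\rho_i=-i$ in the symplectic case, $\rho_i=-i+\tfrac12$ in the orthogonal case. The twisted Yangian $\mathrm Y^{\mp}(N_k)$ ($-$ in the symplectic and $+$ in the orthogonal case) is the subalgebra of the Yangian $\mathrm Y(N_k)$ generated by the coefficients $s_{ij}^{(r)}$ of the matrix $S(u)=T(u)T^t(-u)$, where $T^t(u)_{ij}=\theta_{ij}t_{-j,-i}(u)$. The homomorphism $\varphi_k:\mathrm Y^{\mp}(N_k)\to U(\mathfrak g_k)$ is given by $$S(u)\mapsto\chi_k(u)\Bigl(1-\frac{\mathcal F^{(k)}}{u+c_k}\Bigr)^{-1},\qquad c_k=\frac{N_k\pm1}{2},$$ that is, $c_k=k+\tfrac12$ in the symplectic case and $c_k=k$ in the orthogonal case. The algebra $\mathrm Y^{\mp}(2)$ is embedded into $\mathrm Y^{\mp}(N_k)$ as the subalgebra generated by the $s_{ij}^{(r)}$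 with $|i|=|j|=k$; so its generator $s_{11}^{(r)}$ is $s_{kk}^{(r)}$ in $\mathrm Y^{\mp}(N_k)$, and $\varphi_k(s_{11}^{(r)})$ is the coefficient of $u^{-r}$ in the $(k,k)$ entry of $\chi_k(u)\bigl(1-\mathcal F^{(k)}/(u+c_k)\bigr)^{-1}$. Then, for $k=1,\dots,n$ and $m=1,\dots,k$, the elements $\varphi_k(s_{11}^{(2m-1)})$ lie in the centralizer $U(\mathfrak g_k)^{\mathfrak g_{k-1}}$, the elements $S_m^{(k)}$ lie in the center of $U(\mathfrak g_k)$, and all these elements $$\varphi_k(s_{11}^{(2m-1)}),\quad S_m^{(k)}\qquad(1\le m\le k\le n)$$ are algebraically independent in $U(\mathfrak g_n)$: they commute with each other, and no nonzero polynomial over $\mathbb C$ vanishes at them. -/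

import Mathlib

noncomputable section

namespace GTLimit

attribute [local instance 100] LieRing.ofAssociativeRing

/-! ### The Lie algebras `sp_{2n}` and `o_{2n+1}` -/

/-- The two series of classical Lie algebras under consideration:
`C` stands for `sp_{2n}` and `B` stands for `o_{2n+1}`. -/
inductive Series
  | C
  | B

/-- The index set `{-n, …, -1, 1, …, n}` for `C`, and `{-n, …, n}` for `B`. -/
def idxSet : Series → ℕ → Finset ℤ
  | .C, n => (Finset.Icc (-(n : ℤ)) n).erase 0
  | .B, n => Finset.Icc (-(n : ℤ)) n

/-- The index set as a type. It has `N` elements, `N = 2n` for `C` and `N = 2n + 1` for `B`. -/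
abbrev Idx (κ : Series) (n : ℕ) : Type := idxSet κ n

theorem neg_mem_idxSet {κ : Series} {n : ℕ} {i : ℤ} (hi : i ∈ idxSet κ n) :
    -i ∈ idxSet κ n := by
  cases κ <;> simp only [idxSet, Finset.mem_erase, Finset.mem_Icc] at hi ⊢ <;> grind

theorem top_mem_idxSet {κ : Series} {n : ℕ} (hn : 1 ≤ n) : (n : ℤ) ∈ idxSet κ n := by
  cases κ <;> simp only [idxSet, Finset.mem_erase, Finset.mem_Icc] <;> grind

/-- The index `-i`. -/
def negIdx {κ : Series} {n : ℕ} (i : Idx κ n) : Idx κ n := ⟨-i.1, neg_mem_idxSet i.2⟩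

/-- The index `n`, for `n ≥ 1`. -/
def topIdx (κ : Series) {n : ℕ} (hn : 1 ≤ n) : Idx κ n := ⟨n, top_mem_idxSet hn⟩

/-- `θ_{ij} = sgn(i) sgn(j)` for `C`, and `θ_{ij} = 1` for `B`. -/
def theta : Series → ℤ → ℤ → ℤ
  | .C, i, j => i.sign * j.sign
  | .B, _, _ => 1

/-- The Gram matrix of the form preserved by the Lie algebra:
`⟨e_i, e_j⟩ = sgn(i) δ_{i,-j}` for `C`, and `⟨e_i, e_j⟩ = δ_{i,-j}` for `B`. -/
def formMatrix (κ : Series) (n : ℕ) : Matrix (Idx κ n) (Idx κ n) ℂ :=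
  Matrix.of fun i j =>
    if i.1 = -j.1 then (match κ with | .C => ((i.1.sign : ℤ) : ℂ) | .B => 1) else 0

/-- The Lie algebra `g_n`: `sp_{2n}` for `C`, and `o_{2n+1}` for `B`. -/
abbrev g (κ : Series) (n : ℕ) : LieSubalgebra ℂ (Matrix (Idx κ n) (Idx κ n) ℂ) :=
  skewAdjointMatricesLieSubalgebra (formMatrix κ n)

/-- The matrix unit `E_{ij}` (it is zero if `i` or `j` is not an index). -/
def E (κ : Series) (n : ℕ) (i j : ℤ) : Matrix (Idx κ n) (Idx κ n) ℂ :=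
  Matrix.of fun a b => if a.1 = i ∧ b.1 = j then 1 else 0

/-- `F_{ij} = E_{ij} - θ_{ij} E_{-j,-i}`, as a matrix. -/
def Fmat (κ : Series) (n : ℕ) (i j : ℤ) : Matrix (Idx κ n) (Idx κ n) ℂ :=
  E κ n i j - (theta κ i j : ℂ) • E κ n (-j) (-i)

theorem Fmat_mem (κ : Series) (n : ℕ) (i j : ℤ) : Fmat κ n i j ∈ g κ n := by
  simp only [g, mem_skewAdjointMatricesLieSubalgebra, mem_skewAdjointMatricesSubmodule]
  rw [Matrix.IsSkewAdjoint, Matrix.IsAdjointPair]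
  ext a b
  have hl : ((Fmat κ n i j).transpose * formMatrix κ n) a b
      = Fmat κ n i j (negIdx b) a * formMatrix κ n (negIdx b) b := by
    rw [Matrix.mul_apply, Finset.sum_eq_single (negIdx b)]
    · rfl
    · intro c _ hc
      have : c.1 ≠ -b.1 := fun h => hc (Subtype.ext h)
      simp [formMatrix, this]
    · simp
  have hr : (formMatrix κ n * (-Fmat κ n i j)) a b
      = -(formMatrix κ n a (negIdx a) * Fmat κ n i j (negIdx a) b) := by
    rw [Matrix.mul_apply, Finset.sum_eq_single (negIdx a)]
    · simp
    · intro c _ hc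
      have : a.1 ≠ -c.1 := fun h => hc (Subtype.ext (by simp [negIdx, h]))
      simp [formMatrix, this]
    · simp
  rw [hl, hr]
  have ha := a.2
  have hb := b.2
  have e1 : (-b.1 = i ∧ a.1 = j) ↔ (a.1 = j ∧ b.1 = -i) := by constructor <;> grind
  have e2 : (-b.1 = -j ∧ a.1 = -i) ↔ (a.1 = -i ∧ b.1 = j) := by constructor <;> grind
  have e3 : (-a.1 = i ∧ b.1 = j) ↔ (a.1 = -i ∧ b.1 = j) := by constructor <;> grind
  have e4 : (-a.1 = -j ∧ b.1 = -i) ↔ (a.1 = j ∧ b.1 = -i) := by constructor <;> grind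
  cases κ
  · have ha0 : a.1 ≠ 0 := (Finset.mem_erase.1 ha).1
    have hb0 : b.1 ≠ 0 := (Finset.mem_erase.1 hb).1
    simp only [Fmat, E, formMatrix, theta, negIdx, Matrix.sub_apply, Matrix.smul_apply,
      Matrix.of_apply, e1, e2, e3, e4, neg_neg, if_true, smul_eq_mul, Int.sign_neg]
    have hsa : ((a.1.sign : ℤ) : ℂ) * ((a.1.sign : ℤ) : ℂ) = 1 := by
      rcases lt_or_gt_of_ne ha0 with h | h <;>
        simp [Int.sign_eq_neg_one_of_neg, Int.sign_eq_one_of_pos, h]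
    have hsb : ((b.1.sign : ℤ) : ℂ) * ((b.1.sign : ℤ) : ℂ) = 1 := by
      rcases lt_or_gt_of_ne hb0 with h | h <;>
        simp [Int.sign_eq_neg_one_of_neg, Int.sign_eq_one_of_pos, h]
    have t1 : a.1 = j ∧ b.1 = -i → i.sign = -b.1.sign ∧ j.sign = a.1.sign := by
      rintro ⟨h, h'⟩
      exact ⟨by rw [h', Int.sign_neg, neg_neg], by rw [h]⟩
    have t2 : a.1 = -i ∧ b.1 = j → i.sign = -a.1.sign ∧ j.sign = b.1.sign := by
      rintro ⟨h, h'⟩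
      exact ⟨by rw [h, Int.sign_neg, neg_neg], by rw [h']⟩
    by_cases h1 : a.1 = j ∧ b.1 = -i <;> by_cases h2 : a.1 = -i ∧ b.1 = j
    · have := t2 h2
      rw [if_pos h1, if_pos h2, (t1 h1).1, (t1 h1).2]
      have hab : b.1.sign = a.1.sign := by grind
      rw [hab]
      push_cast
      ring
    · rw [if_pos h1, if_neg h2, (t1 h1).1, (t1 h1).2]
      push_cast
      linear_combination ((b.1.sign : ℤ) : ℂ) * hsa
    · rw [if_neg h1, if_pos h2, (t2 h2).1, (t2 h2).2]
      push_cast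
      linear_combination -((a.1.sign : ℤ) : ℂ) * hsb
    · rw [if_neg h1, if_neg h2]
      ring
  · simp only [Fmat, E, formMatrix, theta, negIdx, Matrix.sub_apply, Matrix.smul_apply,
      Matrix.of_apply, e1, e2, e3, e4, neg_neg, if_true, smul_eq_mul]
    push_cast
    ring

/-- The element `F_{ij}` of `g_n`. -/
def F (κ : Series) (n : ℕ) (i j : ℤ) : g κ n := ⟨Fmat κ n i j, Fmat_mem κ n i j⟩

/-- The universal enveloping algebra `U(g_n)`. -/
abbrev U (κ : Series) (n : ℕ) : Type := UniversalEnvelopingAlgebra ℂ (g κ n)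

/-- The generator `F_{ij}` of `U(g_n)`. -/
def UF (κ : Series) (n : ℕ) (i j : ℤ) : U κ n := UniversalEnvelopingAlgebra.ι ℂ (F κ n i j)

/-- The subalgebra `U(g_k)` of `U(g_n)`, for `k ≤ n`: it is generated by the `F_{ij}` with
`|i|, |j| ≤ k`. -/
def Usub (κ : Series) (n k : ℕ) : Subalgebra ℂ (U κ n) :=
  Algebra.adjoin ℂ {x | ∃ i ∈ idxSet κ k, ∃ j ∈ idxSet κ k, x = UF κ n i j}

/-- The centralizer `U(g_k)^{g_{k-1}}` of `g_{k-1}` in `U(g_k)`. -/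
def Ucentralizer (κ : Series) (n k : ℕ) : Subalgebra ℂ (U κ n) :=
  Usub κ n k ⊓ Subalgebra.centralizer ℂ (Usub κ n (k - 1) : Set (U κ n))

/-- The center of `U(g_k)`, as a subalgebra of `U(g_n)`. -/
def Ucenter (κ : Series) (n k : ℕ) : Subalgebra ℂ (U κ n) :=
  Usub κ n k ⊓ Subalgebra.centralizer ℂ (Usub κ n k : Set (U κ n))

/-- The matrix `𝓕^{(k)} = (F_{ij})`, with `|i|, |j| ≤ k`, with entries in `U(g_k) ⊆ U(g_n)`. -/
def calF (κ : Series) (n k : ℕ) : Matrix (Idx κ k) (Idx κ k) (U κ n) :=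
  Matrix.of fun i j => UF κ n i.1 j.1

/-- `S_m^{(k)} = Tr (𝓕^{(k)})^{2m}`. -/
def S (κ : Series) (n k m : ℕ) : U κ n := ((calF κ n k) ^ (2 * m)).trace

/-! ### The central series `χ_k(u)`

A series in `u⁻¹` is a power series whose variable `X` stands for `u⁻¹`. -/

/-- The components `ρ_i` of the half-sum of the positive roots: `-i` for `C` and `-i + 1/2` for
`B`. The positive root vectors are the `F_{ij}` with `i < j`. -/
def rho : Series → ℕ → ℂ
  | .C, i => -i
  | .B, i => -i + 1 / 2

/-- The series `∏_{i=1}^k ((u + 1/2)² - l_i²) / ((u + 1/2)² - ρ_i²)` in `u⁻¹`, `l_i = λ_i + ρ_i`,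
evaluated at `λ_i = F_{ii}`. Numerators and denominators are multiplied by `u⁻²`. -/
def cartanSeries (κ : Series) (n k : ℕ) : PowerSeries (U κ n) :=
  ((List.range k).map fun i =>
    ((1 + PowerSeries.C (algebraMap ℂ (U κ n) (1 / 2)) * PowerSeries.X) ^ 2
      - PowerSeries.C
          ((UF κ n (i + 1 : ℕ) (i + 1 : ℕ) + algebraMap ℂ (U κ n) (rho κ (i + 1))) ^ 2)
        * PowerSeries.X ^ 2)
    * PowerSeries.map (algebraMap ℂ (U κ n))
      ((1 + PowerSeries.C (1 / 2 : ℂ) * PowerSeries.X) ^ 2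
        - PowerSeries.C (rho κ (i + 1) ^ 2) * PowerSeries.X ^ 2)⁻¹).prod

/-- The left ideal `U(g_k) n_+` of `U(g_k)`, where `n_+` is spanned by the `F_{ij}`, `i < j`. -/
def leftIdealNPlus (κ : Series) (n k : ℕ) : Submodule ℂ (U κ n) :=
  Submodule.span ℂ {x | ∃ a ∈ Usub κ n k, ∃ i ∈ idxSet κ k, ∃ j ∈ idxSet κ k,
    i < j ∧ x = a * UF κ n i j}

/-- `z` lies in the center of `U(g_k)` and its Harish-Chandra image is `p`, an element of the
subalgebra generated by `F_{11}, …, F_{kk}`: on a highest weight vector of weight `λ` the element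
`z` acts by the value of `p` at `F_{ii} = λ_i`. -/
def HasHCImage (κ : Series) (n k : ℕ) (z p : U κ n) : Prop :=
  z ∈ Ucenter κ n k ∧ z - p ∈ leftIdealNPlus κ n k

open Classical in
/-- The coefficient `χ_{k,r}` of `χ_k(u)`: the element of the center of `U(g_k)` whose
Harish-Chandra image is the `r`-th coefficient of
`∏_{i=1}^k ((u + 1/2)² - l_i²) / ((u + 1/2)² - ρ_i²)`. By the Harish-Chandra isomorphism there is
exactly one such element. -/
def chiCoeff (κ : Series) (n k r : ℕ) : U κ n :=
  if h : ∃ z, HasHCImage κ n k z (PowerSeries.coeff r (cartanSeries κ n k)) then h.choose else 0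

/-- The series `χ_k(u) = 1 + ∑_{r ≥ 1} χ_{k,r} u^{-r}`. -/
def chi (κ : Series) (n k : ℕ) : PowerSeries (U κ n) := PowerSeries.mk (chiCoeff κ n k)

/-! ### The matrix `φ_k(S(u)) = χ_k(u) (1 - 𝓕^{(k)} / (u + (N ± 1)/2))⁻¹` -/

/-- `(N + 1)/2 = k + 1/2` for `C` (where `N = 2k`); `(N - 1)/2 = k` for `B` (where `N = 2k+1`). -/
def shift : Series → ℕ → ℂ
  | .C, k => k + 1 / 2
  | .B, k => k

/-- The series `(1 - 𝓕^{(k)} / (u + (N ± 1)/2))⁻¹` in `u⁻¹`. Here `(u + c)⁻¹` is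
`u⁻¹ (1 + c u⁻¹)⁻¹`. -/
def resolvent (κ : Series) (n k : ℕ) : PowerSeries (Matrix (Idx κ k) (Idx κ k) (U κ n)) :=
  PowerSeries.invOfUnit
    (1 - PowerSeries.C (calF κ n k) *
      PowerSeries.map (algebraMap ℂ (Matrix (Idx κ k) (Idx κ k) (U κ n)))
        (PowerSeries.X * (1 + PowerSeries.C (shift κ k) * PowerSeries.X)⁻¹)) 1

/-- The `(i, j)` entry of `χ_k(u) (1 - 𝓕^{(k)} / (u + (N ± 1)/2))⁻¹`. -/
def phiSeries (κ : Series) (n k : ℕ) (i j : Idx κ k) : PowerSeries (U κ n) :=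
  chi κ n k * PowerSeries.mk fun r => PowerSeries.coeff r (resolvent κ n k) i j

/-- The coefficient of `u^{-r}` in the `(i, j)` entry of
`χ_k(u) (1 - 𝓕^{(k)} / (u + (N ± 1)/2))⁻¹`; this is the value of `φ_k` at `s_{ij}^{(r)}`. -/
def phiCoeff (κ : Series) (n k r : ℕ) (i j : Idx κ k) : U κ n :=
  PowerSeries.coeff r (phiSeries κ n k i j)

/-! ### Yangians and twisted Yangians -/

/-- The element `t_{ij}^{(r)}` of the free algebra on the `t_{ij}^{(r)}`, `r ≥ 1`, with the
convention `t_{ij}^{(0)} = δ_{ij}`. The generator `(r, i, j)` stands for `t_{ij}^{(r+1)}`. -/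
def freeT {I : Type} [DecidableEq I] : ℕ → I → I → FreeAlgebra ℂ (ℕ × I × I)
  | 0, i, j => if i = j then 1 else 0
  | r + 1, i, j => FreeAlgebra.ι ℂ (r, i, j)

/-- The defining relations of the Yangian. -/
inductive YangianRel (I : Type) [DecidableEq I] :
    FreeAlgebra ℂ (ℕ × I × I) → FreeAlgebra ℂ (ℕ × I × I) → Prop
  | rel (i j k l : I) (r s : ℕ) : YangianRel I
      ((freeT (r + 1) i j * freeT s k l - freeT s k l * freeT (r + 1) i j)
        - (freeT r i j * freeT (s + 1) k l - freeT (s + 1) k l * freeT r i j))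
      (freeT r k j * freeT s i l - freeT s k j * freeT r i l)

/-- The Yangian `Y(N)`, with its generators indexed by a set `I` with `N` elements. -/
abbrev Yangian (I : Type) [DecidableEq I] : Type := RingQuot (YangianRel I)

/-- The generator `t_{ij}^{(r)}` of the Yangian. -/
def Yangian.t {I : Type} [DecidableEq I] (r : ℕ) (i j : I) : Yangian I :=
  RingQuot.mkAlgHom ℂ (YangianRel I) (freeT r i j)

/-- `s_{ij}^{(M)} = ∑_a ∑_{r=0}^M θ_{aj} t_{ia}^{(M-r)} (-1)^r t_{-j,-a}^{(r)}`, the coefficients of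
the matrix `S(u) = T(u) T^t(-u)`. -/
def sElem (κ : Series) (k M : ℕ) (i j : Idx κ k) : Yangian (Idx κ k) :=
  ∑ a : Idx κ k, ∑ r ∈ Finset.range (M + 1),
    ((theta κ a.1 j.1 : ℂ) * (-1) ^ r) •
      (Yangian.t (M - r) i a * Yangian.t r (negIdx j) (negIdx a))

/-- The twisted Yangian: `Y^-(2k)` for `C`, and `Y^+(2k+1)` for `B`. -/
def twistedYangian (κ : Series) (k : ℕ) : Subalgebra ℂ (Yangian (Idx κ k)) :=
  Algebra.adjoin ℂ {x | ∃ M i j, x = sElem κ k M i j}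

/-- The generator `s_{ij}^{(M)}` of the twisted Yangian. -/
def sGen (κ : Series) (k M : ℕ) (i j : Idx κ k) : twistedYangian κ k :=
  ⟨sElem κ k M i j, Algebra.subset_adjoin ⟨M, i, j, rfl⟩⟩

/-- The homomorphism `φ` from the twisted Yangian to `U(g_k) ⊆ U(g_n)` is given by
`S(u) ↦ χ_k(u) (1 - 𝓕^{(k)} / (u + (N ± 1)/2))⁻¹`. -/
def IsPhi (κ : Series) (n k : ℕ) (φ : twistedYangian κ k →ₐ[ℂ] U κ n) : Prop :=
  ∀ (r : ℕ) (i j : Idx κ k), φ (sGen κ k r i j) = phiCoeff κ n k r i j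

/-! ### Algebraic independence -/

/-- A family of elements of a (not necessarily commutative) algebra is algebraically independent
if the elements commute with each other and no nonzero polynomial vanishes at them, that is, if
`X_i ↦ a_i` defines an injective homomorphism from the polynomial algebra. -/
def AlgIndep {ι A : Type*} [Ring A] [Algebra ℂ A] (a : ι → A) : Prop :=
  ∃ f : MvPolynomial ι ℂ →ₐ[ℂ] A, (∀ i, f (MvPolynomial.X i) = a i) ∧ Function.Injective f

/-- The pairs `(k, m)` with `1 ≤ k ≤ n` and `1 ≤ m ≤ k`. -/
abbrev Pairs (n : ℕ) : Type := {p : ℕ × ℕ // 1 ≤ p.1 ∧ p.1 ≤ n ∧ 1 ≤ p.2 ∧ p.2 ≤ p.1}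

/-- The index `k` of `Y^-(2k)` or `Y^+(2k+1)`, which is the index `1` of the subalgebra `Y^∓(2)`
generated by the `s_{ij}^{(r)}` with `|i| = |j| = k`. -/
def Pairs.top (κ : Series) {n : ℕ} (p : Pairs n) : Idx κ p.1.1 := topIdx κ p.2.1

end GTLimit

end

/-! Commutativity. The entries of every power of 𝓕 transform under g_k like the entries of 𝓕
(`IsTensor.mul`). Hence the traces of powers are central, the (k,k) entries commute with g_{k-1},
and elements of different levels k commute. What remains is to compare two odd coefficients of the
same level. Commuting 𝓕 past its own powers gives a recursion for the transposed powers
(`IsFMatrix.tT_pow_succ`), and this yields the quaternary relation for the moments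
(`IsFMatrix.quaternary`). Summed against the central coefficients, it says that [s_{i+1}, s_j] +
[s_i, s_{j+1}] equals a correction built from the entries (k,-k) and (-k,k) (`phiCoeff_bracket`).
The symmetry relation of the twisted Yangian (`resCoeff_tT`) ties these entries in neighbouring
orders so that the corrections match, and an induction makes the odd coefficients commute
(`commute_of_bracket`).

The series χ_k. The symmetry relation holds only for the right χ_k, so χ_k has to be related to the
traces. Modulo the left ideal generated by the raising elements, the diagonal entries of 𝓕^r satisfy
a triangular recursion (`pow_diag_sub_mem`), which sums to a closed product
(`gser_hcTrace_mul_hcNum`) and to a functional equation linking χ_k(u) and χ_k(-u) (`hcChi_mul_eq`).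
The image of χ_k depends only on (u + 1/2)², so u ↦ -u may be replaced by u ↦ u - 1. The equation
then becomes a recursion for χ_{k,r} in terms of the traces (`hcChi_rec`), which proves that these
central elements exist. For uniqueness, g_n acts on polynomial functions on matrices, and the
Fischer form turns F_{ij} into the adjoint of F_{ji}. A central element that kills all highest
weight vectors then acts by zero (`eq_zero_of_highest_weight`), and the action is faithful
(`polyAct_injective`). Thus identities between central elements can be checked on Harish-Chandra
images.

Independence. Conjugating the action on polynomials by exp(tf), with f linear, turns each generator
into an operator of degree one in t; its top coefficient is a principal symbol. This gives
multiplicative symbols at every linear functional (`SymbolAt`) without an appeal to the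
Poincaré–Birkhoff–Witt theorem. For a skew matrix Y with k-th central block Y_k, the symbol of
(𝓕^{(k)})^r is Y_k^r, that of χ_{k,r} is the Newton polynomial e_r in the traces of powers of Y_k,
and that of the coefficient of u^{-r} is ∑ e_{r-s} (Y_k^s)_{kk}. Algebraic independence follows once
these symbols take arbitrary values (`algIndep_of_symbolAt`). They do so already on skew Hessenberg
matrices: the entries of the last column of Y_k are adjusted one after another, each moving exactly
the next symbol of its level (`exists_isHess`). -/

noncomputable section

namespace GTLimit

attribute [local instance 100] LieRing.ofAssociativeRing

/-! ### Signs and the transposition -/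

/-- The sign `θ_{i,-i}`: `-1` for `C` and `1` for `B`. -/
def eps : Series → ℂ
  | .C => -1
  | .B => 1

/-- The sign `θ_{ij}` as a complex number. -/
def th {κ : Series} {k : ℕ} (i j : Idx κ k) : ℂ := (theta κ i.1 j.1 : ℂ)

section signs

variable {κ : Series} {k : ℕ}

theorem eps_mul_eps (κ : Series) : eps κ * eps κ = 1 := by cases κ <;> simp [eps]

@[simp] theorem negIdx_negIdx (i : Idx κ k) : negIdx (negIdx i) = i := Subtype.ext (neg_neg _)

theorem negIdx_eq_iff {i j : Idx κ k} : negIdx i = j ↔ i = negIdx j := by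
  constructor <;> rintro rfl <;> simp

theorem negIdx_injective : Function.Injective (negIdx : Idx κ k → Idx κ k) :=
  fun i j h => by simpa using congrArg negIdx h

@[simp] theorem negIdx_inj {i j : Idx κ k} : negIdx i = negIdx j ↔ i = j :=
  negIdx_injective.eq_iff

/-- The sign of an index for `C`, and `1` for `B`. -/
def sg (i : Idx κ k) : ℂ := match κ with | .C => ((i.1.sign : ℤ) : ℂ) | .B => 1

theorem th_eq (i j : Idx κ k) : th i j = sg i * sg j := by
  cases κ <;> simp [th, theta, sg]

theorem sg_mul_self (i : Idx κ k) : sg i * sg i = 1 := by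
  cases κ
  · have h0 : i.1 ≠ 0 := (Finset.mem_erase.1 i.2).1
    rcases lt_or_gt_of_ne h0 with h | h <;>
      simp [sg, Int.sign_eq_neg_one_of_neg, Int.sign_eq_one_of_pos, h]
  · simp [sg]

theorem sg_negIdx (i : Idx κ k) : sg (negIdx i) = eps κ * sg i := by
  cases κ <;> simp [sg, negIdx, eps]

theorem th_self (i : Idx κ k) : th i i = 1 := by rw [th_eq, sg_mul_self]

theorem th_self_negIdx (i : Idx κ k) : th i (negIdx i) = eps κ := by
  rw [th_eq, sg_negIdx]; linear_combination eps κ * sg_mul_self i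

theorem th_negIdx_self (i : Idx κ k) : th (negIdx i) i = eps κ := by
  rw [th_eq, sg_negIdx]; linear_combination eps κ * sg_mul_self i

theorem th_negIdx_negIdx (i j : Idx κ k) : th (negIdx i) (negIdx j) = th i j := by
  simp only [th_eq, sg_negIdx]; linear_combination sg i * sg j * eps_mul_eps κ

theorem th_mul_th (i j l : Idx κ k) : th i j * th j l = th i l := by
  simp only [th_eq]; linear_combination sg i * sg l * sg_mul_self j

theorem th_comm (i j : Idx κ k) : th i j = th j i := by simp only [th_eq]; ring

theorem th_mul_self (i j : Idx κ k) : th i j * th i j = 1 := by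
  rw [th_comm i j]; nth_rw 2 [th_comm j i]; rw [th_mul_th, th_self]

/-- The relation N = 2c + ε is the source of the shift c: contracting an index produces the factor
N, and an ε-term of the bracket reduces it to 2c. -/
theorem card_idx (κ : Series) (k : ℕ) : (Fintype.card (Idx κ k) : ℂ) = 2 * shift κ k + eps κ := by
  have h : (idxSet κ k).card = match κ with | .C => 2 * k | .B => 2 * k + 1 := by
    cases κ
    · simp only [idxSet]
      rw [Finset.card_erase_of_mem (by simp)]
      simp only [Int.card_Icc]; omega
    · simp only [idxSet, Int.card_Icc]; omega
  rw [Fintype.card_coe, h]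
  cases κ <;> (simp [shift, eps]; try ring)

end signs

/-! ### Matrices satisfying the defining relations -/

section tensor

variable {κ : Series} {k : ℕ} {A : Type*} [Ring A] [Algebra ℂ A]

/-- The value of `[F_{ij}, X_{ab}]` for a matrix `X` which transforms like `F`. -/
def brk (X : Matrix (Idx κ k) (Idx κ k) A) (i j a b : Idx κ k) : A :=
  (if a = j then X i b else 0) - (if b = i then X a j else 0)
    - (if a = negIdx i then th i j • X (negIdx j) b else 0)
    + (if b = negIdx j then th i j • X a (negIdx i) else 0)

/-- `X` transforms like `M` under the commutators with the entries of `M`. -/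
def IsTensor (M X : Matrix (Idx κ k) (Idx κ k) A) : Prop :=
  ∀ i j a b, M i j * X a b - X a b * M i j = brk X i j a b

/-- The entries of `M` satisfy the relations of the generators `F_{ij}`. -/
structure IsFMatrix (M : Matrix (Idx κ k) (Idx κ k) A) : Prop where
  skew : ∀ i j, M i j = -(th i j • M (negIdx j) (negIdx i))
  tensor : IsTensor M M

/-- Commutators are derivations, and the terms in which the summation index is hit cancel in pairs
between the two factors. -/
theorem IsTensor.mul {M X Y : Matrix (Idx κ k) (Idx κ k) A} (hX : IsTensor M X)
    (hY : IsTensor M Y) : IsTensor M (X * Y) := by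
  intro i j a b
  have key : ∀ c, M i j * (X a c * Y c b) - X a c * Y c b * M i j
      = brk X i j a c * Y c b + X a c * brk Y i j c b := by
    intro c
    rw [← hX, ← hY]; noncomm_ring
  have e : M i j * (X * Y) a b - (X * Y) a b * M i j
      = ∑ c, (brk X i j a c * Y c b + X a c * brk Y i j c b) := by
    rw [Matrix.mul_apply, Finset.mul_sum, Finset.sum_mul, ← Finset.sum_sub_distrib]
    exact Finset.sum_congr rfl fun c _ => key c
  rw [e]
  simp only [brk, add_mul, sub_mul, mul_add, mul_sub, Finset.sum_add_distrib,
    Finset.sum_sub_distrib, ite_mul, mul_ite, zero_mul, mul_zero, Finset.sum_ite_eq',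
    Finset.mem_univ, if_true, smul_mul_assoc, mul_smul_comm]
  have h1 : ∀ (p : Prop) [Decidable p] (g : Idx κ k → A),
      ∑ c, (if p then g c else 0) = if p then ∑ c, g c else 0 := by
    intro p _ g; split_ifs <;> simp
  simp only [h1, Matrix.mul_apply, Finset.smul_sum]
  abel

theorem IsTensor.one (M : Matrix (Idx κ k) (Idx κ k) A) : IsTensor M 1 := by
  intro i j a b
  have h0 : M i j * (1 : Matrix (Idx κ k) (Idx κ k) A) a b
      - (1 : Matrix (Idx κ k) (Idx κ k) A) a b * M i j = 0 := by
    by_cases h : a = b <;> simp [Matrix.one_apply, h]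
  rw [h0]
  simp only [brk, Matrix.one_apply]
  have e1 : (if a = j then if i = b then (1 : A) else 0 else 0)
      = if b = i then if a = j then 1 else 0 else 0 := by
    simp only [eq_comm (a := i) (b := b)]; split_ifs <;> rfl
  have e2 : (if a = negIdx i then th i j • (if negIdx j = b then (1 : A) else 0) else 0)
      = if b = negIdx j then th i j • (if a = negIdx i then (1 : A) else 0) else 0 := by
    simp only [eq_comm (a := negIdx j) (b := b)]; split_ifs <;> simp
  rw [e1, e2]; simp

theorem IsFMatrix.pow {M : Matrix (Idx κ k) (Idx κ k) A} (hM : IsFMatrix M) (r : ℕ) :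
    IsTensor M (M ^ r) := by
  induction r with
  | zero => rw [pow_zero]; exact IsTensor.one M
  | succ r ih => rw [pow_succ]; exact ih.mul hM.tensor

/-- On the diagonal, the four terms of the bracket cancel in pairs after summation. -/
theorem IsTensor.trace_comm {M X : Matrix (Idx κ k) (Idx κ k) A} (hX : IsTensor M X)
    (i j : Idx κ k) : M i j * X.trace = X.trace * M i j := by
  rw [← sub_eq_zero]
  simp only [Matrix.trace, Matrix.diag, Finset.mul_sum, Finset.sum_mul]
  rw [← Finset.sum_sub_distrib, Finset.sum_congr rfl fun a _ => hX i j a a]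
  simp [brk, Finset.sum_add_distrib, Finset.sum_sub_distrib]

/-- The transposition `X ↦ X^t`, `(X^t)_{ij} = θ_{ij} X_{-j,-i}`. -/
def tT : Matrix (Idx κ k) (Idx κ k) A →ₗ[ℂ] Matrix (Idx κ k) (Idx κ k) A where
  toFun X := Matrix.of fun i j => th i j • X (negIdx j) (negIdx i)
  map_add' X Y := by ext; simp
  map_smul' c X := by ext; simp [smul_comm c]

theorem tT_apply (X : Matrix (Idx κ k) (Idx κ k) A) (i j : Idx κ k) :
    tT X i j = th i j • X (negIdx j) (negIdx i) := rfl

theorem tT_one : tT (1 : Matrix (Idx κ k) (Idx κ k) A) = 1 := by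
  ext i j
  rw [tT_apply, Matrix.one_apply, Matrix.one_apply]
  by_cases h : i = j
  · simp [h, th_self]
  · simp [h, Ne.symm h]

/-- Transposition reverses the order of the factors, so M has to be commuted past X. The main term
becomes -X^t M by skewness. The contracted bracket contributes N X^t - ε X^t + ε X - Tr X, where N -
ε is twice the shift. -/
theorem IsFMatrix.tT_mul {M X : Matrix (Idx κ k) (Idx κ k) A} (hM : IsFMatrix M)
    (hX : IsTensor M X) :
    tT (M * X) = -(tT X * M) + (2 * shift κ k : ℂ) • tT X + eps κ • X
      - Matrix.scalar _ X.trace := by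
  ext a b
  have e : (M * X) (negIdx b) (negIdx a) = ∑ c, X c (negIdx a) * M (negIdx b) c
      + ∑ c, brk X (negIdx b) c c (negIdx a) := by
    rw [Matrix.mul_apply, ← Finset.sum_add_distrib]
    exact Finset.sum_congr rfl fun c _ => by rw [← hX]; abel
  have e1 : th a b • ∑ c, X c (negIdx a) * M (negIdx b) c = -(tT X * M) a b := by
    rw [Matrix.mul_apply, Finset.smul_sum, ← Finset.sum_neg_distrib]
    refine Fintype.sum_equiv (Function.Involutive.toPerm _ negIdx_negIdx) _ _ fun c => ?_
    change _ = -(tT X a (negIdx c) * M (negIdx c) b)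
    have h := th_negIdx_negIdx b (negIdx c)
    rw [negIdx_negIdx] at h
    rw [hM.skew (negIdx b) c, tT_apply]
    simp only [negIdx_negIdx, mul_neg, smul_neg, mul_smul_comm, smul_smul, smul_mul_assoc,
      h, th_mul_th]
  have e2 : ∑ c, brk X (negIdx b) c c (negIdx a)
      = (Fintype.card (Idx κ k) : ℂ) • X (negIdx b) (negIdx a)
        - (if a = b then X.trace else 0) - eps κ • X (negIdx b) (negIdx a)
        + th (negIdx b) a • X a b := by
    simp only [brk, Finset.sum_add_distrib, Finset.sum_sub_distrib, negIdx_inj, negIdx_negIdx,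
      if_true, Finset.sum_const, Finset.card_univ, Finset.sum_ite_eq', Finset.mem_univ,
      th_negIdx_self, Finset.sum_ite_eq]
    congr 2
    congr 1
    · rw [Nat.cast_smul_eq_nsmul]
    · by_cases h : a = b <;> simp [h, Matrix.trace]
  rw [tT_apply, e, smul_add, e1, e2, card_idx]
  simp only [Matrix.add_apply, Matrix.sub_apply, Matrix.neg_apply, Matrix.smul_apply, smul_add,
    smul_sub, smul_smul, tT_apply, Matrix.scalar_apply, Matrix.diagonal_apply]
  have h3 : th a b * th (negIdx b) a = eps κ := by
    rw [mul_comm, th_mul_th, th_negIdx_self]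
  rw [h3]
  have h4 : (th a b • if a = b then X.trace else 0) = if a = b then X.trace else 0 := by
    split_ifs with h
    · rw [h, th_self, one_smul]
    · simp
  rw [h4, mul_add, add_smul, mul_comm (th a b) (2 * _), mul_comm (th a b) (eps κ)]
  abel

end tensor

/-! ### The quaternary relation for the moments -/

section moments

variable {κ : Series} {k : ℕ} {A : Type*} [Ring A] [Algebra ℂ A]
  {M : Matrix (Idx κ k) (Idx κ k) A}

theorem IsFMatrix.tT_pow_succ (hM : IsFMatrix M) (s : ℕ) :
    tT (M ^ (s + 1)) = -(tT (M ^ s) * M) + (2 * shift κ k : ℂ) • tT (M ^ s) + eps κ • M ^ s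
      - Matrix.scalar _ (M ^ s).trace := by
  rw [pow_succ', hM.tT_mul (hM.pow s)]

theorem IsTensor.scalar_trace_comm {X : Matrix (Idx κ k) (Idx κ k) A} (hX : IsTensor M X) :
    Commute (Matrix.scalar _ X.trace) M := by
  ext i j
  simpa [Matrix.scalar_apply] using (hX.trace_comm i j).symm

/-- By the recursion, a transposed power is a polynomial in M whose coefficients are scalar matrices
of traces, and these commute with M. -/
theorem IsFMatrix.tT_pow_comm (hM : IsFMatrix M) (s : ℕ) : Commute (tT (M ^ s)) M := by
  induction s with
  | zero => rw [pow_zero, tT_one]; exact Commute.one_left M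
  | succ s ih =>
    rw [hM.tT_pow_succ]
    refine Commute.sub_left (Commute.add_left (Commute.add_left ?_ ?_) ?_)
      (hM.pow s).scalar_trace_comm
    · exact (ih.mul_left (Commute.refl M)).neg_left
    · exact ih.smul_left _
    · exact ((Commute.refl M).pow_left s).smul_left _

/-- Leibniz rule: the factors of M^r are commuted with Y_{tt} one at a time, and each bracket has
only four kinds of nonzero terms. -/
theorem IsTensor.commutator_pow {Y : Matrix (Idx κ k) (Idx κ k) A} (hY : IsTensor M Y)
    (t : Idx κ k) (r : ℕ) :
    (M ^ r) t t * Y t t - Y t t * (M ^ r) t t = ∑ p ∈ Finset.range r,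
      ((M ^ p * Y) t t * (M ^ (r - 1 - p)) t t - (M ^ p) t t * (Y * M ^ (r - 1 - p)) t t
        - (M ^ p) t (negIdx t) * (tT Y * M ^ (r - 1 - p)) (negIdx t) t
        + (M ^ p * tT Y) t (negIdx t) * (M ^ (r - 1 - p)) (negIdx t) t) := by
  -- The entries of `B` are the commutators [M_{ij}, Y_{tt}]; they live in the rows and columns t
  -- and -t.
  set B : Matrix (Idx κ k) (Idx κ k) A := Matrix.of fun i j => brk Y i j t t with hB
  have hC : ∀ r a b, (M ^ r) a b * Y t t - Y t t * (M ^ r) a b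
      = (∑ p ∈ Finset.range r, M ^ p * B * M ^ (r - 1 - p)) a b := by
    intro r
    induction r with
    | zero =>
      intro a b
      by_cases h : a = b <;> simp [h]
    | succ r ih =>
      intro a b
      have e : (∑ p ∈ Finset.range (r + 1), M ^ p * B * M ^ (r + 1 - 1 - p))
          = M * (∑ p ∈ Finset.range r, M ^ p * B * M ^ (r - 1 - p)) + B * M ^ r := by
        rw [Finset.sum_range_succ', Finset.mul_sum]
        congr 1
        · refine Finset.sum_congr rfl fun p hp => ?_
          rw [show r + 1 - 1 - (p + 1) = r - 1 - p by omega, pow_succ']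
          simp only [mul_assoc]
        · simp
      rw [e, Matrix.add_apply, Matrix.mul_apply, Matrix.mul_apply, ← Finset.sum_add_distrib,
        pow_succ', Matrix.mul_apply, Finset.sum_mul, Finset.mul_sum, ← Finset.sum_sub_distrib]
      refine Finset.sum_congr rfl fun j _ => ?_
      rw [← ih, hB, Matrix.of_apply, ← hY]
      noncomm_ring
  rw [hC, Matrix.sum_apply]
  refine Finset.sum_congr rfl fun p _ => ?_
  generalize r - 1 - p = q
  have e1 : (B : Matrix (Idx κ k) (Idx κ k) A) = Matrix.of fun i j =>
      (if j = t then Y i t else 0) - (if i = t then Y t j else 0)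
      - (if i = negIdx t then tT Y (negIdx t) j else 0)
      + (if j = negIdx t then tT Y i (negIdx t) else 0) := by
    ext i j
    simp only [hB, Matrix.of_apply, brk]
    have h1 : (t = negIdx i) ↔ (i = negIdx t) := by
      rw [eq_comm, negIdx_eq_iff]
    have h2 : (t = negIdx j) ↔ (j = negIdx t) := by
      rw [eq_comm, negIdx_eq_iff]
    simp only [h1, h2, eq_comm (a := t), tT_apply, negIdx_negIdx]
    congr 1
    · congr 1
      split_ifs with h
      · rw [h]
      · rfl
    · split_ifs with h
      · rw [h]
      · rfl
  have e2 : (M ^ p * B * M ^ q) t t = ∑ j, ∑ i, (M ^ p) t i * B i j * (M ^ q) j t := by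
    rw [Matrix.mul_apply]
    exact Finset.sum_congr rfl fun j _ => by rw [Matrix.mul_apply, Finset.sum_mul]
  rw [e2, e1]
  simp only [Matrix.of_apply, mul_add, mul_sub, add_mul, sub_mul, Finset.sum_add_distrib,
    Finset.sum_sub_distrib, mul_ite, ite_mul, mul_zero, zero_mul]
  have h1 : ∀ (p : Prop) [Decidable p] (g : Idx κ k → A),
      ∑ c, (if p then g c else 0) = if p then ∑ c, g c else 0 := by
    intro p _ g; split_ifs <;> simp
  simp only [h1, Finset.sum_ite_eq', Finset.mem_univ, if_true, Matrix.mul_apply, Finset.sum_mul,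
    Finset.mul_sum, mul_assoc]

/-- The recursive solution of the quaternary relation, in terms of sequences in a ring. -/
theorem quaternary_of_recursion (c ε : ℂ) (f a b T : ℕ → A) (lg rg : ℕ → ℕ → A)
    (hf : f 0 = 1) (hT : ∀ s p, T s * a p = a p * T s)
    (hlg : ∀ s q, lg (s + 1) q = -lg s (q + 1) + c • lg s q + ε • b (s + q) - T s * b q)
    (hrg : ∀ p s, rg p (s + 1) = -rg (p + 1) s + c • rg p s + ε • a (p + s) - T s * a p)
    (hlg0 : ∀ s, lg s 0 = ε • b s) (hrg0 : ∀ s, rg 0 s = ε • a s)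
    (hH : ∀ r s, f r * f s - f s * f r = ∑ p ∈ Finset.range r,
      (f (p + s) * f (r - 1 - p) - f p * f (s + (r - 1 - p))
        - a p * lg s (r - 1 - p) + rg p s * b (r - 1 - p))) (r s : ℕ) :
    (f (r + 1) * f s - f s * f (r + 1)) + (f r * f (s + 1) - f (s + 1) * f r)
      - c • (f r * f s - f s * f r) + ε • (a r * b s - a s * b r) = 0 := by
  -- `Z` is the expression to be shown zero. The plan is to write `Z r s` as a sum of values of `Z`
  -- with smaller total index.
  set H : ℕ → ℕ → A := fun r s => f r * f s - f s * f r with hHdef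
  set J : ℕ → ℕ → A := fun r s => a r * b s - a s * b r with hJdef
  set Z : ℕ → ℕ → A := fun r s => H (r + 1) s + H r (s + 1) - c • H r s + ε • J r s with hZdef
  have hL : ∀ r s, ∑ p ∈ Finset.range r, (f (p + s) * f (r - 1 - p) - f p * f (s + (r - 1 - p)))
      = ∑ q ∈ Finset.range r, H (r - 1 - q + s) q := by
    intro r s
    simp only [hHdef, Finset.sum_sub_distrib]
    congr 1
    · rw [← Finset.sum_range_reflect]
      refine Finset.sum_congr rfl fun q hq => ?_
      rw [Finset.mem_range] at hq
      rw [show r - 1 - (r - 1 - q) = q by omega]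
    · exact Finset.sum_congr rfl fun q _ => by rw [add_comm s]
  set B : ℕ → ℕ → A := fun r s => ∑ p ∈ Finset.range r,
    (-(a p * lg s (r - 1 - p)) + rg p s * b (r - 1 - p)) with hBdef
  have hHLB : ∀ r s, H r s = ∑ q ∈ Finset.range r, H (r - 1 - q + s) q + B r s := by
    intro r s
    rw [← hL, hBdef, ← Finset.sum_add_distrib, hHdef]
    simp only
    rw [hH]
    exact Finset.sum_congr rfl fun p _ => by abel
  have hJsum : ∀ r s, ∑ p ∈ Finset.range r, (-(a p * b (s + (r - 1 - p)))
      + a (p + s) * b (r - 1 - p)) = ∑ q ∈ Finset.range r, J (r - 1 - q + s) q := by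
    intro r s
    simp only [hJdef, Finset.sum_sub_distrib, Finset.sum_add_distrib, Finset.sum_neg_distrib]
    rw [neg_add_eq_sub]
    congr 1
    · rw [← Finset.sum_range_reflect]
      refine Finset.sum_congr rfl fun q hq => ?_
      rw [Finset.mem_range] at hq
      rw [show r - 1 - (r - 1 - q) = q by omega]
    · exact Finset.sum_congr rfl fun q _ => by rw [add_comm s]
  -- Applying the two recursions to the off-diagonal part, the terms with `T` cancel because `T`
  -- commutes with `a`. The two boundary terms supply the first summand on the right.
  have hBrec : ∀ r s, B (r + 1) s + B r (s + 1) - c • B r s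
      = -(ε • J r s) + ε • ∑ q ∈ Finset.range r, J (r - 1 - q + s) q := by
    intro r s
    have h1 : B (r + 1) s = ∑ p ∈ Finset.range r, (-(a p * lg s (r - 1 - p + 1))
        + rg (p + 1) s * b (r - 1 - p)) - ε • J r s := by
      simp only [hBdef, Finset.sum_add_distrib]
      rw [Finset.sum_range_succ, Finset.sum_range_succ' (fun p => rg p s * b (r + 1 - 1 - p))]
      have x1 : ∑ p ∈ Finset.range r, -(a p * lg s (r + 1 - 1 - p))
          = ∑ p ∈ Finset.range r, -(a p * lg s (r - 1 - p + 1)) :=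
        Finset.sum_congr rfl fun p hp => by
          rw [Finset.mem_range] at hp
          rw [show r + 1 - 1 - p = r - 1 - p + 1 by omega]
      have x2 : ∑ p ∈ Finset.range r, rg (p + 1) s * b (r + 1 - 1 - (p + 1))
          = ∑ p ∈ Finset.range r, rg (p + 1) s * b (r - 1 - p) :=
        Finset.sum_congr rfl fun p _ => by
          rw [show r + 1 - 1 - (p + 1) = r - 1 - p by omega]
      rw [x1, x2, show r + 1 - 1 - r = 0 by omega, show r + 1 - 1 - 0 = r by omega, hlg0, hrg0]
      simp only [hJdef, mul_smul_comm, smul_mul_assoc, smul_sub]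
      abel
    rw [h1, ← hJsum, Finset.smul_sum]
    simp only [hBdef, Finset.smul_sum]
    have h2 : ∀ x y z w u : A, x + y - z = w → x - u + y - z = -u + w := by
      intro x y z w u h; rw [← h]; abel
    apply h2
    rw [← Finset.sum_add_distrib, ← Finset.sum_sub_distrib]
    refine Finset.sum_congr rfl fun p _ => ?_
    rw [hlg, hrg]
    simp only [mul_add, mul_sub, add_mul, sub_mul, mul_smul_comm, smul_mul_assoc, smul_add,
      smul_neg, mul_neg, neg_mul, ← mul_assoc, hT]
    abel
  -- Every term on the right has total index r + s - 1, so induction on r + s finishes the proof.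
  have hZrec : ∀ r s, Z r s = ∑ q ∈ Finset.range r, Z (r - 1 - q + s) q := by
    intro r s
    have h0 : ∀ m, H m 0 = 0 := by intro m; simp [hHdef, hf]
    have h1 : ∑ q ∈ Finset.range (r + 1), H (r + 1 - 1 - q + s) q
        = ∑ q ∈ Finset.range r, H (r - 1 - q + s) (q + 1) := by
      rw [Finset.sum_range_succ', h0, add_zero]
      exact Finset.sum_congr rfl fun q _ => by
        rw [show r + 1 - 1 - (q + 1) = r - 1 - q by omega]
    have e : Z r s = (∑ q ∈ Finset.range r, H (r - 1 - q + s) (q + 1))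
        + (∑ q ∈ Finset.range r, H (r - 1 - q + s + 1) q)
        - c • (∑ q ∈ Finset.range r, H (r - 1 - q + s) q)
        + (B (r + 1) s + B r (s + 1) - c • B r s) + ε • J r s := by
      simp only [hZdef]
      rw [hHLB (r + 1) s, hHLB r (s + 1), hHLB r s, h1, smul_add]
      simp only [← add_assoc]
      abel
    rw [e, hBrec]
    simp only [hZdef, Finset.sum_add_distrib, Finset.sum_sub_distrib, Finset.smul_sum]
    abel
  have hZ : ∀ N r s, r + s = N → Z r s = 0 := by
    intro N
    induction N using Nat.strong_induction_on with
    | _ N ih =>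
      intro r s hrs
      rw [hZrec]
      refine Finset.sum_eq_zero fun q hq => ?_
      rw [Finset.mem_range] at hq
      exact ih (N - 1) (by omega) _ _ (by omega)
  exact hZ _ r s rfl

/-- The auxiliary sequences are the entries of (M^s)^t M^q at (-t,t) and of M^p (M^s)^t at (t,-t).
Both recursions come from `IsFMatrix.tT_pow_succ`. They start from multiples of ε because
transposition acts on an entry (t,-t) or (-t,t) as the scalar ε. -/
theorem IsFMatrix.quaternary (hM : IsFMatrix M) (t : Idx κ k) (r s : ℕ) :
    ((M ^ (r + 1)) t t * (M ^ s) t t - (M ^ s) t t * (M ^ (r + 1)) t t)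
      + ((M ^ r) t t * (M ^ (s + 1)) t t - (M ^ (s + 1)) t t * (M ^ r) t t)
      - (2 * shift κ k : ℂ) • ((M ^ r) t t * (M ^ s) t t - (M ^ s) t t * (M ^ r) t t)
      + eps κ • ((M ^ r) t (negIdx t) * (M ^ s) (negIdx t) t
        - (M ^ s) t (negIdx t) * (M ^ r) (negIdx t) t) = 0 := by
  have hoff : ∀ X : Matrix (Idx κ k) (Idx κ k) A,
      tT X (negIdx t) t = eps κ • X (negIdx t) t := by
    intro X; rw [tT_apply, negIdx_negIdx, th_negIdx_self]
  have hoff' : ∀ X : Matrix (Idx κ k) (Idx κ k) A,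
      tT X t (negIdx t) = eps κ • X t (negIdx t) := by
    intro X; rw [tT_apply, negIdx_negIdx, th_self_negIdx]
  have hTc : ∀ s p, Commute (Matrix.scalar (Idx κ k) (M ^ s).trace) (M ^ p) := fun s p =>
    ((hM.pow s).scalar_trace_comm).pow_right p
  refine quaternary_of_recursion (2 * shift κ k) (eps κ) (fun r => (M ^ r) t t)
    (fun r => (M ^ r) t (negIdx t)) (fun r => (M ^ r) (negIdx t) t) (fun s => (M ^ s).trace)
    (fun s q => (tT (M ^ s) * M ^ q) (negIdx t) t) (fun p s => (M ^ p * tT (M ^ s)) t (negIdx t))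
    ?_ ?_ ?_ ?_ ?_ ?_ ?_ r s
  · simp
  · intro s p
    have := congrFun (congrFun (hTc s p).eq t) (negIdx t)
    simpa [Matrix.scalar_apply] using this
  · intro s q
    have e : tT (M ^ (s + 1)) * M ^ q = -(tT (M ^ s) * M ^ (q + 1))
        + (2 * shift κ k : ℂ) • (tT (M ^ s) * M ^ q) + eps κ • M ^ (s + q)
        - Matrix.scalar _ (M ^ s).trace * M ^ q := by
      rw [hM.tT_pow_succ, sub_mul, add_mul, add_mul, neg_mul, mul_assoc, ← pow_succ',
        smul_mul_assoc, smul_mul_assoc, ← pow_add]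
    rw [e]
    simp [Matrix.scalar_apply]
  · intro p s
    have e : M ^ p * tT (M ^ (s + 1)) = -(M ^ (p + 1) * tT (M ^ s))
        + (2 * shift κ k : ℂ) • (M ^ p * tT (M ^ s)) + eps κ • M ^ (p + s)
        - Matrix.scalar _ (M ^ s).trace * M ^ p := by
      rw [hM.tT_pow_succ, mul_sub, mul_add, mul_add, mul_neg, (hM.tT_pow_comm s).eq,
        ← mul_assoc, ← pow_succ, mul_smul_comm, mul_smul_comm, ← pow_add, (hTc s p).eq]
    rw [e]
    simp [Matrix.scalar_apply]
  · intro s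
    simp only [pow_zero, mul_one]; exact hoff _
  · intro s
    simp only [pow_zero, one_mul]; exact hoff' _
  · intro r s
    have := (hM.pow s).commutator_pow t r
    simp only [← pow_add] at this
    exact this

end moments

/-! ### The generators of `U(g_k)` -/

section generators

variable {κ : Series} {n k : ℕ}

theorem idxSet_mono {k n : ℕ} (h : k ≤ n) : idxSet κ k ⊆ idxSet κ n := by
  intro i hi
  cases κ <;> simp only [idxSet, Finset.mem_erase, Finset.mem_Icc] at hi ⊢ <;> omega

/-- The inclusion of the index sets. -/
def up (h : k ≤ n) (i : Idx κ k) : Idx κ n := ⟨i.1, idxSet_mono h i.2⟩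

theorem up_inj (h : k ≤ n) {i j : Idx κ k} : up h i = up h j ↔ i = j := by
  refine ⟨fun e => Subtype.ext ?_, congrArg _⟩
  simpa only [up] using congrArg Subtype.val e

theorem E_eq_single (i j : Idx κ n) : E κ n i.1 j.1 = Matrix.single i j 1 := by
  ext a b
  have h1 : a.1 = i.1 ↔ i = a := by rw [← Subtype.ext_iff, eq_comm]
  have h2 : b.1 = j.1 ↔ j = b := by rw [← Subtype.ext_iff, eq_comm]
  simp only [E, Matrix.of_apply, Matrix.single_apply, h1, h2]

theorem Fmat_eq (i j : Idx κ n) : Fmat κ n i.1 j.1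
    = Matrix.single i j 1 - th i j • Matrix.single (negIdx j) (negIdx i) 1 := by
  rw [Fmat, E_eq_single, ← E_eq_single (negIdx j)]; rfl

theorem Fmat_skew (i j : Idx κ n) :
    Fmat κ n i.1 j.1 = -(th i j • Fmat κ n (negIdx j).1 (negIdx i).1) := by
  rw [Fmat_eq, Fmat_eq, smul_sub, smul_smul, th_negIdx_negIdx, th_comm j i, th_mul_self]
  simp

theorem single_mul_single_ite (i j a b : Idx κ n) :
    (Matrix.single i j 1 * Matrix.single a b 1 : Matrix (Idx κ n) (Idx κ n) ℂ)
      = if a = j then Matrix.single i b 1 else 0 := by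
  split_ifs with h
  · rw [h]; simp
  · exact Matrix.single_mul_single_of_ne _ _ _ _ (Ne.symm h) _

theorem Fmat_tensor (i j a b : Idx κ n) :
    Fmat κ n i.1 j.1 * Fmat κ n a.1 b.1 - Fmat κ n a.1 b.1 * Fmat κ n i.1 j.1
      = (if a = j then Fmat κ n i.1 b.1 else 0) - (if b = i then Fmat κ n a.1 j.1 else 0)
        - (if a = negIdx i then th i j • Fmat κ n (negIdx j).1 b.1 else 0)
        + (if b = negIdx j then th i j • Fmat κ n a.1 (negIdx i).1 else 0) := by
  have n1 : (negIdx b = j) ↔ b = negIdx j := negIdx_eq_iff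
  have n2 : (i = negIdx a) ↔ a = negIdx i := by rw [eq_comm, negIdx_eq_iff]
  have n3 : (i = b) ↔ b = i := eq_comm
  have n4 : (negIdx j = b) ↔ b = negIdx j := eq_comm
  have n5 : (j = a) ↔ a = j := eq_comm
  simp only [Fmat_eq, mul_sub, sub_mul, mul_smul_comm, smul_mul_assoc, single_mul_single_ite,
    negIdx_inj, negIdx_negIdx, n1, n2, n3, n4, n5]
  have k1 : ∀ (p : Prop) [Decidable p] (x y : Matrix (Idx κ n) (Idx κ n) ℂ),
      (if p then x - y else 0) = (if p then x else 0) - (if p then y else 0) := by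
    intro p _ x y; split_ifs <;> simp
  -- The sign factors need to agree only on the support of the accompanying indicator.
  have k2 : ∀ (p : Prop) [Decidable p] (c c' : ℂ) (x : Matrix (Idx κ n) (Idx κ n) ℂ),
      (p → c = c') → (if p then c • x else 0) = if p then c' • x else 0 := by
    intro p _ c c' x h; split_ifs with hp
    · rw [h hp]
    · rfl
  simp only [smul_ite, smul_zero, smul_sub, smul_smul, k1]
  have hs := sg_mul_self (κ := κ) (k := n)
  have he := eps_mul_eps κ
  rw [k2 (b = negIdx j) (th a b) (th i j * th a (negIdx i)),
    k2 (a = negIdx i) (th a b) (th i j * th (negIdx j) b),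
    k2 (b = i) (th a b * th i j) (th a j), k2 (a = j) (th i j * th a b) (th i b)]
  · abel
  · rintro rfl; rw [th_mul_th]
  · rintro rfl; rw [th_mul_th]
  · rintro rfl; simp only [th_eq, sg_negIdx]
    linear_combination -eps κ * sg i * sg b * hs j
  · rintro rfl; simp only [th_eq, sg_negIdx]
    linear_combination -eps κ * sg a * sg j * hs i

theorem F_tensor (i j a b : Idx κ n) :
    ⁅F κ n i.1 j.1, F κ n a.1 b.1⁆
      = (if a = j then F κ n i.1 b.1 else 0) - (if b = i then F κ n a.1 j.1 else 0)
        - (if a = negIdx i then th i j • F κ n (negIdx j).1 b.1 else 0)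
        + (if b = negIdx j then th i j • F κ n a.1 (negIdx i).1 else 0) := by
  apply Subtype.ext
  have h : ∀ (p : Prop) [Decidable p] (x : g κ n),
      ((if p then x else 0 : g κ n) : Matrix (Idx κ n) (Idx κ n) ℂ) = if p then x.1 else 0 := by
    intro p _ x; split_ifs <;> rfl
  have := Fmat_tensor i j a b
  push_cast [LieSubalgebra.coe_bracket, h]
  exact this

theorem calF_isFMatrix (h : k ≤ n) : IsFMatrix (calF κ n k) where
  skew i j := by
    have e : F κ n i.1 j.1 = -(th i j • F κ n (negIdx j).1 (negIdx i).1) :=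
      Subtype.ext (Fmat_skew (up h i) (up h j))
    simp only [calF, Matrix.of_apply, UF]
    rw [e]; simp
  tensor i j a b := by
    have e := congrArg (UniversalEnvelopingAlgebra.ι ℂ) (F_tensor (up h i) (up h j) (up h a) (up h b))
    rw [LieHom.map_lie, LieRing.of_associative_ring_bracket] at e
    have e' : calF κ n k i j * calF κ n k a b - calF κ n k a b * calF κ n k i j = _ := e
    rw [e']
    have n1 : (up h a = negIdx (up h i)) ↔ a = negIdx i := up_inj h (j := negIdx i)
    have n2 : (up h b = negIdx (up h j)) ↔ b = negIdx j := up_inj h (j := negIdx j)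
    simp only [up_inj, n1, n2, map_add, map_sub, apply_ite (UniversalEnvelopingAlgebra.ι ℂ), map_zero, map_smul]
    rfl

theorem UF_mem_Usub (i j : Idx κ k) : UF κ n i.1 j.1 ∈ Usub κ n k :=
  Algebra.subset_adjoin ⟨i.1, i.2, j.1, j.2, rfl⟩

theorem calF_pow_mem_Usub (r : ℕ) (i j : Idx κ k) : (calF κ n k ^ r) i j ∈ Usub κ n k := by
  induction r generalizing i j with
  | zero =>
    rw [pow_zero, Matrix.one_apply]; split_ifs
    · exact one_mem _
    · exact zero_mem _
  | succ r ih =>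
    rw [pow_succ, Matrix.mul_apply]
    exact sum_mem fun c _ => mul_mem (ih _ _) (UF_mem_Usub _ _)

theorem mem_centralizer_Usub {z : U κ n}
    (hz : ∀ i j : Idx κ k, UF κ n i.1 j.1 * z = z * UF κ n i.1 j.1) :
    z ∈ Subalgebra.centralizer ℂ (Usub κ n k : Set (U κ n)) := by
  rw [Subalgebra.mem_centralizer_iff]
  have : Usub κ n k ≤ Subalgebra.centralizer ℂ {z} := by
    refine Algebra.adjoin_le ?_
    rintro _ ⟨i, hi, j, hj, rfl⟩
    rw [SetLike.mem_coe, Subalgebra.mem_centralizer_iff]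
    rintro _ rfl
    exact (hz ⟨i, hi⟩ ⟨j, hj⟩).symm
  intro x hx
  exact ((Subalgebra.mem_centralizer_iff ℂ).1 (this hx) z rfl).symm

theorem Ucenter_comm {z x : U κ n} (hz : z ∈ Ucenter κ n k) (hx : x ∈ Usub κ n k) :
    x * z = z * x :=
  (Subalgebra.mem_centralizer_iff ℂ).1 hz.2 x hx

theorem trace_pow_mem_Ucenter (h : k ≤ n) (r : ℕ) :
    (calF κ n k ^ r).trace ∈ Ucenter κ n k := by
  refine ⟨sum_mem fun i _ => calF_pow_mem_Usub r i i, mem_centralizer_Usub fun i j => ?_⟩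
  exact ((calF_isFMatrix h).pow r).trace_comm i j

theorem chiCoeff_mem_Ucenter (r : ℕ) : chiCoeff κ n k r ∈ Ucenter κ n k := by
  rw [chiCoeff]; split_ifs with h
  · exact h.choose_spec.1
  · exact zero_mem _

theorem Usub_mono {k l : ℕ} (h : k ≤ l) : Usub κ n k ≤ Usub κ n l := by
  refine Algebra.adjoin_mono ?_
  rintro _ ⟨i, hi, j, hj, rfl⟩
  exact ⟨i, idxSet_mono h hi, j, idxSet_mono h hj, rfl⟩

theorem Ucenter_le_Ucentralizer {z : U κ n} (hz : z ∈ Ucenter κ n k) : z ∈ Ucentralizer κ n k :=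
  ⟨hz.1, Subalgebra.centralizer_le _ _ _ (Usub_mono (Nat.sub_le k 1)) hz.2⟩

/-- The index k differs from ±i whenever |i| < k, so none of the four bracket terms survives. -/
theorem pow_top_mem_Ucentralizer (h : k ≤ n) (hk : 1 ≤ k) (r : ℕ) :
    (calF κ n k ^ r) (topIdx κ hk) (topIdx κ hk) ∈ Ucentralizer κ n k := by
  refine ⟨calF_pow_mem_Usub r _ _, mem_centralizer_Usub fun i j => ?_⟩
  have hle : k - 1 ≤ k := Nat.sub_le k 1
  have e := (calF_isFMatrix h).pow r (up hle i) (up hle j) (topIdx κ hk) (topIdx κ hk)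
  have hne : ∀ i : Idx κ (k - 1), topIdx κ hk ≠ up hle i ∧ topIdx κ hk ≠ negIdx (up hle i) := by
    intro i
    have hi := i.2
    have : -((k - 1 : ℕ) : ℤ) ≤ i.1 ∧ i.1 ≤ (k - 1 : ℕ) := by
      revert hi; generalize i.1 = z; intro hi
      cases κ <;> simp only [idxSet, Finset.mem_erase, Finset.mem_Icc] at hi <;> omega
    constructor <;> intro he
    · have := congrArg Subtype.val he
      simp only [topIdx, up] at this; omega
    · have := congrArg Subtype.val he
      simp only [topIdx, up, negIdx] at this; omega
  simp only [brk, (hne i).1, (hne j).1, (hne i).2, (hne j).2, if_false, sub_zero, add_zero] at e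
  exact sub_eq_zero.1 e

/-- The series `(u + c)⁻¹` in `X = u⁻¹`, where `c` is the shift. -/
def Vser (κ : Series) (k : ℕ) : PowerSeries ℂ :=
  PowerSeries.X * (1 + PowerSeries.C (shift κ k) * PowerSeries.X)⁻¹

theorem Vser_mul (κ : Series) (k : ℕ) :
    Vser κ k * (1 + PowerSeries.C (shift κ k) * PowerSeries.X) = PowerSeries.X := by
  rw [Vser, mul_assoc, PowerSeries.inv_mul_cancel _ (by simp), mul_one]

theorem coeff_Vser_pow_of_lt {i r : ℕ} (h : i < r) :
    PowerSeries.coeff i (Vser κ k ^ r) = 0 := by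
  rw [Vser, mul_pow, PowerSeries.coeff_X_pow_mul', if_neg (not_le.2 h)]

theorem coeff_resolvent (i : ℕ) : PowerSeries.coeff i (resolvent κ n k)
    = ∑ r ∈ Finset.range (i + 1),
        (PowerSeries.coeff i (Vser κ k ^ r)) • calF κ n k ^ r := by
  set R' : PowerSeries (Matrix (Idx κ k) (Idx κ k) (U κ n)) := PowerSeries.mk fun i =>
    ∑ r ∈ Finset.range (i + 1), (PowerSeries.coeff i (Vser κ k ^ r)) • calF κ n k ^ r with hR'
  set W := PowerSeries.C (calF κ n k) *
      PowerSeries.map (algebraMap ℂ (Matrix (Idx κ k) (Idx κ k) (U κ n))) (Vser κ k) with hW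
  have hext : ∀ i N, i ≤ N → PowerSeries.coeff i R' = ∑ r ∈ Finset.range (N + 1),
      (PowerSeries.coeff i (Vser κ k ^ r)) • calF κ n k ^ r := by
    intro i N h
    rw [hR', PowerSeries.coeff_mk]
    refine Finset.sum_subset (Finset.range_mono (by omega)) fun r _ hr => ?_
    rw [Finset.mem_range, not_lt] at hr
    rw [coeff_Vser_pow_of_lt (by omega), zero_smul]
  have hWR : W * R' = R' - 1 := by
    ext1 i
    rw [PowerSeries.coeff_mul, map_sub, hext i (i + 1) (by omega), Finset.sum_range_succ']
    have e0 : PowerSeries.coeff i (Vser κ k ^ 0) • calF κ n k ^ 0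
        = PowerSeries.coeff i (1 : PowerSeries (Matrix (Idx κ k) (Idx κ k) (U κ n))) := by
      rw [pow_zero, pow_zero, PowerSeries.coeff_one, PowerSeries.coeff_one]
      split_ifs <;> simp
    rw [e0, add_sub_cancel_right]
    have e1 : ∀ p ∈ Finset.HasAntidiagonal.antidiagonal i, PowerSeries.coeff p.1 W * PowerSeries.coeff p.2 R'
        = ∑ r ∈ Finset.range (i + 1), (PowerSeries.coeff p.1 (Vser κ k)
          * PowerSeries.coeff p.2 (Vser κ k ^ r)) • calF κ n k ^ (r + 1) := by
      intro p hp
      rw [Finset.HasAntidiagonal.mem_antidiagonal] at hp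
      rw [hext p.2 i (by omega), hW, PowerSeries.coeff_C_mul, PowerSeries.coeff_map,
        Finset.mul_sum]
      refine Finset.sum_congr rfl fun r _ => ?_
      rw [mul_smul_comm, ← Algebra.commutes, mul_assoc, ← pow_succ', ← Algebra.smul_def,
        smul_smul, mul_comm]
    rw [Finset.sum_congr rfl e1, Finset.sum_comm]
    refine Finset.sum_congr rfl fun r _ => ?_
    rw [pow_succ' (Vser κ k), PowerSeries.coeff_mul, Finset.sum_smul]
  -- The geometric series is a right inverse and the resolvent a left inverse of the same element,
  -- so they coincide even over a noncommutative ring.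
  have h1 : (1 - W) * R' = 1 := by rw [sub_mul, hWR]; simp
  have h2 : resolvent κ n k * (1 - W) = 1 := by
    refine PowerSeries.invOfUnit_mul _ _ ?_
    simp
  have h3 : resolvent κ n k = R' := by
    rw [← mul_one (resolvent κ n k), ← h1, ← mul_assoc, h2, one_mul]
  rw [h3, hR', PowerSeries.coeff_mk]

/-- The coefficient `κ_{i,r}` of `(𝓕^{(k)})^r u^{-i}` in `χ_k(u) (1 - 𝓕^{(k)} / (u + c))⁻¹`. -/
def phiScalar (κ : Series) (n k i r : ℕ) : U κ n :=
  ∑ p ∈ Finset.HasAntidiagonal.antidiagonal i,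
    (PowerSeries.coeff p.2 (Vser κ k ^ r)) • chiCoeff κ n k p.1

theorem phiScalar_mem_Ucenter (i r : ℕ) : phiScalar κ n k i r ∈ Ucenter κ n k :=
  sum_mem fun _ _ => Subalgebra.smul_mem _ (chiCoeff_mem_Ucenter _) _

/-- The free bound N allows coefficients of different orders to be summed over a common range; the
surplus terms vanish. -/
theorem phiCoeff_eq (i N : ℕ) (hN : i ≤ N) (a b : Idx κ k) : phiCoeff κ n k i a b
    = ∑ r ∈ Finset.range (N + 1), phiScalar κ n k i r * (calF κ n k ^ r) a b := by
  have hext : ∀ j ≤ N, PowerSeries.coeff j (resolvent κ n k) a b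
      = ∑ r ∈ Finset.range (N + 1),
        (PowerSeries.coeff j (Vser κ k ^ r)) • (calF κ n k ^ r) a b := by
    intro j h
    rw [coeff_resolvent, Matrix.sum_apply]
    refine Finset.sum_subset (Finset.range_mono (by omega)) fun r _ hr => ?_
    rw [Finset.mem_range, not_lt] at hr
    rw [coeff_Vser_pow_of_lt (by omega), zero_smul, Matrix.zero_apply]
  rw [phiCoeff, phiSeries, PowerSeries.coeff_mul]
  simp only [phiScalar, Finset.sum_mul]
  rw [Finset.sum_comm]
  refine Finset.sum_congr rfl fun p hp => ?_
  rw [Finset.HasAntidiagonal.mem_antidiagonal] at hp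
  rw [PowerSeries.coeff_mk, chi, PowerSeries.coeff_mk, hext p.2 (by omega), Finset.mul_sum]
  exact Finset.sum_congr rfl fun r _ => by rw [mul_smul_comm, smul_mul_assoc]

theorem phiCoeff_mem_Ucentralizer (h : k ≤ n) (hk : 1 ≤ k) (i : ℕ) :
    phiCoeff κ n k i (topIdx κ hk) (topIdx κ hk) ∈ Ucentralizer κ n k := by
  rw [phiCoeff_eq i i le_rfl]
  exact sum_mem fun r _ => mul_mem (Ucenter_le_Ucentralizer (phiScalar_mem_Ucenter i r))
    (pow_top_mem_Ucentralizer h hk r)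

theorem S_mem_Ucenter (h : k ≤ n) (m : ℕ) : S κ n k m ∈ Ucenter κ n k :=
  trace_pow_mem_Ucenter h _

end generators

/-! ### The action on polynomial functions and symbols -/

section symbols

variable {ι : Type} [Fintype ι] [DecidableEq ι]

/-- The derivation `x_{ab} ↦ ∑_c Y_{ca} x_{cb}` of the polynomial algebra. -/
def matDer (Y : Matrix ι ι ℂ) :
    Derivation ℂ (MvPolynomial (ι × ι) ℂ) (MvPolynomial (ι × ι) ℂ) :=
  MvPolynomial.mkDerivation ℂ fun p => ∑ c, Y c p.1 • MvPolynomial.X (c, p.2)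

theorem matDer_X (Y : Matrix ι ι ℂ) (a b : ι) :
    matDer Y (MvPolynomial.X (a, b)) = ∑ c, Y c a • MvPolynomial.X (c, b) :=
  MvPolynomial.mkDerivation_X ..

theorem matDer_add (Y Z : Matrix ι ι ℂ) : matDer (Y + Z) = matDer Y + matDer Z := by
  refine MvPolynomial.derivation_ext fun p => ?_
  obtain ⟨a, b⟩ := p
  simp [matDer_X, add_smul, Finset.sum_add_distrib]

theorem matDer_smul (c : ℂ) (Y : Matrix ι ι ℂ) : matDer (c • Y) = c • matDer Y := by
  refine MvPolynomial.derivation_ext fun p => ?_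
  obtain ⟨a, b⟩ := p
  simp [matDer_X, mul_smul, Finset.smul_sum]

theorem matDer_lie (Y Z : Matrix ι ι ℂ) (p : MvPolynomial (ι × ι) ℂ) :
    matDer ⁅Y, Z⁆ p = matDer Y (matDer Z p) - matDer Z (matDer Y p) := by
  have : matDer ⁅Y, Z⁆ = ⁅matDer Y, matDer Z⁆ := by
    refine MvPolynomial.derivation_ext fun p => ?_
    obtain ⟨a, b⟩ := p
    have h : ∀ Y Z : Matrix ι ι ℂ, matDer Y (matDer Z (MvPolynomial.X (a, b)))
        = ∑ d, (Y * Z) d a • MvPolynomial.X (d, b) := by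
      intro Y Z
      simp only [matDer_X, map_sum, Derivation.map_smul, Finset.smul_sum, Matrix.mul_apply, Finset.sum_smul]
      rw [Finset.sum_comm]
      simp only [smul_smul, mul_comm]
    rw [Derivation.commutator_apply, h, h, matDer_X, LieRing.of_associative_ring_bracket,
      ← Finset.sum_sub_distrib]
    simp [sub_smul]
  rw [this, Derivation.commutator_apply]

variable (L : LieSubalgebra ℂ (Matrix ι ι ℂ))

/-- The action of a matrix Lie algebra on polynomial functions on matrices. -/
def polyRep : L →ₗ⁅ℂ⁆ Module.End ℂ (MvPolynomial (ι × ι) ℂ) where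
  toFun Y := (matDer Y.1).toLinearMap
  map_add' Y Z := by
    ext1 p; simp [matDer_add]
  map_smul' c Y := by
    ext1 p; simp [matDer_smul]
  map_lie' {Y Z} := by
    refine LinearMap.ext fun p => ?_
    exact matDer_lie Y.1 Z.1 p

/-- The linear function `∑ M_{ab} x_{ab}`. -/
def linFun (M : Matrix ι ι ℂ) : MvPolynomial (ι × ι) ℂ :=
  ∑ a, ∑ b, M a b • MvPolynomial.X (a, b)

/-- A derivation applied to the coefficients of a power series. -/
def coeffDer (Y : Matrix ι ι ℂ) :
    PowerSeries (MvPolynomial (ι × ι) ℂ) →ₗ[ℂ] PowerSeries (MvPolynomial (ι × ι) ℂ) where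
  toFun p := PowerSeries.mk fun n => matDer Y (PowerSeries.coeff n p)
  map_add' p q := by ext1 n; simp
  map_smul' c p := by
    ext1 n
    have h : ∀ p : PowerSeries (MvPolynomial (ι × ι) ℂ),
      PowerSeries.coeff n (c • p) = c • PowerSeries.coeff n p := fun p => rfl
    simp [h]

theorem coeff_coeffDer (Y : Matrix ι ι ℂ) (p : PowerSeries (MvPolynomial (ι × ι) ℂ)) (n : ℕ) :
    PowerSeries.coeff n (coeffDer Y p) = matDer Y (PowerSeries.coeff n p) :=
  PowerSeries.coeff_mk n fun n => matDer Y (PowerSeries.coeff n p)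

theorem coeffDer_mul (Y : Matrix ι ι ℂ) (p q : PowerSeries (MvPolynomial (ι × ι) ℂ)) :
    coeffDer Y (p * q) = coeffDer Y p * q + p * coeffDer Y q := by
  ext1 n
  rw [coeff_coeffDer, map_add, PowerSeries.coeff_mul, PowerSeries.coeff_mul, PowerSeries.coeff_mul,
    map_sum, ← Finset.sum_add_distrib]
  refine Finset.sum_congr rfl fun x _ => ?_
  rw [coeff_coeffDer, coeff_coeffDer, Derivation.leibniz, smul_eq_mul, smul_eq_mul]
  ring

/-- The operator `D_Y + t D_Y(f)`, with `f = ∑ M_{ab} x_{ab}`. -/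
def twist (M Y : Matrix ι ι ℂ) :
    PowerSeries (MvPolynomial (ι × ι) ℂ) →ₗ[ℂ] PowerSeries (MvPolynomial (ι × ι) ℂ) :=
  coeffDer Y + LinearMap.mulLeft ℂ (PowerSeries.C (matDer Y (linFun M)) * PowerSeries.X)

theorem twist_apply (M Y : Matrix ι ι ℂ) (p : PowerSeries (MvPolynomial (ι × ι) ℂ)) :
    twist M Y p = coeffDer Y p + PowerSeries.C (matDer Y (linFun M)) * PowerSeries.X * p := rfl

/-- The twisted action. -/
def twistRep (M : Matrix ι ι ℂ) :
    L →ₗ⁅ℂ⁆ Module.End ℂ (PowerSeries (MvPolynomial (ι × ι) ℂ)) where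
  toFun Y := twist M Y.1
  map_add' Y Z := by
    refine LinearMap.ext fun p => PowerSeries.ext fun n => ?_
    have e : twist M (Y + Z : Matrix ι ι ℂ) p = twist M Y.1 p + twist M Z.1 p := by
      rw [twist_apply, twist_apply, twist_apply]
      have : coeffDer (Y.1 + Z.1) p = coeffDer Y.1 p + coeffDer Z.1 p := by
        ext1 n; simp [coeff_coeffDer, matDer_add]
      rw [this, matDer_add, Derivation.add_apply, map_add]; ring
    exact congrArg _ e
  map_smul' c Y := by
    refine LinearMap.ext fun p => PowerSeries.ext fun n => ?_
    have e : twist M (c • Y : Matrix ι ι ℂ) p = c • twist M Y.1 p := by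
      rw [twist_apply, twist_apply]
      have : coeffDer (c • Y.1) p = c • coeffDer Y.1 p := by
        ext1 n
        change _ = c • PowerSeries.coeff n (coeffDer Y.1 p)
        simp [coeff_coeffDer, matDer_smul]
      rw [this, matDer_smul, Derivation.smul_apply, smul_add]
      congr 1
      have : PowerSeries.C (c • matDer Y.1 (linFun M)) = c • PowerSeries.C (matDer Y.1 (linFun M)) := by
        ext1 n
        change _ = c • PowerSeries.coeff n (PowerSeries.C (matDer Y.1 (linFun M)))
        rw [PowerSeries.coeff_C, PowerSeries.coeff_C]; split_ifs <;> simp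
      rw [this, smul_mul_assoc, smul_mul_assoc]
    exact congrArg _ e
  map_lie' {Y Z} := by
    refine LinearMap.ext fun p => ?_
    have e : twist M ⁅Y.1, Z.1⁆ p = twist M Y.1 (twist M Z.1 p) - twist M Z.1 (twist M Y.1 p) := by
      have h1 : coeffDer ⁅Y.1, Z.1⁆ p = coeffDer Y.1 (coeffDer Z.1 p)
          - coeffDer Z.1 (coeffDer Y.1 p) := by
        ext1 n; simp [coeff_coeffDer, matDer_lie]
      have h2 : ∀ (Y : Matrix ι ι ℂ) h, coeffDer Y (PowerSeries.C h * PowerSeries.X)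
          = PowerSeries.C (matDer Y h) * PowerSeries.X := by
        intro Y h
        ext1 n
        rw [coeff_coeffDer, PowerSeries.coeff_C_mul, PowerSeries.coeff_C_mul, PowerSeries.coeff_X]
        split_ifs <;> simp
      simp only [twist_apply, map_add, coeffDer_mul, h1, h2, matDer_lie, map_sub]
      ring
    exact e

/-- The action of the enveloping algebra on polynomials. -/
abbrev polyAct : UniversalEnvelopingAlgebra ℂ L →ₐ[ℂ] Module.End ℂ (MvPolynomial (ι × ι) ℂ) :=
  UniversalEnvelopingAlgebra.lift ℂ (polyRep L)

/-- The twisted action of the enveloping algebra. -/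
abbrev twistAct (M : Matrix ι ι ℂ) : UniversalEnvelopingAlgebra ℂ L →ₐ[ℂ]
    Module.End ℂ (PowerSeries (MvPolynomial (ι × ι) ℂ)) :=
  UniversalEnvelopingAlgebra.lift ℂ (twistRep L M)

variable {L}

/-- The elements with property P form a subalgebra containing the Lie algebra. The universal
property maps the enveloping algebra into it, and the composite with the inclusion is the identity.
-/
theorem uea_induction {P : UniversalEnvelopingAlgebra ℂ L → Prop}
    (hι : ∀ Y, P (UniversalEnvelopingAlgebra.ι ℂ Y)) (hc : ∀ c, P (algebraMap ℂ _ c))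
    (hadd : ∀ x y, P x → P y → P (x + y)) (hmul : ∀ x y, P x → P y → P (x * y))
    (u : UniversalEnvelopingAlgebra ℂ L) : P u := by
  let T : Subalgebra ℂ (UniversalEnvelopingAlgebra ℂ L) :=
    { carrier := {x | P x}
      mul_mem' := fun {x y} hx hy => hmul x y hx hy
      add_mem' := fun {x y} hx hy => hadd x y hx hy
      algebraMap_mem' := hc }
  let j : L →ₗ⁅ℂ⁆ T :=
    { toFun := fun Y => ⟨UniversalEnvelopingAlgebra.ι ℂ Y, hι Y⟩
      map_add' := fun Y Z => Subtype.ext (map_add _ Y Z)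
      map_smul' := fun c Y => Subtype.ext (map_smul _ c Y)
      map_lie' := fun {Y Z} => Subtype.ext (LieHom.map_lie _ Y Z) }
  have h : T.val.comp (UniversalEnvelopingAlgebra.lift ℂ j) = AlgHom.id ℂ (UniversalEnvelopingAlgebra ℂ L) := by
    apply UniversalEnvelopingAlgebra.hom_ext
    refine LieHom.ext fun Y => ?_
    change ((UniversalEnvelopingAlgebra.lift ℂ j) (UniversalEnvelopingAlgebra.ι ℂ Y) : T).1 = _
    rw [UniversalEnvelopingAlgebra.lift_ι_apply]
    rfl
  have := DFunLike.congr_fun h u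
  rw [AlgHom.id_apply] at this
  rw [← this]
  exact ((UniversalEnvelopingAlgebra.lift ℂ j) u).2

/-- The series `exp(t f)`. -/
def expSer (M : Matrix ι ι ℂ) : PowerSeries (MvPolynomial (ι × ι) ℂ) :=
  PowerSeries.mk fun n => ((n.factorial : ℂ)⁻¹) • linFun M ^ n

theorem coeffDer_expSer (M Y : Matrix ι ι ℂ) : coeffDer Y (expSer M)
    = PowerSeries.C (matDer Y (linFun M)) * PowerSeries.X * expSer M := by
  ext1 n
  rw [coeff_coeffDer, expSer, PowerSeries.coeff_mk, mul_assoc, PowerSeries.coeff_C_mul]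
  cases n with
  | zero => simp
  | succ n =>
    rw [PowerSeries.coeff_succ_X_mul, PowerSeries.coeff_mk, Derivation.map_smul, Derivation.leibniz_pow,
      Nat.add_sub_cancel, Nat.factorial_succ, ← Nat.cast_smul_eq_nsmul ℂ, smul_smul]
    have : (((n + 1) * n.factorial : ℕ) : ℂ)⁻¹ * ((n + 1 : ℕ) : ℂ) = ((n.factorial : ℕ) : ℂ)⁻¹ := by
      push_cast
      have : (n : ℂ) + 1 ≠ 0 := by exact_mod_cast Nat.succ_ne_zero n
      field_simp
    rw [this, smul_eq_mul, mul_smul_comm, mul_comm]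

/-- On generators this is exp(-tf) ∘ D_Y ∘ exp(tf) = D_Y + t D_Y(f); the general case follows by
multiplicativity. -/
theorem twistAct_intertwine (M : Matrix ι ι ℂ) (u : UniversalEnvelopingAlgebra ℂ L) :
    ∀ (p : PowerSeries (MvPolynomial (ι × ι) ℂ)) (n : ℕ),
      PowerSeries.coeff n (expSer M * twistAct L M u p)
        = polyAct L u (PowerSeries.coeff n (expSer M * p)) := by
  induction u using uea_induction with
  | hι Y =>
    intro p n
    rw [UniversalEnvelopingAlgebra.lift_ι_apply, UniversalEnvelopingAlgebra.lift_ι_apply]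
    change PowerSeries.coeff n (expSer M * twist M Y.1 p)
      = matDer Y.1 (PowerSeries.coeff n (expSer M * p))
    rw [← coeff_coeffDer, coeffDer_mul, coeffDer_expSer, twist_apply]
    congr 1; ring
  | hc c =>
    intro p n
    rw [AlgHom.commutes, AlgHom.commutes, Module.algebraMap_end_apply,
      Module.algebraMap_end_apply, mul_smul_comm]
    rfl
  | hadd x y hx hy =>
    intro p n
    rw [map_add, map_add, LinearMap.add_apply, LinearMap.add_apply, mul_add, map_add, hx, hy]
  | hmul x y hx hy =>
    intro p n
    rw [map_mul (twistAct L M), map_mul (polyAct L), Module.End.mul_apply, Module.End.mul_apply,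
      hx, hy]

/-- The series exp(tf) has constant term 1, so multiplication by it is invertible. -/
theorem twistAct_eq_zero (M : Matrix ι ι ℂ) {u : UniversalEnvelopingAlgebra ℂ L}
    (hu : polyAct L u = 0) : twistAct L M u = 0 := by
  refine LinearMap.ext fun p => ?_
  have h : expSer M * twistAct L M u p = 0 := by
    ext1 n
    rw [twistAct_intertwine, hu]; simp
  have h1 : IsUnit (expSer M) := by
    rw [PowerSeries.isUnit_iff_constantCoeff, ← PowerSeries.coeff_zero_eq_constantCoeff_apply]
    simp [expSer]
  exact (h1.mul_right_eq_zero).1 h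

/-- `u` raises the degree in `t` by at most `d`, and acts on the top coefficients as the
multiplication by `s`: the symbol of order `d` of `u` at the differential of `∑ M_{ab} x_{ab}`
is `s`. -/
def IsSymbol (M : Matrix ι ι ℂ) (d : ℕ) (u : UniversalEnvelopingAlgebra ℂ L)
    (s : MvPolynomial (ι × ι) ℂ) : Prop :=
  ∀ (e : ℕ) (p : PowerSeries (MvPolynomial (ι × ι) ℂ)), (∀ n, e < n → PowerSeries.coeff n p = 0) →
    (∀ n, d + e < n → PowerSeries.coeff n (twistAct L M u p) = 0) ∧
      PowerSeries.coeff (d + e) (twistAct L M u p) = s * PowerSeries.coeff e p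

section

variable {M : Matrix ι ι ℂ} {d d' : ℕ} {u v : UniversalEnvelopingAlgebra ℂ L}
  {s s' : MvPolynomial (ι × ι) ℂ}

theorem isSymbol_ι (Y : L) :
    IsSymbol M 1 (UniversalEnvelopingAlgebra.ι ℂ Y) (matDer Y.1 (linFun M)) := by
  intro e p hp
  rw [UniversalEnvelopingAlgebra.lift_ι_apply]
  change (∀ n, 1 + e < n → PowerSeries.coeff n (twist M Y.1 p) = 0) ∧
    PowerSeries.coeff (1 + e) (twist M Y.1 p) = _
  have h : ∀ n, PowerSeries.coeff (n + 1) (twist M Y.1 p) = matDer Y.1 (PowerSeries.coeff (n + 1) p)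
      + matDer Y.1 (linFun M) * PowerSeries.coeff n p := by
    intro n
    rw [twist_apply, map_add, coeff_coeffDer, mul_assoc, PowerSeries.coeff_C_mul,
      PowerSeries.coeff_succ_X_mul]
  constructor
  · intro n hn
    obtain ⟨m, rfl⟩ := Nat.exists_eq_add_of_lt hn
    rw [h, hp _ (by omega), hp _ (by omega)]; simp
  · rw [add_comm, h, hp _ (by omega)]; simp

theorem isSymbol_algebraMap (c : ℂ) :
    IsSymbol (L := L) M 0 (algebraMap ℂ _ c) (MvPolynomial.C c) := by
  intro e p hp
  rw [AlgHom.commutes, Module.algebraMap_end_apply]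
  have h : ∀ n, PowerSeries.coeff n (c • p) = c • PowerSeries.coeff n p := fun n => rfl
  constructor
  · intro n hn; rw [h, hp _ (by omega), smul_zero]
  · rw [zero_add, h, MvPolynomial.smul_eq_C_mul]

theorem IsSymbol.add (hu : IsSymbol M d u s) (hv : IsSymbol M d v s') :
    IsSymbol M d (u + v) (s + s') := by
  intro e p hp
  obtain ⟨h1, h2⟩ := hu e p hp
  obtain ⟨h3, h4⟩ := hv e p hp
  rw [map_add, LinearMap.add_apply]
  exact ⟨fun n hn => by rw [map_add, h1 n hn, h3 n hn, add_zero], by rw [map_add, h2, h4, add_mul]⟩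

theorem IsSymbol.mul (hu : IsSymbol M d u s) (hv : IsSymbol M d' v s') :
    IsSymbol M (d + d') (u * v) (s * s') := by
  intro e p hp
  obtain ⟨h3, h4⟩ := hv e p hp
  obtain ⟨h1, h2⟩ := hu (d' + e) _ h3
  rw [map_mul, Module.End.mul_apply, add_assoc]
  exact ⟨h1, by rw [h2, h4, mul_assoc]⟩

theorem IsSymbol.of_lt (hu : IsSymbol M d u s) (h : d < d') : IsSymbol M d' u 0 := by
  intro e p hp
  obtain ⟨h1, h2⟩ := hu e p hp
  exact ⟨fun n hn => h1 n (by omega), by rw [h1 _ (by omega), zero_mul]⟩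

theorem isSymbol_zero : IsSymbol (L := L) M d 0 0 := by
  intro e p _
  simp

theorem IsSymbol.eq_zero (hu : IsSymbol M d u s) (h : twistAct L M u = 0) : s = 0 := by
  have h1 := (hu 0 1 fun n hn => by rw [PowerSeries.coeff_one, if_neg (by omega)]).2
  rw [h] at h1
  simpa using h1.symm

end

/-- The evaluation at the identity matrix. -/
def evOne : MvPolynomial (ι × ι) ℂ →ₐ[ℂ] ℂ :=
  MvPolynomial.aeval fun p => if p.1 = p.2 then 1 else 0

/-- Evaluation at the identity matrix turns the symbol, a priori a polynomial function, into a
number depending only on the functional Y ↦ Tr(MY). -/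
theorem evOne_matDer (M Y : Matrix ι ι ℂ) : evOne (matDer Y (linFun M)) = (M * Y).trace := by
  simp only [linFun, map_sum, Derivation.map_smul, map_smul, matDer_X, evOne,
    MvPolynomial.aeval_X, Matrix.trace, Matrix.diag, Matrix.mul_apply]
  simp

/-- The symbol of order `d` of `u` takes the value `c` at the linear functional given by `M`. -/
def SymbolAt (M : Matrix ι ι ℂ) (d : ℕ) (u : UniversalEnvelopingAlgebra ℂ L) (c : ℂ) : Prop :=
  ∃ s, IsSymbol M d u s ∧ evOne s = c

section

variable {M : Matrix ι ι ℂ} {d d' : ℕ} {u v : UniversalEnvelopingAlgebra ℂ L} {c c' : ℂ}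

theorem symbolAt_ι (Y : L) : SymbolAt M 1 (UniversalEnvelopingAlgebra.ι ℂ Y) (M * Y.1).trace :=
  ⟨_, isSymbol_ι Y, evOne_matDer M Y.1⟩

theorem symbolAt_algebraMap (c : ℂ) : SymbolAt (L := L) M 0 (algebraMap ℂ _ c) c :=
  ⟨_, isSymbol_algebraMap c, by simp [evOne]⟩

theorem symbolAt_one : SymbolAt (L := L) M 0 1 1 := by
  simpa using symbolAt_algebraMap (L := L) (M := M) 1

theorem SymbolAt.add (hu : SymbolAt M d u c) (hv : SymbolAt M d v c') :
    SymbolAt M d (u + v) (c + c') := by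
  obtain ⟨s, h, rfl⟩ := hu
  obtain ⟨s', h', rfl⟩ := hv
  exact ⟨_, h.add h', map_add _ _ _⟩

theorem SymbolAt.mul (hu : SymbolAt M d u c) (hv : SymbolAt M d' v c') :
    SymbolAt M (d + d') (u * v) (c * c') := by
  obtain ⟨s, h, rfl⟩ := hu
  obtain ⟨s', h', rfl⟩ := hv
  exact ⟨_, h.mul h', map_mul _ _ _⟩

theorem SymbolAt.smul (b : ℂ) (hu : SymbolAt M d u c) : SymbolAt M d (b • u) (b * c) := by
  have := (symbolAt_algebraMap (L := L) (M := M) b).mul hu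
  rwa [zero_add, ← Algebra.smul_def] at this

theorem SymbolAt.neg (hu : SymbolAt M d u c) : SymbolAt M d (-u) (-c) := by
  simpa using hu.smul (-1)

theorem SymbolAt.sub (hu : SymbolAt M d u c) (hv : SymbolAt M d v c') :
    SymbolAt M d (u - v) (c - c') := by
  rw [sub_eq_add_neg, sub_eq_add_neg]; exact hu.add hv.neg

theorem SymbolAt.of_lt (hu : SymbolAt M d u c) (h : d < d') : SymbolAt M d' u 0 := by
  obtain ⟨s, h', rfl⟩ := hu
  exact ⟨0, h'.of_lt h, map_zero _⟩

theorem symbolAt_zero : SymbolAt (L := L) M d 0 0 := ⟨0, isSymbol_zero, map_zero _⟩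

theorem SymbolAt.sum {β : Type*} (S : Finset β) {w : β → UniversalEnvelopingAlgebra ℂ L}
    {z : β → ℂ} (h : ∀ b ∈ S, SymbolAt M d (w b) (z b)) :
    SymbolAt M d (∑ b ∈ S, w b) (∑ b ∈ S, z b) := by
  classical
  induction S using Finset.induction_on with
  | empty => simpa using symbolAt_zero
  | insert a S ha ih =>
    rw [Finset.sum_insert ha, Finset.sum_insert ha]
    exact (h a (Finset.mem_insert_self _ _)).add
      (ih fun b hb => h b (Finset.mem_insert_of_mem hb))

theorem SymbolAt.eq_zero (hu : SymbolAt M d u c) (h : polyAct L u = 0) : c = 0 := by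
  obtain ⟨s, h', rfl⟩ := hu
  rw [h'.eq_zero (twistAct_eq_zero M h), map_zero]

end

/-! ### The action on polynomials is faithful -/

/-- A basis of the Lie algebra. -/
abbrev lieBasis (L : LieSubalgebra ℂ (Matrix ι ι ℂ)) :
    Module.Basis (Fin (Module.finrank ℂ L)) ℂ L :=
  Module.finBasis ℂ L

/-- The product of a list of basis elements in the enveloping algebra. -/
def listProd (l : List (Fin (Module.finrank ℂ L))) : UniversalEnvelopingAlgebra ℂ L :=
  (l.map fun i => UniversalEnvelopingAlgebra.ι ℂ (lieBasis L i)).prod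

theorem listProd_cons (i : Fin (Module.finrank ℂ L)) (l : List (Fin (Module.finrank ℂ L))) :
    listProd (i :: l) = UniversalEnvelopingAlgebra.ι ℂ (lieBasis L i) * listProd l := by
  simp [listProd]

/-- The standard filtration of the enveloping algebra. -/
def ueaFil (L : LieSubalgebra ℂ (Matrix ι ι ℂ)) (d : ℕ) :
    Submodule ℂ (UniversalEnvelopingAlgebra ℂ L) :=
  Submodule.span ℂ {x | ∃ l : List (Fin (Module.finrank ℂ L)), l.length ≤ d ∧ x = listProd l}

theorem listProd_mem_ueaFil {l : List (Fin (Module.finrank ℂ L))} {d : ℕ} (h : l.length ≤ d) :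
    listProd l ∈ ueaFil L d := Submodule.subset_span ⟨l, h, rfl⟩

theorem ueaFil_mono {d d' : ℕ} (h : d ≤ d') : ueaFil L d ≤ ueaFil L d' :=
  Submodule.span_mono fun _ ⟨l, hl, e⟩ => ⟨l, hl.trans h, e⟩

theorem ι_eq_sum (Y : L) : UniversalEnvelopingAlgebra.ι ℂ Y
    = ∑ i, (lieBasis L).repr Y i • UniversalEnvelopingAlgebra.ι ℂ (lieBasis L i) := by
  conv_lhs => rw [← (lieBasis L).sum_repr Y]
  rw [map_sum]
  exact Finset.sum_congr rfl fun i _ => map_smul _ _ _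

theorem ι_mul_mem_ueaFil (Y : L) {d : ℕ} {x : UniversalEnvelopingAlgebra ℂ L}
    (hx : x ∈ ueaFil L d) : UniversalEnvelopingAlgebra.ι ℂ Y * x ∈ ueaFil L (d + 1) := by
  rw [ι_eq_sum, Finset.sum_mul]
  refine sum_mem fun i _ => ?_
  rw [smul_mul_assoc]
  refine Submodule.smul_mem _ _ ?_
  induction hx using Submodule.span_induction with
  | mem x hx =>
    obtain ⟨l, hl, rfl⟩ := hx
    rw [← listProd_cons]
    exact listProd_mem_ueaFil (by simpa using hl)
  | zero => simp
  | add x y _ _ hx hy => rw [mul_add]; exact add_mem hx hy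
  | smul c x _ hx => rw [mul_smul_comm]; exact Submodule.smul_mem _ _ hx

theorem mul_mem_ueaFil {d d' : ℕ} {x y : UniversalEnvelopingAlgebra ℂ L}
    (hx : x ∈ ueaFil L d) (hy : y ∈ ueaFil L d') : x * y ∈ ueaFil L (d + d') := by
  induction hx using Submodule.span_induction with
  | mem x hx =>
    obtain ⟨l, hl, rfl⟩ := hx
    refine ueaFil_mono (Nat.add_le_add_right hl _) ?_
    clear hl
    induction l with
    | nil => simpa [listProd] using hy
    | cons i l ih =>
      rw [listProd_cons, mul_assoc, List.length_cons, show l.length + 1 + d' = l.length + d' + 1 by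
        omega]
      exact ι_mul_mem_ueaFil _ ih
  | zero => simp
  | add x y _ _ hx hy => rw [add_mul]; exact add_mem hx hy
  | smul c x _ hx => rw [smul_mul_assoc]; exact Submodule.smul_mem _ _ hx

theorem exists_mem_ueaFil (u : UniversalEnvelopingAlgebra ℂ L) : ∃ d, u ∈ ueaFil L d := by
  have h1 : (1 : UniversalEnvelopingAlgebra ℂ L) ∈ ueaFil L 0 :=
    listProd_mem_ueaFil (l := []) (by simp)
  induction u using uea_induction with
  | hι Y => exact ⟨1, by simpa using ι_mul_mem_ueaFil Y h1⟩
  | hc c => exact ⟨0, by rw [Algebra.algebraMap_eq_smul_one]; exact Submodule.smul_mem _ _ h1⟩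
  | hadd x y hx hy =>
    obtain ⟨a, ha⟩ := hx
    obtain ⟨b, hb⟩ := hy
    exact ⟨max a b, add_mem (ueaFil_mono (le_max_left _ _) ha) (ueaFil_mono (le_max_right _ _) hb)⟩
  | hmul x y hx hy =>
    obtain ⟨a, ha⟩ := hx
    obtain ⟨b, hb⟩ := hy
    exact ⟨_, mul_mem_ueaFil ha hb⟩

/-- Exchanging two neighbours costs a bracket, which is a single element of the Lie algebra and so
lowers the length by one. -/
theorem listProd_perm {l l' : List (Fin (Module.finrank ℂ L))} (h : l.Perm l') :
    ∀ d, l.length ≤ d + 1 → listProd l - listProd l' ∈ ueaFil L d := by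
  induction h with
  | nil => intro d _; simp
  | @cons x l₁ l₂ h ih =>
    intro d hd
    rw [List.length_cons] at hd
    rw [listProd_cons, listProd_cons, ← mul_sub]
    cases d with
    | zero =>
      obtain rfl := List.eq_nil_of_length_eq_zero (by omega : l₁.length = 0)
      rw [List.nil_perm.1 h]; simp
    | succ d => exact ι_mul_mem_ueaFil _ (ih d (by omega))
  | swap x y l =>
    intro d hd
    simp only [List.length_cons] at hd
    have : listProd (y :: x :: l) - listProd (x :: y :: l)
        = UniversalEnvelopingAlgebra.ι ℂ ⁅lieBasis L y, lieBasis L x⁆ * listProd l := by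
      rw [LieHom.map_lie, LieRing.of_associative_ring_bracket]
      simp only [listProd_cons]; noncomm_ring
    rw [this]
    exact ueaFil_mono (by omega : l.length + 1 ≤ d)
      (ι_mul_mem_ueaFil _ (listProd_mem_ueaFil le_rfl))
  | trans h1 h2 ih1 ih2 =>
    intro d hd
    have := add_mem (ih1 d hd) (ih2 d (by rw [← h1.length_eq]; exact hd))
    rwa [sub_add_sub_cancel] at this

/-- A linear section of the symbol map: a monomial is sent to the product of its variables in
some order. -/
def orderedProd (L : LieSubalgebra ℂ (Matrix ι ι ℂ)) :
    MvPolynomial (Fin (Module.finrank ℂ L)) ℂ →ₗ[ℂ] UniversalEnvelopingAlgebra ℂ L :=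
  (MvPolynomial.basisMonomials _ ℂ).constr ℂ fun m => listProd (Finsupp.toMultiset m).toList

/-- Modulo lower filtration, an element is an ordered polynomial P in a basis, and its symbol at M
is P evaluated at the pairings with the basis. Since P is the same for all M, the symbols determine
it. -/
theorem exists_symbol {d : ℕ} {u : UniversalEnvelopingAlgebra ℂ L} (hu : u ∈ ueaFil L (d + 1)) :
    ∃ P : MvPolynomial (Fin (Module.finrank ℂ L)) ℂ, u - orderedProd L P ∈ ueaFil L d ∧
      ∀ M, SymbolAt M (d + 1) u (MvPolynomial.eval (fun i => (M * (lieBasis L i).1).trace) P) := by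
  have hl : ∀ (M : Matrix ι ι ℂ) (l : List (Fin (Module.finrank ℂ L))), SymbolAt M l.length
      (listProd l) (l.map fun i => (M * (lieBasis L i).1).trace).prod := by
    intro M l
    induction l with
    | nil => simpa [listProd] using symbolAt_one
    | cons i l ih =>
      rw [listProd_cons, List.length_cons, add_comm, List.map_cons, List.prod_cons]
      exact (symbolAt_ι _).mul ih
  induction hu using Submodule.span_induction with
  | mem x hx =>
    obtain ⟨l, hld, rfl⟩ := hx
    rcases hld.lt_or_eq with h | h
    · exact ⟨0, by rw [map_zero, sub_zero]; exact listProd_mem_ueaFil (by omega),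
        fun M => by rw [map_zero]; exact (hl M l).of_lt h⟩
    · refine ⟨MvPolynomial.monomial (Multiset.toFinsupp (l : Multiset _)) 1, ?_, fun M => ?_⟩
      · have e : orderedProd L (MvPolynomial.monomial (Multiset.toFinsupp (l : Multiset _)) 1)
            = listProd ((l : Multiset (Fin (Module.finrank ℂ L))).toList) := by
          have := (MvPolynomial.basisMonomials (Fin (Module.finrank ℂ L)) ℂ).constr_basis ℂ
            (fun m => listProd (L := L) (Finsupp.toMultiset m).toList)
            (Multiset.toFinsupp (l : Multiset _))
          rw [MvPolynomial.coe_basisMonomials] at this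
          rw [orderedProd, this, Multiset.toFinsupp_toMultiset]
        rw [e]
        refine listProd_perm ?_ d h.le
        rw [← Multiset.coe_eq_coe, Multiset.coe_toList]
      · have e : MvPolynomial.monomial (Multiset.toFinsupp
            (l : Multiset (Fin (Module.finrank ℂ L)))) (1 : ℂ)
            = (l.map fun i => MvPolynomial.X i).prod := by
          clear h hld
          induction l with
          | nil => simp
          | cons i l ih =>
            rw [List.map_cons, List.prod_cons, ← ih, ← Multiset.cons_coe,
              ← Multiset.singleton_add, map_add, Multiset.toFinsupp_singleton,
              ← one_mul (1 : ℂ), ← MvPolynomial.monomial_mul, one_mul]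
            rfl
        rw [e, map_list_prod, List.map_map, ← h]
        have e3 : (MvPolynomial.eval fun i => (M * (lieBasis L i).1).trace)
            ∘ (fun i => (MvPolynomial.X i : MvPolynomial (Fin (Module.finrank ℂ L)) ℂ))
            = fun i => (M * (lieBasis L i).1).trace := funext fun i => MvPolynomial.eval_X _
        rw [e3]
        exact hl M l
  | zero => exact ⟨0, by simp, fun M => by rw [map_zero]; exact symbolAt_zero⟩
  | add x y _ _ hx hy =>
    obtain ⟨P, h1, h2⟩ := hx
    obtain ⟨Q, h3, h4⟩ := hy
    refine ⟨P + Q, ?_, fun M => ?_⟩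
    · rw [map_add, add_sub_add_comm]; exact add_mem h1 h3
    · rw [map_add]; exact (h2 M).add (h4 M)
  | smul c x _ hx =>
    obtain ⟨P, h1, h2⟩ := hx
    refine ⟨c • P, ?_, fun M => ?_⟩
    · rw [map_smul, ← smul_sub]; exact Submodule.smul_mem _ _ h1
    · rw [MvPolynomial.smul_eval]; exact (h2 M).smul c

/-- A functional on the subalgebra extends to all matrices, where the trace form represents every
functional. -/
theorem exists_trace_eq (v : Fin (Module.finrank ℂ L) → ℂ) :
    ∃ M : Matrix ι ι ℂ, ∀ i, (M * (lieBasis L i).1).trace = v i := by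
  obtain ⟨φ, hφ⟩ := LinearMap.exists_extend (p := L.toSubmodule) ((lieBasis L).constr ℂ v)
  refine ⟨Matrix.of fun a b => φ (Matrix.single b a 1), fun i => ?_⟩
  have h : ∀ Y : Matrix ι ι ℂ, ((Matrix.of fun a b => φ (Matrix.single b a 1)) * Y).trace = φ Y := by
    intro Y
    conv_rhs => rw [Matrix.matrix_eq_sum_single Y]
    simp only [Matrix.trace, Matrix.diag, Matrix.mul_apply, Matrix.of_apply, map_sum]
    rw [Finset.sum_comm]
    refine Finset.sum_congr rfl fun a _ => Finset.sum_congr rfl fun b _ => ?_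
    rw [show Matrix.single a b (Y a b) = Y a b • Matrix.single a b 1 by simp, map_smul,
      smul_eq_mul, mul_comm]
  rw [h]
  have := LinearMap.congr_fun hφ (lieBasis L i)
  have h2 := (lieBasis L).constr_basis ℂ v i
  exact this.trans h2

/-- An element acting by zero has zero symbols. The leading polynomial therefore vanishes at every
point, hence identically, and the element drops one step in the filtration. -/
theorem polyAct_injective {u : UniversalEnvelopingAlgebra ℂ L} (hu : polyAct L u = 0) : u = 0 := by
  obtain ⟨d, hd⟩ := exists_mem_ueaFil u
  induction d with
  | zero =>
    have : ∃ c : ℂ, u = c • 1 := by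
      refine Submodule.mem_span_singleton.1 ?_ |>.imp fun c h => h.symm
      refine Submodule.span_mono ?_ hd
      rintro _ ⟨l, hl, rfl⟩
      rw [List.eq_nil_of_length_eq_zero (by omega : l.length = 0)]
      simp [listProd]
    obtain ⟨c, rfl⟩ := this
    rw [← Algebra.algebraMap_eq_smul_one] at hu ⊢
    rw [(symbolAt_algebraMap (L := L) (M := 0) c).eq_zero hu, map_zero]
  | succ d ih =>
    obtain ⟨P, h1, h2⟩ := exists_symbol hd
    have hP : P = 0 := by
      refine MvPolynomial.funext fun v => ?_
      obtain ⟨M, hM⟩ := exists_trace_eq (L := L) v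
      have h := (h2 M).eq_zero hu
      simp only [hM] at h
      rw [h, map_zero]
    rw [hP, map_zero, sub_zero] at h1
    exact ih h1

end symbols

/-! ### A positive definite form on polynomials -/

section fischer

variable {σ : Type} [Fintype σ] [DecidableEq σ]

/-- The factorial of a multi-index. -/
def multiFactorial (m : σ →₀ ℕ) : ℂ := ∏ s, ((m s).factorial : ℂ)

theorem multiFactorial_add_single (m : σ →₀ ℕ) (s : σ) :
    multiFactorial (m + Finsupp.single s 1) = (m s + 1) * multiFactorial m := by
  rw [multiFactorial, multiFactorial, ← Finset.mul_prod_erase _ _ (Finset.mem_univ s),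
    ← Finset.mul_prod_erase _ (fun t => ((m t).factorial : ℂ)) (Finset.mem_univ s), ← mul_assoc]
  congr 1
  · simp [Nat.factorial_succ]
  · refine Finset.prod_congr rfl fun t ht => ?_
    have : s ≠ t := (Finset.ne_of_mem_erase ht).symm
    simp [this]

/-- The Fischer form, conjugate linear in the first variable. -/
def fischer (p q : MvPolynomial σ ℂ) : ℂ :=
  ∑ m ∈ p.support, multiFactorial m * (starRingEnd ℂ (p.coeff m) * q.coeff m)

theorem fischer_eq_sum {p q : MvPolynomial σ ℂ} {T : Finset (σ →₀ ℕ)} (h : p.support ⊆ T) :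
    fischer p q = ∑ m ∈ T, multiFactorial m * (starRingEnd ℂ (p.coeff m) * q.coeff m) := by
  refine Finset.sum_subset h fun m _ hm => ?_
  rw [MvPolynomial.notMem_support_iff.1 hm]; simp

theorem fischer_add_right (p q q' : MvPolynomial σ ℂ) :
    fischer p (q + q') = fischer p q + fischer p q' := by
  simp [fischer, mul_add, Finset.sum_add_distrib]

theorem fischer_smul_right (c : ℂ) (p q : MvPolynomial σ ℂ) :
    fischer p (c • q) = c * fischer p q := by
  simp only [fischer, Finset.mul_sum, MvPolynomial.coeff_smul, smul_eq_mul]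
  exact Finset.sum_congr rfl fun m _ => by ring

theorem fischer_conj (p q : MvPolynomial σ ℂ) :
    starRingEnd ℂ (fischer p q) = fischer q p := by
  rw [fischer_eq_sum (T := p.support ∪ q.support) Finset.subset_union_left,
    fischer_eq_sum (T := p.support ∪ q.support) Finset.subset_union_right, map_sum]
  refine Finset.sum_congr rfl fun m _ => ?_
  simp only [map_mul, Complex.conj_conj, multiFactorial, map_prod, Complex.conj_natCast]
  ring

theorem fischer_add_left (p p' q : MvPolynomial σ ℂ) :
    fischer (p + p') q = fischer p q + fischer p' q := by
  rw [← fischer_conj, fischer_add_right, map_add, fischer_conj, fischer_conj]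

theorem fischer_smul_left (c : ℂ) (p q : MvPolynomial σ ℂ) :
    fischer (c • p) q = starRingEnd ℂ c * fischer p q := by
  rw [← fischer_conj, fischer_smul_right, map_mul, fischer_conj]

theorem fischer_zero_left (q : MvPolynomial σ ℂ) : fischer 0 q = 0 := by simp [fischer]

theorem fischer_zero_right (p : MvPolynomial σ ℂ) : fischer p 0 = 0 := by simp [fischer]

theorem fischer_sum_left {β : Type*} (T : Finset β) (p : β → MvPolynomial σ ℂ)
    (q : MvPolynomial σ ℂ) : fischer (∑ b ∈ T, p b) q = ∑ b ∈ T, fischer (p b) q := by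
  classical
  induction T using Finset.induction_on with
  | empty => simp [fischer_zero_left]
  | insert a T ha ih => rw [Finset.sum_insert ha, Finset.sum_insert ha, fischer_add_left, ih]

theorem fischer_sum_right {β : Type*} (T : Finset β) (p : MvPolynomial σ ℂ)
    (q : β → MvPolynomial σ ℂ) : fischer p (∑ b ∈ T, q b) = ∑ b ∈ T, fischer p (q b) := by
  classical
  induction T using Finset.induction_on with
  | empty => simp [fischer_zero_right]
  | insert a T ha ih => rw [Finset.sum_insert ha, Finset.sum_insert ha, fischer_add_right, ih]

theorem fischer_monomial (m : σ →₀ ℕ) (c : ℂ) (q : MvPolynomial σ ℂ) :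
    fischer (MvPolynomial.monomial m c) q
      = multiFactorial m * (starRingEnd ℂ c * q.coeff m) := by
  rw [fischer_eq_sum (T := {m}) MvPolynomial.support_monomial_subset, Finset.sum_singleton,
    MvPolynomial.coeff_monomial, if_pos rfl]

theorem eq_zero_of_fischer_self {p : MvPolynomial σ ℂ} (h : fischer p p = 0) : p = 0 := by
  have hpos : ∀ m ∈ p.support, 0 ≤ (∏ s, ((m s).factorial : ℝ)) * Complex.normSq (p.coeff m) :=
    fun m _ => mul_nonneg (Finset.prod_nonneg fun s _ => Nat.cast_nonneg _)
      (Complex.normSq_nonneg _)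
  have h1 : fischer p p = ((∑ m ∈ p.support, (∏ s, ((m s).factorial : ℝ))
      * Complex.normSq (p.coeff m) : ℝ) : ℂ) := by
    rw [fischer]; push_cast
    refine Finset.sum_congr rfl fun m _ => ?_
    rw [Complex.normSq_eq_conj_mul_self, multiFactorial]
  rw [h1, Complex.ofReal_eq_zero, Finset.sum_eq_zero_iff_of_nonneg hpos] at h
  ext m
  by_contra hm
  have h2 := h m (MvPolynomial.mem_support_iff.2 hm)
  rcases mul_eq_zero.1 h2 with h3 | h3
  · obtain ⟨s, _, hs⟩ := Finset.prod_eq_zero_iff.1 h3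
    exact Nat.factorial_ne_zero _ (by exact_mod_cast hs)
  · exact hm (by simpa using h3)

theorem eq_of_fischer_right {q q' : MvPolynomial σ ℂ} (h : ∀ p, fischer p q = fischer p q') :
    q = q' := by
  rw [← sub_eq_zero]
  apply eq_zero_of_fischer_self
  have h1 : q - q' = q + (-1 : ℂ) • q' := by rw [neg_one_smul, sub_eq_add_neg]
  nth_rw 2 [h1]
  rw [fischer_add_right, fischer_smul_right, h]; ring

/-- The weights m! are chosen so that multiplication by a variable is adjoint to the corresponding
derivative. -/
theorem fischer_X_mul (s : σ) (p q : MvPolynomial σ ℂ) :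
    fischer (MvPolynomial.X s * p) q = fischer p (MvPolynomial.pderiv s q) := by
  induction p using MvPolynomial.induction_on' with
  | monomial m c =>
    have : MvPolynomial.X s * MvPolynomial.monomial m c
        = MvPolynomial.monomial (m + Finsupp.single s 1) c := by
      rw [MvPolynomial.X, MvPolynomial.monomial_mul, one_mul, add_comm]
    rw [this, fischer_monomial, fischer_monomial, MvPolynomial.coeff_pderiv, multiFactorial_add_single]
    ring
  | add p p' hp hp' => rw [mul_add, fischer_add_left, fischer_add_left, hp, hp']

theorem fischer_X_mul_pderiv (s t : σ) (p q : MvPolynomial σ ℂ) :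
    fischer (MvPolynomial.X s * MvPolynomial.pderiv t p) q
      = fischer p (MvPolynomial.X t * MvPolynomial.pderiv s q) := by
  rw [fischer_X_mul, ← fischer_conj, ← fischer_X_mul, fischer_conj]

end fischer

/-! ### Adjoint operators and highest weight vectors in the polynomial representation -/

section matDer

variable {ι : Type} [Fintype ι] [DecidableEq ι]

theorem matDer_apply (Y : Matrix ι ι ℂ) (p : MvPolynomial (ι × ι) ℂ) :
    matDer Y p = ∑ b, ∑ a, ∑ c,
      Y c a • (MvPolynomial.X (c, b) * MvPolynomial.pderiv (a, b) p) := by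
  have hs : ∀ (T : Finset ι) (D : ι → Derivation ℂ (MvPolynomial (ι × ι) ℂ)
      (MvPolynomial (ι × ι) ℂ)) (p : MvPolynomial (ι × ι) ℂ),
      (∑ t ∈ T, D t) p = ∑ t ∈ T, D t p := by
    intro T D p
    induction T using Finset.induction_on with
    | empty => simp
    | insert a T ha ih => rw [Finset.sum_insert ha, Finset.sum_insert ha, Derivation.add_apply, ih]
  have h : matDer Y = ∑ b, ∑ a, ∑ c, (Y c a • MvPolynomial.X (c, b) : MvPolynomial (ι × ι) ℂ)
      • MvPolynomial.pderiv (R := ℂ) (a, b) := by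
    refine MvPolynomial.derivation_ext fun q => ?_
    obtain ⟨a, b⟩ := q
    rw [matDer_X]
    simp only [hs, Derivation.smul_apply]
    symm
    rw [Finset.sum_eq_single b, Finset.sum_eq_single a]
    · simp
    · intro a' _ ha
      refine Finset.sum_eq_zero fun c _ => ?_
      rw [MvPolynomial.pderiv_X_of_ne (by simpa using fun h => ha h.symm), smul_zero]
    · simp
    · intro b' _ hb
      refine Finset.sum_eq_zero fun a' _ => Finset.sum_eq_zero fun c _ => ?_
      rw [MvPolynomial.pderiv_X_of_ne (by simpa using fun _ h => hb h.symm), smul_zero]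
    · simp
  rw [h]
  simp only [hs, Derivation.smul_apply, smul_eq_mul, smul_mul_assoc]

/-- The operator D_Y is a combination of the operators x_s ∂_t, and x_s ∂_t is adjoint to x_t ∂_s.
-/
theorem fischer_matDer (Y : Matrix ι ι ℂ) (p q : MvPolynomial (ι × ι) ℂ) :
    fischer (matDer Y p) q = fischer p (matDer Y.conjTranspose q) := by
  rw [matDer_apply, matDer_apply]
  simp only [fischer_sum_left, fischer_sum_right, fischer_smul_left, fischer_smul_right,
    fischer_X_mul_pderiv, Matrix.conjTranspose_apply]
  refine Finset.sum_congr rfl fun b _ => ?_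
  rw [Finset.sum_comm]
  rfl

/-- All monomials of `p` have weight less than `s`. -/
def WeightLT (w : ι → ℕ) (s : ℕ) (p : MvPolynomial (ι × ι) ℂ) : Prop :=
  ∀ m, p.coeff m ≠ 0 → Finsupp.weight (fun x : ι × ι => w x.1) m < s

/-- Each term of D_Y replaces a factor x_{ab} by x_{cb} with w(c) < w(a). -/
theorem WeightLT.matDer {w : ι → ℕ} {s : ℕ} {p : MvPolynomial (ι × ι) ℂ}
    (hp : WeightLT w (s + 1) p) {Y : Matrix ι ι ℂ} (hY : ∀ c a, Y c a ≠ 0 → w c < w a) :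
    WeightLT w s (matDer Y p) := by
  intro m hm
  rw [matDer_apply] at hm
  simp only [MvPolynomial.coeff_sum, MvPolynomial.coeff_smul] at hm
  obtain ⟨b, -, hm⟩ := Finset.exists_ne_zero_of_sum_ne_zero hm
  obtain ⟨a, -, hm⟩ := Finset.exists_ne_zero_of_sum_ne_zero hm
  obtain ⟨c, -, hm⟩ := Finset.exists_ne_zero_of_sum_ne_zero hm
  rw [smul_eq_mul] at hm
  have h1 := hY c a (left_ne_zero_of_mul hm)
  have h2 := right_ne_zero_of_mul hm
  rw [MvPolynomial.coeff_X_mul'] at h2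
  split_ifs at h2 with h3
  · rw [MvPolynomial.coeff_pderiv] at h2
    have h4 := hp _ (left_ne_zero_of_mul h2)
    have h5 : Finsupp.single (c, b) 1 ≤ m := by
      rw [Finsupp.single_le_iff]
      exact Nat.one_le_iff_ne_zero.2 (Finsupp.mem_support_iff.1 h3)
    obtain ⟨m', rfl⟩ := exists_add_of_le h5
    rw [add_tsub_cancel_left] at h4
    simp only [map_add, Finsupp.weight_single, smul_eq_mul, one_mul] at h4 ⊢
    omega
  · exact absurd rfl h2

theorem exists_weightLT (w : ι → ℕ) (p : MvPolynomial (ι × ι) ℂ) : ∃ s, WeightLT w s p := by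
  refine ⟨p.support.sup (Finsupp.weight (fun x : ι × ι => w x.1)) + 1, fun m hm => ?_⟩
  exact Nat.lt_succ_of_le (Finset.le_sup (f := Finsupp.weight (fun x : ι × ι => w x.1))
    (MvPolynomial.mem_support_iff.2 hm))

/-- An operator with an adjoint which commutes with a family of operators stable under taking
adjoints vanishes as soon as it vanishes on all the vectors killed by the raising operators. -/
theorem eq_zero_of_highest_weight {T R : Set (Matrix ι ι ℂ)} {w : ι → ℕ}
    (hT : ∀ Y ∈ T, Y.conjTranspose ∈ T) (hRT : R ⊆ T) (hR : ∀ Y ∈ R, ∀ c a, Y c a ≠ 0 → w c < w a)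
    {z z' : Module.End ℂ (MvPolynomial (ι × ι) ℂ)}
    (hz : ∀ Y ∈ T, ∀ p, z (matDer Y p) = matDer Y (z p))
    (hadj : ∀ p q, fischer (z p) q = fischer p (z' q))
    (h0 : ∀ p, (∀ Y ∈ R, matDer Y p = 0) → z p = 0) : z = 0 := by
  have hadj' : ∀ p q, fischer (z' p) q = fischer p (z q) := by
    intro p q; rw [← fischer_conj, ← hadj, fischer_conj]
  have hz' : ∀ Y ∈ T, ∀ q, z' (matDer Y q) = matDer Y (z' q) := by
    intro Y hY q
    refine eq_of_fischer_right fun p => ?_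
    have e : ∀ p q, fischer p (matDer Y q) = fischer (matDer Y.conjTranspose p) q := by
      intro p q; rw [fischer_matDer, Matrix.conjTranspose_conjTranspose]
    rw [← hadj, e, e, ← hz _ (hT Y hY), hadj]
  -- As long as z'z p is not killed by some raising operator, p is replaced by its image under that
  -- operator. This commutes with z'z and lowers the weight bound, so the process stops at a nonzero
  -- vector killed by all raising operators.
  have key : ∀ s p, WeightLT w s (z' (z p)) → z' (z p) ≠ 0 →
      ∃ q, z' (z q) ≠ 0 ∧ ∀ Y ∈ R, matDer Y (z' (z q)) = 0 := by
    intro s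
    induction s with
    | zero =>
      intro p hp hne
      exact absurd (MvPolynomial.ext _ _ fun m => by
        by_contra hm
        exact absurd (hp m (by simpa using hm)) (Nat.not_lt_zero _)) hne
    | succ s ih =>
      intro p hp hne
      by_cases hall : ∀ Y ∈ R, matDer Y (z' (z p)) = 0
      · exact ⟨p, hne, hall⟩
      · push Not at hall
        obtain ⟨Y, hY, hYp⟩ := hall
        have e : z' (z (matDer Y p)) = matDer Y (z' (z p)) := by
          rw [hz _ (hRT hY), hz' _ (hRT hY)]
        exact ih (matDer Y p) (by rw [e]; exact hp.matDer (hR Y hY)) (by rwa [e])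
  refine LinearMap.ext fun p => ?_
  rw [LinearMap.zero_apply]
  by_contra hp
  have hne : z' (z p) ≠ 0 := fun h => hp (eq_zero_of_fischer_self (by
    rw [hadj, h, fischer_zero_right]))
  obtain ⟨s, hs⟩ := exists_weightLT w (z' (z p))
  obtain ⟨q, hq, hkill⟩ := key s p hs hne
  -- The vector z'z q is a highest weight vector, so z kills it; moving z' to the other side shows
  -- that its norm is zero.
  refine hq (eq_zero_of_fischer_self ?_)
  rw [hadj', hadj, h0 _ hkill, map_zero, fischer_zero_right]

end matDer

/-! ### The Harish-Chandra homomorphism is injective on the center -/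

section HC

variable {κ : Series} {n k : ℕ}

theorem polyAct_UF (i j : ℤ) (p : MvPolynomial (Idx κ n × Idx κ n) ℂ) :
    polyAct (g κ n) (UF κ n i j) p = matDer (Fmat κ n i j) p := by
  rw [UF, UniversalEnvelopingAlgebra.lift_ι_apply]; rfl

theorem Fmat_conjTranspose (i j : ℤ) : (Fmat κ n i j).conjTranspose = Fmat κ n j i := by
  have h : ∀ i j, (E κ n i j).conjTranspose = E κ n j i := by
    intro i j
    ext a b
    simp only [E, Matrix.conjTranspose_apply, Matrix.of_apply, and_comm]
    split_ifs <;> simp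
  have h2 : theta κ i j = theta κ j i := by cases κ <;> simp [theta, mul_comm]
  rw [Fmat, Matrix.conjTranspose_sub, Matrix.conjTranspose_smul, h, h, Fmat, h2]
  simp

/-- The generators are permuted by the conjugate transpose, F_{ij} ↦ F_{ji}, and adjoints reverse
products. -/
theorem exists_adjoint {u : U κ n} (hu : u ∈ Usub κ n k) : ∃ u' : U κ n,
    ∀ p q, fischer (polyAct (g κ n) u p) q = fischer p (polyAct (g κ n) u' q) := by
  induction hu using Algebra.adjoin_induction with
  | mem x hx =>
    obtain ⟨i, _, j, _, rfl⟩ := hx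
    exact ⟨UF κ n j i, fun p q => by
      rw [polyAct_UF, polyAct_UF, fischer_matDer, Fmat_conjTranspose]⟩
  | algebraMap c =>
    refine ⟨algebraMap ℂ _ (starRingEnd ℂ c), fun p q => ?_⟩
    rw [AlgHom.commutes, AlgHom.commutes, Module.algebraMap_end_apply,
      Module.algebraMap_end_apply, fischer_smul_left, fischer_smul_right]
  | add x y _ _ hx hy =>
    obtain ⟨x', hx⟩ := hx
    obtain ⟨y', hy⟩ := hy
    refine ⟨x' + y', fun p q => ?_⟩
    rw [map_add (polyAct (g κ n)), map_add (polyAct (g κ n)), LinearMap.add_apply,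
      LinearMap.add_apply, fischer_add_left, fischer_add_right, hx, hy]
  | mul x y _ _ hx hy =>
    obtain ⟨x', hx⟩ := hx
    obtain ⟨y', hy⟩ := hy
    refine ⟨y' * x', fun p q => ?_⟩
    rw [map_mul (polyAct (g κ n)), map_mul (polyAct (g κ n)), Module.End.mul_apply,
      Module.End.mul_apply, hx, hy]

theorem Fmat_ne_zero_lt {i j : ℤ} (hij : i < j) {c a : Idx κ n} (h : Fmat κ n i j c a ≠ 0) :
    c.1 < a.1 := by
  by_contra hca
  apply h
  have h1 : ¬(c.1 = i ∧ a.1 = j) := by omega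
  have h2 : ¬(c.1 = -j ∧ a.1 = -i) := by omega
  simp [Fmat, E, h1, h2]

theorem neg_le_idx (i : Idx κ n) : -(n : ℤ) ≤ i.1 := by
  have hi := i.2
  revert hi; generalize i.1 = z; intro hi
  cases κ <;> simp only [idxSet, Finset.mem_erase, Finset.mem_Icc] at hi <;> omega

/-- Injectivity of the Harish-Chandra map on the center: an element of the left ideal kills every
highest weight vector of the polynomial representation, hence acts by zero, and the action is
faithful. -/
theorem eq_zero_of_mem_leftIdealNPlus {z : U κ n} (hz : z ∈ Ucenter κ n k)
    (hJ : z ∈ leftIdealNPlus κ n k) : z = 0 := by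
  apply polyAct_injective
  obtain ⟨z', hz'⟩ := exists_adjoint hz.1
  refine eq_zero_of_highest_weight
    (T := {Y | ∃ i ∈ idxSet κ k, ∃ j ∈ idxSet κ k, Y = Fmat κ n i j})
    (R := {Y | ∃ i ∈ idxSet κ k, ∃ j ∈ idxSet κ k, i < j ∧ Y = Fmat κ n i j})
    (w := fun i => (i.1 + n).toNat) ?_ ?_ ?_ ?_ hz' ?_
  · rintro _ ⟨i, hi, j, hj, rfl⟩
    exact ⟨j, hj, i, hi, Fmat_conjTranspose i j⟩
  · rintro _ ⟨i, hi, j, hj, _, rfl⟩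
    exact ⟨i, hi, j, hj, rfl⟩
  · rintro _ ⟨i, hi, j, hj, hij, rfl⟩ c a hca
    have h1 := Fmat_ne_zero_lt hij hca
    have h2 := neg_le_idx c
    have h3 := neg_le_idx a
    omega
  · rintro _ ⟨i, hi, j, hj, rfl⟩ p
    rw [← polyAct_UF, ← polyAct_UF, ← Module.End.mul_apply, ← Module.End.mul_apply, ← map_mul,
      ← map_mul, Ucenter_comm hz (UF_mem_Usub ⟨i, hi⟩ ⟨j, hj⟩)]
  · intro p hp
    have : leftIdealNPlus κ n k ≤ LinearMap.ker
        ((LinearMap.applyₗ p).comp (polyAct (g κ n)).toLinearMap) := by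
      refine Submodule.span_le.2 ?_
      rintro _ ⟨a, _, i, hi, j, hj, hij, rfl⟩
      rw [SetLike.mem_coe, LinearMap.mem_ker]
      change polyAct (g κ n) (a * UF κ n i j) p = 0
      rw [map_mul, Module.End.mul_apply, polyAct_UF, hp _ ⟨i, hi, j, hj, hij, rfl⟩, map_zero]
    exact this hJ

theorem HasHCImage.eq_of_eq {z z' p : U κ n} (hz : HasHCImage κ n k z p)
    (hz' : HasHCImage κ n k z' p) : z = z' := by
  rw [← sub_eq_zero]
  refine eq_zero_of_mem_leftIdealNPlus (sub_mem hz.1 hz'.1) ?_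
  have := sub_mem hz.2 hz'.2
  rwa [sub_sub_sub_cancel_right] at this

end HC

open scoped IsMulCommutative in
theorem exists_algHom_of_commute {ι A : Type*} [Ring A] [Algebra ℂ A] (a : ι → A)
    (h : ∀ i j, a i * a j = a j * a i) :
    ∃ f : MvPolynomial ι ℂ →ₐ[ℂ] A, ∀ i, f (MvPolynomial.X i) = a i := by
  have : IsMulCommutative (Algebra.adjoin ℂ (Set.range a)) :=
    Algebra.isMulCommutative_adjoin ℂ (by rintro _ ⟨i, rfl⟩ _ ⟨j, rfl⟩; exact h i j)
  let b : ι → Algebra.adjoin ℂ (Set.range a) := fun i => ⟨a i, Algebra.subset_adjoin ⟨i, rfl⟩⟩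
  refine ⟨(Algebra.adjoin ℂ (Set.range a)).val.comp (MvPolynomial.aeval b), fun i => ?_⟩
  rw [AlgHom.comp_apply, MvPolynomial.aeval_X]
  rfl

/-! ### Harish-Chandra images -/

section HC

variable {κ : Series} {n k : ℕ}

theorem leftIdealNPlus_left {a x : U κ n} (ha : a ∈ Usub κ n k) (hx : x ∈ leftIdealNPlus κ n k) :
    a * x ∈ leftIdealNPlus κ n k := by
  induction hx using Submodule.span_induction with
  | mem x hx =>
    obtain ⟨b, hb, i, hi, j, hj, hij, rfl⟩ := hx
    exact Submodule.subset_span ⟨a * b, mul_mem ha hb, i, hi, j, hj, hij, by rw [mul_assoc]⟩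
  | zero => simp
  | add x y _ _ hx hy => rw [mul_add]; exact add_mem hx hy
  | smul c x _ hx => rw [mul_smul_comm]; exact Submodule.smul_mem _ _ hx

theorem mul_UF_mem_leftIdealNPlus {a : U κ n} (ha : a ∈ Usub κ n k) {i j : Idx κ k}
    (hij : i.1 < j.1) : a * UF κ n i.1 j.1 ∈ leftIdealNPlus κ n k :=
  Submodule.subset_span ⟨a, ha, i.1, i.2, j.1, j.2, hij, rfl⟩

theorem UF_mem_leftIdealNPlus {i j : Idx κ k} (hij : i.1 < j.1) :
    UF κ n i.1 j.1 ∈ leftIdealNPlus κ n k := by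
  simpa using mul_UF_mem_leftIdealNPlus (n := n) (one_mem _) hij

/-- Bracketing a raising element with F_{cc} gives a combination of raising elements again. -/
theorem leftIdealNPlus_mul_UF (hk : k ≤ n) {x : U κ n} (hx : x ∈ leftIdealNPlus κ n k)
    (c : Idx κ k) : x * UF κ n c.1 c.1 ∈ leftIdealNPlus κ n k := by
  induction hx using Submodule.span_induction with
  | mem x hx =>
    obtain ⟨b, hb, i, hi, j, hj, hij, rfl⟩ := hx
    have e := (calF_isFMatrix (κ := κ) hk).tensor ⟨i, hi⟩ ⟨j, hj⟩ c c
    rw [sub_eq_iff_eq_add] at e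
    have e' : UF κ n i j * UF κ n c.1 c.1
        = brk (calF κ n k) ⟨i, hi⟩ ⟨j, hj⟩ c c + UF κ n c.1 c.1 * UF κ n i j := e
    rw [mul_assoc, e', mul_add, ← mul_assoc]
    refine add_mem (leftIdealNPlus_left hb ?_) (Submodule.subset_span
      ⟨_, mul_mem hb (UF_mem_Usub c c), i, hi, j, hj, hij, rfl⟩)
    have h : ∀ (p : Prop) [Decidable p] (i j : Idx κ k), (p → i.1 < j.1) →
        (if p then calF κ n k i j else 0) ∈ leftIdealNPlus κ n k := by
      intro p _ i j hp
      split_ifs with hq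
      · exact UF_mem_leftIdealNPlus (hp hq)
      · exact zero_mem _
    have h' : ∀ (p : Prop) [Decidable p] (z : ℂ) (i j : Idx κ k), (p → i.1 < j.1) →
        (if p then z • calF κ n k i j else 0) ∈ leftIdealNPlus κ n k := by
      intro p _ z i j hp
      have := Submodule.smul_mem _ z (h p i j hp)
      rwa [smul_ite, smul_zero] at this
    refine add_mem (sub_mem (sub_mem (h _ _ _ ?_) (h _ _ _ ?_)) (h' _ _ _ _ ?_)) (h' _ _ _ _ ?_)
    · rintro rfl; exact hij
    · rintro rfl; exact hij
    · rintro rfl; simp only [negIdx]; omega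
    · rintro rfl; simp only [negIdx]; omega
  | zero => simp
  | add x y _ _ hx hy => rw [add_mul]; exact add_mem hx hy
  | smul c x _ hx => rw [smul_mul_assoc]; exact Submodule.smul_mem _ _ hx

/-- In ∑_b (𝓕^r)_{ab} F_{bc} the terms with b < c end in a raising element, and b = c is covered by
stability under the Cartan part. For b > c the factor F_{bc} is moved to the left, and the brackets
so created are again entries above the diagonal. -/
theorem pow_mem_leftIdealNPlus (hk : k ≤ n) (r : ℕ) {a c : Idx κ k} (hac : a.1 < c.1) :
    (calF κ n k ^ r) a c ∈ leftIdealNPlus κ n k := by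
  induction r generalizing a c with
  | zero =>
    rw [pow_zero, Matrix.one_apply, if_neg (by rintro rfl; omega)]
    exact zero_mem _
  | succ r ih =>
    rw [pow_succ, Matrix.mul_apply]
    refine sum_mem fun b _ => ?_
    rcases lt_trichotomy b.1 c.1 with hbc | hbc | hbc
    · exact mul_UF_mem_leftIdealNPlus (calF_pow_mem_Usub r a b) hbc
    · obtain rfl : b = c := Subtype.ext hbc
      exact leftIdealNPlus_mul_UF hk (ih hac) b
    · have e := (calF_isFMatrix (κ := κ) hk).pow r b c a b
      rw [sub_eq_iff_eq_add, ← sub_eq_iff_eq_add'] at e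
      rw [← e]
      refine sub_mem (leftIdealNPlus_left (UF_mem_Usub b c) (ih (hac.trans hbc))) ?_
      have h1 : a ≠ c := by rintro rfl; omega
      simp only [brk, h1, if_false, if_true, zero_sub]
      refine add_mem (sub_mem (neg_mem (ih hac)) ?_) ?_
      · split_ifs with h
        · refine Submodule.smul_mem _ _ (ih ?_)
          have := congrArg Subtype.val h
          simp only [negIdx] at this ⊢; omega
        · exact zero_mem _
      · split_ifs with h
        · refine Submodule.smul_mem _ _ (ih ?_)
          have := congrArg Subtype.val h
          simp only [negIdx] at this ⊢; omega
        · exact zero_mem _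

/-- The ring of polynomials in the coordinates of the Cartan subalgebra. -/
abbrev HPoly : Type := MvPolynomial ℕ ℂ

/-- The element `F_{ii}` as a polynomial: the variable `i` stands for `F_{i+1,i+1}`. -/
def lam (i : ℤ) : HPoly :=
  if 0 < i then MvPolynomial.X (i.toNat - 1)
  else if i < 0 then -MvPolynomial.X ((-i).toNat - 1) else 0

theorem UF_diag_comm (i j : Idx κ n) :
    UF κ n i.1 i.1 * UF κ n j.1 j.1 = UF κ n j.1 j.1 * UF κ n i.1 i.1 := by
  have e := (calF_isFMatrix (κ := κ) (le_refl n)).tensor i i j j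
  rw [← sub_eq_zero]
  refine Eq.trans e ?_
  have e1 : (if j = i then calF κ n n i j else 0) = if j = i then calF κ n n j i else 0 := by
    split_ifs with h
    · rw [h]
    · rfl
  have e2 : (if j = negIdx i then th i i • calF κ n n (negIdx i) j else 0)
      = if j = negIdx i then th i i • calF κ n n j (negIdx i) else 0 := by
    split_ifs with h
    · rw [h]
    · rfl
  rw [brk, e1, e2]; abel

theorem exists_cartanHom (κ : Series) (n : ℕ) : ∃ f : HPoly →ₐ[ℂ] U κ n, ∀ i : ℕ,
    f (MvPolynomial.X i) = if i < n then UF κ n (i + 1 : ℕ) (i + 1 : ℕ) else 0 := by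
  refine exists_algHom_of_commute _ fun i j => ?_
  split_ifs with hi hj hj
  · exact UF_diag_comm ⟨_, idxSet_mono hi (top_mem_idxSet (by omega))⟩
      ⟨_, idxSet_mono hj (top_mem_idxSet (by omega))⟩
  all_goals simp

/-- The homomorphism from polynomials to the enveloping algebra of the Cartan subalgebra. -/
def cartanHom (κ : Series) (n : ℕ) : HPoly →ₐ[ℂ] U κ n := (exists_cartanHom κ n).choose

theorem cartanHom_X {i : ℕ} (h : i < n) :
    cartanHom κ n (MvPolynomial.X i) = UF κ n (i + 1 : ℕ) (i + 1 : ℕ) := by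
  rw [cartanHom, (exists_cartanHom κ n).choose_spec, if_pos h]

theorem idx_le (i : Idx κ k) : i.1 ≤ k := by
  have := neg_le_idx (negIdx i)
  simp only [negIdx] at this; omega

/-- Skewness gives F_{-i,-i} = -F_{ii}, and in particular F_{00} = 0. -/
theorem cartanHom_lam (hk : k ≤ n) (i : Idx κ k) :
    cartanHom κ n (lam i.1) = UF κ n i.1 i.1 := by
  have h1 := idx_le i
  have h2 := neg_le_idx i
  have hs : UF κ n i.1 i.1 = -UF κ n (-i.1) (-i.1) := by
    have := (calF_isFMatrix (κ := κ) hk).skew i i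
    rwa [th_self, one_smul] at this
  rw [lam]
  split_ifs with h h'
  · rw [cartanHom_X (by omega), show ((i.1.toNat - 1 + 1 : ℕ) : ℤ) = i.1 by omega]
  · rw [map_neg, cartanHom_X (by omega), show (((-i.1).toNat - 1 + 1 : ℕ) : ℤ) = -i.1 by omega, hs]
  · have h0 : i.1 = 0 := by omega
    rw [h0, neg_zero] at hs
    rw [map_zero, h0]
    have h2 : (2 : ℂ) • UF κ n 0 0 = 0 := by
      rw [two_smul]; nth_rw 1 [hs]; simp
    exact ((smul_eq_zero_iff_right two_ne_zero).1 h2).symm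

theorem leftIdealNPlus_mul_cartanHom (hk : k ≤ n) {x : U κ n} (hx : x ∈ leftIdealNPlus κ n k)
    {p : HPoly} (hp : p ∈ Algebra.adjoin ℂ (Set.range fun i : Idx κ k => lam i.1)) :
    x * cartanHom κ n p ∈ leftIdealNPlus κ n k := by
  induction hp using Algebra.adjoin_induction generalizing x with
  | mem p hp =>
    obtain ⟨i, rfl⟩ := hp
    simp only
    rw [cartanHom_lam hk]
    exact leftIdealNPlus_mul_UF hk hx i
  | algebraMap c =>
    rw [AlgHom.commutes, ← Algebra.commutes, ← Algebra.smul_def]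
    exact Submodule.smul_mem _ _ hx
  | add p q _ _ hp hq => rw [map_add, mul_add]; exact add_mem (hp hx) (hq hx)
  | mul p q _ _ hp hq => rw [map_mul, ← mul_assoc]; exact hq (hp hx)

/-- The algebra of polynomials in the `F_{ii}`, `|i| ≤ k`. -/
def HSub (κ : Series) (k : ℕ) : Subalgebra ℂ HPoly :=
  Algebra.adjoin ℂ (Set.range fun i : Idx κ k => lam i.1)

/-- The element `z` is central in `U(g_k)` with Harish-Chandra image `p`. -/
def HasHC (κ : Series) (n k : ℕ) (z : U κ n) (p : HPoly) : Prop :=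
  p ∈ HSub κ k ∧ HasHCImage κ n k z (cartanHom κ n p)

theorem HasHC.add {z z' : U κ n} {p p' : HPoly} (h : HasHC κ n k z p) (h' : HasHC κ n k z' p') :
    HasHC κ n k (z + z') (p + p') := by
  refine ⟨add_mem h.1 h'.1, add_mem h.2.1 h'.2.1, ?_⟩
  rw [map_add, add_sub_add_comm]
  exact add_mem h.2.2 h'.2.2

theorem HasHC.smul (c : ℂ) {z : U κ n} {p : HPoly} (h : HasHC κ n k z p) :
    HasHC κ n k (c • z) (c • p) := by
  refine ⟨Subalgebra.smul_mem _ h.1 c, Subalgebra.smul_mem _ h.2.1 c, ?_⟩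
  rw [map_smul, ← smul_sub]
  exact Submodule.smul_mem _ _ h.2.2

theorem HasHC.sub {z z' : U κ n} {p p' : HPoly} (h : HasHC κ n k z p) (h' : HasHC κ n k z' p') :
    HasHC κ n k (z - z') (p - p') := by
  have := h.add (h'.smul (-1))
  simpa [sub_eq_add_neg] using this

theorem hasHC_algebraMap (c : ℂ) : HasHC κ n k (algebraMap ℂ _ c) (algebraMap ℂ _ c) := by
  refine ⟨Subalgebra.algebraMap_mem _ c, Subalgebra.algebraMap_mem _ c, ?_⟩
  rw [AlgHom.commutes, sub_self]
  exact zero_mem _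

theorem HasHC.sum {β : Type*} (T : Finset β) {z : β → U κ n} {p : β → HPoly}
    (h : ∀ b ∈ T, HasHC κ n k (z b) (p b)) :
    HasHC κ n k (∑ b ∈ T, z b) (∑ b ∈ T, p b) := by
  classical
  induction T using Finset.induction_on with
  | empty => simpa using hasHC_algebraMap (κ := κ) (n := n) (k := k) 0
  | insert a T ha ih =>
    rw [Finset.sum_insert ha, Finset.sum_insert ha]
    exact (h a (Finset.mem_insert_self _ _)).add
      (ih fun b hb => h b (Finset.mem_insert_of_mem hb))

/-- With remainders in the left ideal, zz' - pp' = z(z' - p') + (z - p)p'. The last term needs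
stability of the ideal under right multiplication by the Cartan part. -/
theorem HasHC.mul (hk : k ≤ n) {z z' : U κ n} {p p' : HPoly} (h : HasHC κ n k z p)
    (h' : HasHC κ n k z' p') : HasHC κ n k (z * z') (p * p') := by
  refine ⟨mul_mem h.1 h'.1, mul_mem h.2.1 h'.2.1, ?_⟩
  have e : z * z' - cartanHom κ n (p * p')
      = z * (z' - cartanHom κ n p') + (z - cartanHom κ n p) * cartanHom κ n p' := by
    rw [map_mul]; noncomm_ring
  rw [e]
  exact add_mem (leftIdealNPlus_left h.2.1.1 h'.2.2) (leftIdealNPlus_mul_cartanHom hk h.2.2 h'.1)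

theorem HasHC.eq_of_eq {z z' : U κ n} {p : HPoly} (h : HasHC κ n k z p)
    (h' : HasHC κ n k z' p) : z = z' :=
  HasHCImage.eq_of_eq h.2 h'.2

/-- The weight `1 - ε δ_{c,-a}`. -/
def hcWeight (κ : Series) (a c : ℤ) : ℂ := 1 - if c = -a then eps κ else 0

/-- The Harish-Chandra image of `(𝓕^r)_{aa}`. -/
def hcPow (κ : Series) (k : ℕ) : ℕ → Idx κ k → HPoly
  | 0, _ => 1
  | r + 1, a => (lam a.1 + MvPolynomial.C (∑ c : Idx κ k, if a.1 < c.1 then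
      hcWeight κ a.1 c.1 else 0)) * hcPow κ k r a
      - ∑ c : Idx κ k, if a.1 < c.1 then hcWeight κ a.1 c.1 • hcPow κ k r c else 0

theorem hcPow_mem (r : ℕ) (a : Idx κ k) : hcPow κ k r a ∈ HSub κ k := by
  induction r generalizing a with
  | zero => exact one_mem _
  | succ r ih =>
    refine sub_mem (mul_mem (add_mem (Algebra.subset_adjoin ⟨a, rfl⟩)
      (Subalgebra.algebraMap_mem _ _)) (ih a)) (sum_mem fun c _ => ?_)
    split_ifs
    · exact Subalgebra.smul_mem _ (ih c) _
    · exact zero_mem _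

/-- In ∑_c (𝓕^r)_{ac} F_{ca} the terms with c < a lie in the ideal. For c > a, moving F_{ca} to the
left leaves an element of the ideal and a bracket, which is a multiple of (𝓕^r)_{aa} - (𝓕^r)_{cc}.
The multiple is 1 except at c = -a, where two more bracket terms change it to 1 - ε. -/
theorem pow_diag_sub_mem (hk : k ≤ n) (r : ℕ) (a : Idx κ k) :
    (calF κ n k ^ r) a a - cartanHom κ n (hcPow κ k r a) ∈ leftIdealNPlus κ n k := by
  induction r generalizing a with
  | zero => simp [hcPow]
  | succ r ih =>
    have e : cartanHom κ n (hcPow κ k (r + 1) a)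
        = ∑ c : Idx κ k, (if a.1 < c.1 then hcWeight κ a.1 c.1 •
            (cartanHom κ n (hcPow κ k r a) - cartanHom κ n (hcPow κ k r c)) else
            if c = a then cartanHom κ n (hcPow κ k r a) * UF κ n a.1 a.1 else 0) := by
      rw [hcPow, map_sub, add_mul, map_add, mul_comm (lam a.1), map_mul, cartanHom_lam hk,
        ← MvPolynomial.smul_eq_C_mul, map_smul, map_sum, Finset.sum_smul]
      have h1 : (cartanHom κ n (hcPow κ k r a)) * UF κ n a.1 a.1 = ∑ c : Idx κ k,
          if c = a then cartanHom κ n (hcPow κ k r a) * UF κ n a.1 a.1 else 0 := by simp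
      rw [h1, ← Finset.sum_add_distrib, ← Finset.sum_sub_distrib]
      refine Finset.sum_congr rfl fun c _ => ?_
      by_cases hc : a.1 < c.1
      · have : c ≠ a := by rintro rfl; omega
        simp [hc, this, smul_sub]
      · simp [hc]
    rw [pow_succ, Matrix.mul_apply, e, ← Finset.sum_sub_distrib]
    refine sum_mem fun c _ => ?_
    rcases lt_trichotomy a.1 c.1 with hac | hac | hac
    · rw [if_pos hac]
      have e2 := (calF_isFMatrix (κ := κ) hk).pow r c a a c
      rw [sub_eq_iff_eq_add, ← sub_eq_iff_eq_add'] at e2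
      rw [← e2]
      have e3 : brk (calF κ n k ^ r) c a a c
          = hcWeight κ a.1 c.1 • ((calF κ n k ^ r) c c - (calF κ n k ^ r) a a) := by
        simp only [brk, if_true, hcWeight]
        have n1 : (a = negIdx c) ↔ (c = negIdx a) := by rw [eq_comm, negIdx_eq_iff]
        have n2 : (c.1 = -a.1) ↔ (c = negIdx a) := by rw [Subtype.ext_iff]; rfl
        simp only [n1, n2]
        by_cases h : c = negIdx a
        · rw [if_pos h, if_pos h, if_pos h, h, th_negIdx_self, negIdx_negIdx]
          module
        · rw [if_neg h, if_neg h, if_neg h]; simp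
      have e4 : calF κ n k c a * (calF κ n k ^ r) a c - brk (calF κ n k ^ r) c a a c
          - hcWeight κ a.1 c.1 •
            (cartanHom κ n (hcPow κ k r a) - cartanHom κ n (hcPow κ k r c))
          = calF κ n k c a * (calF κ n k ^ r) a c
          + hcWeight κ a.1 c.1 • (((calF κ n k ^ r) a a - cartanHom κ n (hcPow κ k r a))
            - ((calF κ n k ^ r) c c - cartanHom κ n (hcPow κ k r c))) := by
        rw [e3]; module
      rw [e4]
      exact add_mem (leftIdealNPlus_left (UF_mem_Usub c a) (pow_mem_leftIdealNPlus hk r hac))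
        (Submodule.smul_mem _ _ (sub_mem (ih a) (ih c)))
    · obtain rfl : a = c := Subtype.ext hac
      rw [if_neg (lt_irrefl _), if_pos rfl]
      have : (calF κ n k ^ r) a a * calF κ n k a a
          - cartanHom κ n (hcPow κ k r a) * UF κ n a.1 a.1
          = ((calF κ n k ^ r) a a - cartanHom κ n (hcPow κ k r a)) * UF κ n a.1 a.1 := by
        rw [sub_mul]; rfl
      rw [this]
      exact leftIdealNPlus_mul_UF hk (ih a) a
    · rw [if_neg (by omega), if_neg (by rintro rfl; omega), sub_zero]
      exact mul_UF_mem_leftIdealNPlus (calF_pow_mem_Usub r a c) hac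

/-- The Harish-Chandra image of `Tr 𝓕^r`. -/
def hcTrace (κ : Series) (k r : ℕ) : HPoly := ∑ a, hcPow κ k r a

theorem hasHC_trace (hk : k ≤ n) (r : ℕ) :
    HasHC κ n k (calF κ n k ^ r).trace (hcTrace κ k r) := by
  refine ⟨sum_mem fun a _ => hcPow_mem r a, trace_pow_mem_Ucenter hk r, ?_⟩
  rw [hcTrace, map_sum, Matrix.trace, ← Finset.sum_sub_distrib]
  exact sum_mem fun a _ => pow_diag_sub_mem hk r a

end HC

/-! ### Series in `(u + c)⁻¹` -/

section gser

variable {R : Type*} [Ring R] [Algebra ℂ R]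

theorem coeff_succ_Vser_pow (κ : Series) (k i r : ℕ) :
    PowerSeries.coeff (i + 1) (Vser κ k ^ (r + 1))
      + shift κ k * PowerSeries.coeff i (Vser κ k ^ (r + 1)) = PowerSeries.coeff i (Vser κ k ^ r) := by
  have h : Vser κ k ^ (r + 1) * (1 + PowerSeries.C (shift κ k) * PowerSeries.X)
      = PowerSeries.X * Vser κ k ^ r := by
    rw [pow_succ, mul_assoc, Vser_mul, mul_comm]
  have h2 := congrArg (PowerSeries.coeff (i + 1)) h
  rw [PowerSeries.coeff_succ_X_mul, mul_add, mul_one, map_add, mul_left_comm,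
    PowerSeries.coeff_C_mul, PowerSeries.coeff_succ_mul_X] at h2
  exact h2

theorem coeff_Vser_pow_self (κ : Series) (k r : ℕ) : PowerSeries.coeff r (Vser κ k ^ r) = 1 := by
  induction r with
  | zero => simp
  | succ r ih =>
    have := coeff_succ_Vser_pow κ k r r
    rwa [coeff_Vser_pow_of_lt (Nat.lt_succ_self r), mul_zero, add_zero, ih] at this

/-- The series `∑ c_r (u + c)^{-r-1}`, where `c` is the shift. -/
def gser (κ : Series) (k : ℕ) (c : ℕ → R) : PowerSeries R :=
  PowerSeries.mk fun i => ∑ r ∈ Finset.range i, PowerSeries.coeff i (Vser κ k ^ (r + 1)) • c r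

/-- This is the identity (1 + cX)V = X applied term by term; it converts recursions for sequences
into equations for their generating series. -/
theorem gser_rec (κ : Series) (k : ℕ) (c : ℕ → R) :
    (1 + algebraMap ℂ (PowerSeries R) (shift κ k) * PowerSeries.X) * gser κ k c
      = PowerSeries.X * (PowerSeries.C (c 0) + gser κ k fun r => c (r + 1)) := by
  have hA : ∀ z : ℂ, algebraMap ℂ (PowerSeries R) z = PowerSeries.C (algebraMap ℂ R z) :=
    fun z => PowerSeries.algebraMap_apply
  ext1 i
  cases i with
  | zero => simp [gser]
  | succ i =>
    rw [PowerSeries.coeff_succ_X_mul, add_mul, one_mul, map_add, hA, mul_assoc,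
      PowerSeries.coeff_C_mul, PowerSeries.coeff_succ_X_mul, map_add, gser, gser]
    simp only [PowerSeries.coeff_mk]
    have e1 : ∑ r ∈ Finset.range i, PowerSeries.coeff i (Vser κ k ^ (r + 1)) • c r
        = ∑ r ∈ Finset.range (i + 1), PowerSeries.coeff i (Vser κ k ^ (r + 1)) • c r := by
      rw [Finset.sum_range_succ, coeff_Vser_pow_of_lt (Nat.lt_succ_self i), zero_smul, add_zero]
    rw [e1, ← Algebra.smul_def, Finset.smul_sum, ← Finset.sum_add_distrib]
    have e2 : ∀ r, PowerSeries.coeff (i + 1) (Vser κ k ^ (r + 1)) • c r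
        + shift κ k • PowerSeries.coeff i (Vser κ k ^ (r + 1)) • c r
        = PowerSeries.coeff i (Vser κ k ^ r) • c r := by
      intro r
      rw [smul_smul, ← add_smul, coeff_succ_Vser_pow]
    rw [Finset.sum_congr rfl fun r _ => e2 r, Finset.sum_range_succ', add_comm, pow_zero,
      PowerSeries.coeff_one, PowerSeries.coeff_C]
    congr 1
    split_ifs <;> simp

theorem gser_add (κ : Series) (k : ℕ) (c d : ℕ → R) :
    gser κ k (fun r => c r + d r) = gser κ k c + gser κ k d := by
  ext1 i
  simp [gser, Finset.sum_add_distrib]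

theorem gser_sum (κ : Series) (k : ℕ) {β : Type*} (T : Finset β) (c : β → ℕ → R) :
    gser κ k (fun r => ∑ b ∈ T, c b r) = ∑ b ∈ T, gser κ k (c b) := by
  ext1 i
  rw [map_sum]
  simp only [gser, PowerSeries.coeff_mk, Finset.smul_sum]
  rw [Finset.sum_comm]

theorem gser_mul (κ : Series) (k : ℕ) (a : R) (c : ℕ → R) :
    gser κ k (fun r => a * c r) = PowerSeries.C a * gser κ k c := by
  ext1 i
  rw [PowerSeries.coeff_C_mul]
  simp [gser, Finset.mul_sum]

theorem gser_neg (κ : Series) (k : ℕ) (c : ℕ → R) :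
    gser κ k (fun r => -c r) = -gser κ k c := by
  ext1 i
  simp [gser]

theorem gser_sub (κ : Series) (k : ℕ) (c d : ℕ → R) :
    gser κ k (fun r => c r - d r) = gser κ k c - gser κ k d := by
  simp only [sub_eq_add_neg, gser_add, gser_neg]

end gser

/-! ### The Harish-Chandra image of the generating series of the traces -/

section product

variable {κ : Series} {k : ℕ}

theorem sum_idx_lt {B : Type*} [AddCommMonoid B] (a : Idx κ k) (G : ℤ → B)
    (h0 : ∀ z, z ∉ idxSet κ k → G z = 0) :
    (∑ c : Idx κ k, if a.1 < c.1 then G c.1 else 0) = ∑ z ∈ Finset.Ioc a.1 (k : ℤ), G z := by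
  rw [Finset.sum_coe_sort (idxSet κ k) fun z => if a.1 < z then G z else 0, ← Finset.sum_filter]
  refine Finset.sum_subset (fun z hz => ?_) fun z hz hz' => h0 z fun h => hz' ?_
  · rw [Finset.mem_filter] at hz
    exact Finset.mem_Ioc.2 ⟨hz.2, idx_le ⟨z, hz.1⟩⟩
  · exact Finset.mem_filter.2 ⟨h, (Finset.mem_Ioc.1 hz).1⟩

/-- The generating series of the Harish-Chandra images of `(𝓕^r)_{zz}`. -/
def hcSer (κ : Series) (k : ℕ) (z : ℤ) : PowerSeries HPoly :=
  if h : z ∈ idxSet κ k then gser κ k fun r => hcPow κ k r ⟨z, h⟩ else 0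

/-- The tail `1 - ∑_{c > z}` of the generating series of the traces. -/
def hcTail (κ : Series) (k : ℕ) (z : ℤ) : PowerSeries HPoly :=
  1 - ∑ c ∈ Finset.Ioc z (k : ℤ), hcSer κ k c

theorem hcTail_sub_one {z : ℤ} (hz : z ≤ k) :
    hcTail κ k (z - 1) = hcTail κ k z - hcSer κ k z := by
  have : Finset.Ioc (z - 1) (k : ℤ) = insert z (Finset.Ioc z (k : ℤ)) := by
    ext x; simp only [Finset.mem_Ioc, Finset.mem_insert]; omega
  rw [hcTail, this, Finset.sum_insert (by simp), hcTail]; ring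

theorem hcTail_top : hcTail κ k k = 1 := by simp [hcTail]

/-- The sum of the weights of the indices `c > a`. -/
def hcWeightSum (κ : Series) (k : ℕ) (a : ℤ) : ℂ :=
  ∑ c : Idx κ k, if a < c.1 then hcWeight κ a c.1 else 0

theorem sum_hcWeight_mul (a : ℤ) (ha : -(k : ℤ) ≤ a) :
    ∑ z ∈ Finset.Ioc a (k : ℤ), algebraMap ℂ (PowerSeries HPoly) (hcWeight κ a z) * hcSer κ k z
      = 1 - hcTail κ k a
        - if a < 0 then algebraMap ℂ (PowerSeries HPoly) (eps κ) * hcSer κ k (-a) else 0 := by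
  have h1 : ∀ z, algebraMap ℂ (PowerSeries HPoly) (hcWeight κ a z) * hcSer κ k z
      = hcSer κ k z - if z = -a then algebraMap ℂ (PowerSeries HPoly) (eps κ)
        * hcSer κ k (-a) else 0 := by
    intro z
    rw [hcWeight, map_sub, map_one, sub_mul, one_mul]
    split_ifs with h
    · rw [h]
    · simp
  have h2 : (-a ∈ Finset.Ioc a (k : ℤ)) ↔ a < 0 := by rw [Finset.mem_Ioc]; omega
  simp only [h1, Finset.sum_sub_distrib, Finset.sum_ite_eq', h2, hcTail, sub_sub_cancel]

/-- The recursion for `hcPow` in generating form. The sum over the indices above a is expressed by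
the tail, and the exceptional index -a lies above a only when a is negative. -/
theorem hcSer_rec (a : Idx κ k) :
    (1 + algebraMap ℂ (PowerSeries HPoly) (shift κ k) * PowerSeries.X
      - PowerSeries.X * (PowerSeries.C (lam a.1)
        + algebraMap ℂ (PowerSeries HPoly) (hcWeightSum κ k a.1))) * hcSer κ k a.1
      = PowerSeries.X * (hcTail κ k a.1
        + if a.1 < 0 then algebraMap ℂ (PowerSeries HPoly) (eps κ) * hcSer κ k (-a.1) else 0) := by
  have hs : ∀ c : Idx κ k, hcSer κ k c.1 = gser κ k fun r => hcPow κ k r c := by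
    intro c; rw [hcSer, dif_pos c.2]
  have h := gser_rec κ k fun r => hcPow κ k r a
  have h2 : (gser κ k fun r => hcPow κ k (r + 1) a)
      = (PowerSeries.C (lam a.1) + algebraMap ℂ (PowerSeries HPoly) (hcWeightSum κ k a.1))
          * hcSer κ k a.1
        - ∑ c : Idx κ k, if a.1 < c.1 then algebraMap ℂ (PowerSeries HPoly) (hcWeight κ a.1 c.1)
          * hcSer κ k c.1 else 0 := by
    simp only [hcPow]
    rw [gser_sub, gser_mul, gser_sum, ← hs]
    refine congrArg₂ (· - ·) (congrArg (· * _) ?_) ?_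
    · rw [map_add, PowerSeries.algebraMap_apply, MvPolynomial.algebraMap_eq, hcWeightSum]
    · refine Finset.sum_congr rfl fun c _ => ?_
      split_ifs with hc
      · rw [hs]
        simp only [Algebra.smul_def]
        rw [gser_mul, PowerSeries.algebraMap_apply]
      · ext1 i; simp [gser]
  rw [sum_idx_lt a (fun z => algebraMap ℂ (PowerSeries HPoly) (hcWeight κ a.1 z) * hcSer κ k z)
    (fun z hz => by rw [hcSer, dif_neg hz, mul_zero]), sum_hcWeight_mul _ (neg_le_idx a)] at h2
  rw [h2, ← hs] at h
  have h3 : PowerSeries.C (hcPow κ k 0 a) = 1 := by rw [hcPow, map_one]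
  rw [h3] at h
  linear_combination h

theorem hcWeightSum_eq (a : Idx κ k) : hcWeightSum κ k a.1
    = ∑ z ∈ (idxSet κ k).filter (a.1 < ·), hcWeight κ a.1 z := by
  rw [hcWeightSum, Finset.sum_coe_sort (idxSet κ k)
    fun z => if a.1 < z then hcWeight κ a.1 z else 0, Finset.sum_filter]

theorem hcWeightSum_pos {b : ℕ} (h1 : 1 ≤ b) (h2 : b ≤ k) :
    hcWeightSum κ k b = shift κ k - 1 / 2 + rho κ b := by
  have := hcWeightSum_eq (κ := κ) (k := k) ⟨b, idxSet_mono h2 (top_mem_idxSet h1)⟩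
  simp only at this
  have hf : (idxSet κ k).filter ((b : ℤ) < ·) = Finset.Ioc (b : ℤ) k := by
    ext z
    cases κ <;> simp only [idxSet, Finset.mem_filter, Finset.mem_erase, Finset.mem_Icc,
      Finset.mem_Ioc] <;> omega
  have hw : ∀ z ∈ Finset.Ioc (b : ℤ) k, hcWeight κ b z = 1 := by
    intro z hz
    rw [Finset.mem_Ioc] at hz
    rw [hcWeight, if_neg (by omega), sub_zero]
  rw [this, hf, Finset.sum_congr rfl hw, Finset.sum_const, Int.card_Ioc,
    show ((k : ℤ) - b).toNat = k - b by omega, nsmul_eq_mul, Nat.cast_sub h2]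
  cases κ <;> simp only [shift, rho] <;> ring

theorem card_filter_neg_lt {b : ℕ} (h1 : 1 ≤ b) (h2 : b ≤ k) :
    ((idxSet κ k).filter (-(b : ℤ) < ·)).card = match κ with
      | .C => k + b - 1 | .B => k + b := by
  cases κ
  · have hf : (idxSet .C k).filter (-(b : ℤ) < ·) = (Finset.Ioc (-(b : ℤ)) k).erase 0 := by
      ext z
      simp only [idxSet, Finset.mem_filter, Finset.mem_erase, Finset.mem_Icc,
        Finset.mem_Ioc]; omega
    rw [hf, Finset.card_erase_of_mem (Finset.mem_Ioc.2 (by omega)), Int.card_Ioc]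
    simp only; omega
  · have hf : (idxSet .B k).filter (-(b : ℤ) < ·) = Finset.Ioc (-(b : ℤ)) k := by
      ext z
      simp only [idxSet, Finset.mem_filter, Finset.mem_Icc, Finset.mem_Ioc]; omega
    rw [hf, Int.card_Ioc]
    simp only; omega

/-- The index b lies above -b and counts with 1 - ε. This compensates for the missing index 0 in the
symplectic case, so the same formula serves both series. -/
theorem hcWeightSum_neg {b : ℕ} (h1 : 1 ≤ b) (h2 : b ≤ k) :
    hcWeightSum κ k (-b) = shift κ k - 1 / 2 - rho κ b := by
  have hb := idxSet_mono (κ := κ) h2 (top_mem_idxSet h1)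
  have := hcWeightSum_eq (κ := κ) (k := k) ⟨-b, neg_mem_idxSet hb⟩
  simp only at this
  have hw : ∀ z, hcWeight κ (-b) z = 1 - if z = b then eps κ else 0 := by
    intro z; rw [hcWeight, neg_neg]
  have hm : (b : ℤ) ∈ (idxSet κ k).filter (-(b : ℤ) < ·) :=
    Finset.mem_filter.2 ⟨hb, by omega⟩
  rw [this, Finset.sum_congr rfl fun z _ => hw z, Finset.sum_sub_distrib, Finset.sum_ite_eq',
    if_pos hm, Finset.sum_const, card_filter_neg_lt h1 h2, nsmul_one]
  cases κ
  · simp only [shift, rho, eps]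
    rw [Nat.cast_sub (by omega)]; push_cast; ring
  · simp only [shift, rho, eps]; push_cast; ring

theorem hcWeightSum_zero : hcWeightSum .B k 0 = shift .B k := by
  have := hcWeightSum_eq (κ := .B) (k := k) ⟨0, by simp [idxSet]⟩
  simp only at this
  have hf : (idxSet .B k).filter ((0 : ℤ) < ·) = Finset.Ioc (0 : ℤ) k := by
    ext z
    simp only [idxSet, Finset.mem_filter, Finset.mem_Icc, Finset.mem_Ioc]; omega
  have hw : ∀ z ∈ Finset.Ioc (0 : ℤ) k, hcWeight .B 0 z = 1 := by
    intro z hz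
    rw [Finset.mem_Ioc] at hz
    rw [hcWeight, if_neg (by omega), sub_zero]
  rw [this, hf, Finset.sum_congr rfl hw, Finset.sum_const, Int.card_Ioc]
  simp [shift]

/-- The coordinate `l_{i+1} = λ_{i+1} + ρ_{i+1}`. -/
def lShift (κ : Series) (i : ℕ) : PowerSeries HPoly :=
  PowerSeries.C (MvPolynomial.X i + algebraMap ℂ HPoly (rho κ (i + 1)))

/-- The constant `1/2`. -/
abbrev hlf : PowerSeries HPoly := algebraMap ℂ (PowerSeries HPoly) (1 / 2)

theorem two_hlf : 2 * hlf = 1 := by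
  rw [hlf, show (2 : PowerSeries HPoly) = algebraMap ℂ _ 2 from (map_ofNat _ 2).symm, ← map_mul]; norm_num

theorem lam_pos (i : ℕ) : lam ((i + 1 : ℕ) : ℤ) = MvPolynomial.X i := by
  rw [lam, if_pos (by omega)]; congr 1

theorem lam_neg (i : ℕ) : lam (-((i + 1 : ℕ) : ℤ)) = -MvPolynomial.X i := by
  rw [lam, if_neg (by omega), if_pos (by omega)]; congr 2

/-- The constants of the recursion combine to 1/2 - ρ, so that λ and ρ occur only through l = λ + ρ.
-/
theorem hcSer_pos {i : ℕ} (hi : i < k) :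
    (1 + hlf * PowerSeries.X - lShift κ i * PowerSeries.X) * hcSer κ k (i + 1 : ℕ)
      = PowerSeries.X * hcTail κ k (i + 1 : ℕ) := by
  have h := hcSer_rec (κ := κ) (k := k) ⟨(i + 1 : ℕ), idxSet_mono hi (top_mem_idxSet (by omega))⟩
  simp only at h
  rw [if_neg (by omega), hcWeightSum_pos (by omega) hi, lam_pos] at h
  simp only [map_add, map_sub] at h
  have e : lShift κ i = PowerSeries.C (MvPolynomial.X i)
      + algebraMap ℂ (PowerSeries HPoly) (rho κ (i + 1)) := by
    rw [lShift, map_add, PowerSeries.algebraMap_apply]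
  rw [e]
  linear_combination h

theorem hcSer_neg {i : ℕ} (hi : i < k) :
    (1 + hlf * PowerSeries.X + lShift κ i * PowerSeries.X) * hcSer κ k (-(i + 1 : ℕ))
      = PowerSeries.X * (hcTail κ k (-(i + 1 : ℕ))
        + algebraMap ℂ (PowerSeries HPoly) (eps κ) * hcSer κ k (i + 1 : ℕ)) := by
  have h := hcSer_rec (κ := κ) (k := k)
    ⟨-(i + 1 : ℕ), neg_mem_idxSet (idxSet_mono hi (top_mem_idxSet (by omega)))⟩
  simp only at h
  rw [if_pos (by omega), hcWeightSum_neg (by omega) hi, lam_neg, neg_neg] at h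
  simp only [map_sub, map_neg] at h
  have e : lShift κ i = PowerSeries.C (MvPolynomial.X i)
      + algebraMap ℂ (PowerSeries HPoly) (rho κ (i + 1)) := by
    rw [lShift, map_add, PowerSeries.algebraMap_apply]
  rw [e]
  linear_combination h

/-- Passing one positive index multiplies the tail by (u - 1/2 - l)/(u + 1/2 - l), and the factors
accumulate down to 0. -/
theorem hcTail_zero : ∀ j ≤ k, hcTail κ k ((k - j : ℕ) : ℤ)
    * ∏ i ∈ Finset.Ico (k - j) k, (1 + hlf * PowerSeries.X - lShift κ i * PowerSeries.X)
      = ∏ i ∈ Finset.Ico (k - j) k, (1 - hlf * PowerSeries.X - lShift κ i * PowerSeries.X) := by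
  intro j
  induction j with
  | zero => simp [hcTail_top]
  | succ j ih =>
    intro hj
    have ih := ih (by omega)
    have h1 : Finset.Ico (k - (j + 1)) k = insert (k - (j + 1)) (Finset.Ico (k - j) k) := by
      ext x; simp only [Finset.mem_Ico, Finset.mem_insert]; omega
    rw [h1, Finset.prod_insert (by simp; omega), Finset.prod_insert (by simp; omega)]
    have h2 := hcTail_sub_one (κ := κ) (k := k) (z := ((k - j : ℕ) : ℤ)) (by omega)
    rw [show ((k - j : ℕ) : ℤ) - 1 = ((k - (j + 1) : ℕ) : ℤ) by omega] at h2
    have h3 := hcSer_pos (κ := κ) (k := k) (i := k - (j + 1)) (by omega)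
    rw [show k - (j + 1) + 1 = k - j by omega] at h3
    rw [h2, ← ih]
    have h4 := two_hlf
    generalize hcTail κ k ((k - j : ℕ) : ℤ) = t at *
    generalize hcSer κ k ((k - j : ℕ) : ℤ) = f at *
    generalize ∏ i ∈ Finset.Ico (k - j) k, (1 + hlf * PowerSeries.X
      - lShift κ i * PowerSeries.X) = P at *
    linear_combination -P * h3 + t * P * PowerSeries.X * h4

/-- The combination of tails which satisfies a two-term recursion. -/
def hcQ (κ : Series) (k i : ℕ) : PowerSeries HPoly :=
  hcTail κ k (-(i + 1 : ℕ))
    + algebraMap ℂ (PowerSeries HPoly) (eps κ) * hlf * PowerSeries.X * hcTail κ k i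

/-- For negative indices the recursion also involves the series at the opposite positive index. The
term with ε/(2u) in `hcQ` absorbs it and leaves the clean factor (u - 1/2 + l)/(u + 1/2 + l). -/
theorem hcQ_succ {i : ℕ} (hi : i < k) :
    (1 + hlf * PowerSeries.X + lShift κ i * PowerSeries.X) * hcQ κ k (i + 1)
      = (1 - hlf * PowerSeries.X + lShift κ i * PowerSeries.X) * hcQ κ k i := by
  have h1 := hcTail_sub_one (κ := κ) (k := k) (z := ((i + 1 : ℕ) : ℤ)) (by omega)
  have h2 := hcTail_sub_one (κ := κ) (k := k) (z := -((i + 1 : ℕ) : ℤ)) (by omega)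
  rw [show ((i + 1 : ℕ) : ℤ) - 1 = (i : ℕ) by omega] at h1
  rw [show -((i + 1 : ℕ) : ℤ) - 1 = -((i + 1 + 1 : ℕ) : ℤ) by omega] at h2
  have h3 := hcSer_pos (κ := κ) hi
  have h4 := hcSer_neg (κ := κ) hi
  have h5 := two_hlf
  rw [hcQ, hcQ, h1, h2]
  generalize hcTail κ k ((i + 1 : ℕ) : ℤ) = t at *
  generalize hcTail κ k (-((i + 1 : ℕ) : ℤ)) = t' at *
  generalize hcSer κ k ((i + 1 : ℕ) : ℤ) = f at *
  generalize hcSer κ k (-((i + 1 : ℕ) : ℤ)) = f' at *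
  generalize algebraMap ℂ (PowerSeries HPoly) (eps κ) = e at *
  generalize hlf = H at *
  linear_combination -h4 - e * H * PowerSeries.X * h3
    + (PowerSeries.X * t' + PowerSeries.X * e * f + H * PowerSeries.X ^ 2 * e * t) * h5

end product

/-! ### The product formula and the functional equation of the image of χ_k -/

section product

variable {κ : Series} {k : ℕ}

theorem hcQ_top : hcQ κ k k = 1 - gser κ k (hcTrace κ k)
    + algebraMap ℂ (PowerSeries HPoly) (eps κ) * hlf * PowerSeries.X := by
  have h : hcTail κ k (-(k + 1 : ℕ)) = 1 - gser κ k (hcTrace κ k) := by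
    have h1 : gser κ k (hcTrace κ k) = ∑ a : Idx κ k, hcSer κ k a.1 := by
      have : hcTrace κ k = fun r => ∑ a, hcPow κ k r a := rfl
      rw [this, gser_sum]
      refine Finset.sum_congr rfl fun c _ => ?_
      rw [hcSer, dif_pos c.2]
    rw [h1, Finset.sum_coe_sort (idxSet κ k) fun z => hcSer κ k z, hcTail]
    congr 1
    refine (Finset.sum_subset (fun z hz => ?_) fun z _ hz => ?_).symm
    · have h2 := idx_le ⟨z, hz⟩
      have h3 := neg_le_idx ⟨z, hz⟩
      rw [Finset.mem_Ioc]
      simp only at h2 h3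
      omega
    · rw [hcSer, dif_neg hz]
  rw [hcQ, h, hcTail_top, mul_one]

/-- In the symplectic case there is no index 0 and the tail does not change there, while ε = -1. In
the orthogonal case the series at 0 is the tail divided by u. Both give the factor 1 - 1/(2u). -/
theorem hcQ_zero : hcQ κ k 0 = (1 - hlf * PowerSeries.X) * hcTail κ k 0 := by
  have h1 := hcTail_sub_one (κ := κ) (k := k) (z := 0) (by omega)
  have h5 := two_hlf
  rw [hcQ, show -((0 + 1 : ℕ) : ℤ) = 0 - 1 by omega, h1, Nat.cast_zero]
  cases κ with
  | C =>
    have : hcSer .C k 0 = 0 := by rw [hcSer, dif_neg (by simp [idxSet])]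
    rw [this]
    simp only [eps, map_neg, map_one]
    ring
  | B =>
    have h := hcSer_rec (κ := .B) (k := k) ⟨0, by simp [idxSet]⟩
    simp only [lt_irrefl, if_false, hcWeightSum_zero] at h
    have h0 : lam 0 = 0 := by simp [lam]
    rw [h0, map_zero] at h
    simp only [eps, map_one]
    linear_combination -h + PowerSeries.X * hcTail .B k 0 * h5

/-- The numerator of the Harish-Chandra image of `χ_k(u)`. -/
def hcNum (κ : Series) (k : ℕ) : PowerSeries HPoly :=
  ∏ i ∈ Finset.range k, ((1 + hlf * PowerSeries.X) ^ 2 - (lShift κ i) ^ 2 * PowerSeries.X ^ 2)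

/-- The numerator of the Harish-Chandra image of `χ_k(-u)`. -/
def hcNumNeg (κ : Series) (k : ℕ) : PowerSeries HPoly :=
  ∏ i ∈ Finset.range k, ((1 - hlf * PowerSeries.X) ^ 2 - (lShift κ i) ^ 2 * PowerSeries.X ^ 2)

/-- The factors with u + 1/2 - l come from the positive indices and those with u + 1/2 + l from the
negative ones; together they form the quadratic factors of the image of χ_k. -/
theorem gser_hcTrace_mul_hcNum : (1 - gser κ k (hcTrace κ k)
    + algebraMap ℂ (PowerSeries HPoly) (eps κ) * hlf * PowerSeries.X) * hcNum κ k
      = (1 - hlf * PowerSeries.X) * hcNumNeg κ k := by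
  have h1 := hcTail_zero (κ := κ) (k := k) k le_rfl
  simp only [Nat.sub_self, ← Finset.range_eq_Ico, Nat.cast_zero] at h1
  have h2 : ∀ j ≤ k, (∏ i ∈ Finset.range j,
      (1 + hlf * PowerSeries.X + lShift κ i * PowerSeries.X)) * hcQ κ k j
      = (∏ i ∈ Finset.range j, (1 - hlf * PowerSeries.X + lShift κ i * PowerSeries.X))
        * hcQ κ k 0 := by
    intro j
    induction j with
    | zero => simp
    | succ j ih =>
      intro hj
      have h3 := hcQ_succ (κ := κ) (show j < k by omega)
      rw [Finset.prod_range_succ, Finset.prod_range_succ, mul_assoc, h3]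
      linear_combination (1 - hlf * PowerSeries.X + lShift κ j * PowerSeries.X) * ih (by omega)
  have h2 := h2 k le_rfl
  rw [hcQ_top, hcQ_zero] at h2
  have e1 : hcNum κ k = (∏ i ∈ Finset.range k,
        (1 + hlf * PowerSeries.X - lShift κ i * PowerSeries.X))
      * ∏ i ∈ Finset.range k, (1 + hlf * PowerSeries.X + lShift κ i * PowerSeries.X) := by
    rw [← Finset.prod_mul_distrib]
    exact Finset.prod_congr rfl fun i _ => by ring
  have e2 : hcNumNeg κ k = (∏ i ∈ Finset.range k,
        (1 - hlf * PowerSeries.X - lShift κ i * PowerSeries.X))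
      * ∏ i ∈ Finset.range k, (1 - hlf * PowerSeries.X + lShift κ i * PowerSeries.X) := by
    rw [← Finset.prod_mul_distrib]
    exact Finset.prod_congr rfl fun i _ => by ring
  rw [e1, e2, ← h1]
  linear_combination (∏ i ∈ Finset.range k,
        (1 + hlf * PowerSeries.X - lShift κ i * PowerSeries.X)) * h2

/-- The denominator of the Harish-Chandra image of `χ_k(u)`. -/
def hcDen (κ : Series) (k : ℕ) : PowerSeries HPoly :=
  ∏ i ∈ Finset.range k, ((1 + hlf * PowerSeries.X) ^ 2
    - (algebraMap ℂ (PowerSeries HPoly) (rho κ (i + 1))) ^ 2 * PowerSeries.X ^ 2)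

/-- The denominator of the Harish-Chandra image of `χ_k(-u)`. -/
def hcDenNeg (κ : Series) (k : ℕ) : PowerSeries HPoly :=
  ∏ i ∈ Finset.range k, ((1 - hlf * PowerSeries.X) ^ 2
    - (algebraMap ℂ (PowerSeries HPoly) (rho κ (i + 1))) ^ 2 * PowerSeries.X ^ 2)

/-- Each quadratic factor splits into two linear ones. In the quotient of the products for -u and u,
consecutive values of ρ telescope and only end factors remain. -/
theorem hcDenNeg_mul :
    (1 + algebraMap ℂ (PowerSeries HPoly) (shift κ k) * PowerSeries.X)
      * (1 - hlf * PowerSeries.X) * hcDenNeg κ k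
    = (1 - algebraMap ℂ (PowerSeries HPoly) (shift κ k) * PowerSeries.X)
      * (1 - algebraMap ℂ (PowerSeries HPoly) (eps κ) * hlf * PowerSeries.X) * hcDen κ k := by
  have h5 := two_hlf
  have h6 : (1 : ℂ) = 1 / 2 + 1 / 2 := by norm_num
  induction k with
  | zero =>
    cases κ
    · simp only [hcDenNeg, hcDen, Finset.range_zero, Finset.prod_empty, shift, eps, Nat.cast_zero,
        zero_add, map_neg, map_one, hlf]
      ring
    · simp [hcDenNeg, hcDen, shift, eps]
  | succ k ih =>
    rw [hcDenNeg, hcDen, Finset.prod_range_succ, Finset.prod_range_succ, ← hcDenNeg, ← hcDen]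
    cases κ
    · simp only [shift, rho, eps, map_add, map_neg, map_one, Nat.cast_add, Nat.cast_one] at ih ⊢
      rw [show algebraMap ℂ (PowerSeries HPoly) (1 / 2) = hlf from rfl] at ih ⊢
      generalize algebraMap ℂ (PowerSeries HPoly) (k : ℂ) = K at *
      generalize hlf = H at *
      have e1 : (1 + H * PowerSeries.X) ^ 2 - (-(K + 1)) ^ 2 * PowerSeries.X ^ 2
          = (1 - (K + H) * PowerSeries.X) * (1 + (K + 1 + H) * PowerSeries.X) := by
        linear_combination PowerSeries.X * (1 + (K + 1 + H) * PowerSeries.X) * h5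
      have e2 : (1 - H * PowerSeries.X) ^ 2 - (-(K + 1)) ^ 2 * PowerSeries.X ^ 2
          = (1 + (K + H) * PowerSeries.X) * (1 - (K + 1 + H) * PowerSeries.X) := by
        linear_combination -PowerSeries.X * (1 - (K + 1 + H) * PowerSeries.X) * h5
      rw [e1, e2]
      linear_combination (1 + (K + 1 + H) * PowerSeries.X)
        * (1 - (K + 1 + H) * PowerSeries.X) * ih
    · simp only [shift, rho, eps, map_add, map_neg, map_one, Nat.cast_add, Nat.cast_one] at ih ⊢
      rw [show algebraMap ℂ (PowerSeries HPoly) (1 / 2) = hlf from rfl]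
      generalize algebraMap ℂ (PowerSeries HPoly) (k : ℂ) = K at *
      generalize hlf = H at *
      have e1 : (1 + H * PowerSeries.X) ^ 2 - (-(K + 1) + H) ^ 2 * PowerSeries.X ^ 2
          = (1 - K * PowerSeries.X) * (1 + (K + 1) * PowerSeries.X) := by
        linear_combination PowerSeries.X * (1 + (K + 1) * PowerSeries.X) * h5
      have e2 : (1 - H * PowerSeries.X) ^ 2 - (-(K + 1) + H) ^ 2 * PowerSeries.X ^ 2
          = (1 + K * PowerSeries.X) * (1 - (K + 1) * PowerSeries.X) := by
        linear_combination -PowerSeries.X * (1 - (K + 1) * PowerSeries.X) * h5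
      rw [e1, e2]
      linear_combination (1 + (K + 1) * PowerSeries.X)
        * (1 - (K + 1) * PowerSeries.X) * ih

/-- The Harish-Chandra image of `χ_k(u)`. -/
def hcChi (κ : Series) (k : ℕ) : PowerSeries HPoly :=
  ((List.range k).map fun i =>
    ((1 + hlf * PowerSeries.X) ^ 2 - (lShift κ i) ^ 2 * PowerSeries.X ^ 2)
    * PowerSeries.map (algebraMap ℂ HPoly)
      ((1 + PowerSeries.C (1 / 2 : ℂ) * PowerSeries.X) ^ 2
        - PowerSeries.C (rho κ (i + 1) ^ 2) * PowerSeries.X ^ 2)⁻¹).prod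

theorem map_cartanHom_hcChi {n : ℕ} (hk : k ≤ n) :
    PowerSeries.map (cartanHom κ n : HPoly →+* U κ n) (hcChi κ k) = cartanSeries κ n k := by
  rw [hcChi, cartanSeries, map_list_prod, List.map_map]
  refine congrArg List.prod (List.map_congr_left fun i hi => ?_)
  rw [List.mem_range] at hi
  have h1 : ∀ z : ℂ, (cartanHom κ n : HPoly →+* U κ n) (algebraMap ℂ HPoly z)
      = algebraMap ℂ (U κ n) z := fun z => AlgHom.commutes _ z
  have h2 : ∀ f : PowerSeries ℂ, PowerSeries.map (cartanHom κ n : HPoly →+* U κ n)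
      (PowerSeries.map (algebraMap ℂ HPoly) f) = PowerSeries.map (algebraMap ℂ (U κ n)) f := by
    intro f; ext1 r; simp only [PowerSeries.coeff_map, h1]
  have h3 : (cartanHom κ n : HPoly →+* U κ n) (MvPolynomial.X i)
      = UF κ n (i + 1 : ℕ) (i + 1 : ℕ) := cartanHom_X (by omega)
  simp only [Function.comp_apply, map_mul, h2, map_sub, map_pow, map_add, map_one, lShift,
    PowerSeries.algebraMap_apply, PowerSeries.map_C, PowerSeries.map_X, h1, h3]

theorem hcChi_mul_hcDen : hcChi κ k * hcDen κ k = hcNum κ k := by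
  have : hcChi κ k = ∏ i ∈ Finset.range k,
      ((1 + hlf * PowerSeries.X) ^ 2 - (lShift κ i) ^ 2 * PowerSeries.X ^ 2)
      * PowerSeries.map (algebraMap ℂ HPoly)
      ((1 + PowerSeries.C (1 / 2 : ℂ) * PowerSeries.X) ^ 2
        - PowerSeries.C (rho κ (i + 1) ^ 2) * PowerSeries.X ^ 2)⁻¹ := by
    rw [hcChi, ← Multiset.prod_coe, ← Multiset.map_coe]; rfl
  rw [this, hcDen, hcNum, ← Finset.prod_mul_distrib]
  refine Finset.prod_congr rfl fun i _ => ?_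
  have e : (1 + hlf * PowerSeries.X) ^ 2
      - (algebraMap ℂ (PowerSeries HPoly) (rho κ (i + 1))) ^ 2 * PowerSeries.X ^ 2
      = PowerSeries.map (algebraMap ℂ HPoly) ((1 + PowerSeries.C (1 / 2 : ℂ) * PowerSeries.X) ^ 2
        - PowerSeries.C (rho κ (i + 1) ^ 2) * PowerSeries.X ^ 2) := by
    simp only [map_sub, map_pow, map_add, map_one, map_mul, PowerSeries.algebraMap_apply,
      PowerSeries.map_C, PowerSeries.map_X]
  rw [e, mul_assoc, ← map_mul, PowerSeries.inv_mul_cancel, map_one, mul_one]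
  simp

theorem hcDen_ne_zero : hcDen κ k ≠ 0 := by
  intro h
  have := congrArg PowerSeries.constantCoeff h
  simp [hcDen] at this

/-- The substitution `u ↦ -u`. -/
abbrev negSubst : PowerSeries HPoly →+* PowerSeries HPoly := PowerSeries.evalNegHom

theorem evalNegHom_C {R : Type*} [CommRing R] (z : R) :
    PowerSeries.evalNegHom (PowerSeries.C z) = PowerSeries.C z := by
  ext1 i
  rw [PowerSeries.evalNegHom, PowerSeries.coeff_rescale, PowerSeries.coeff_C]
  split_ifs with h
  · rw [h]; simp
  · simp

theorem negSubst_hcNum : negSubst (hcNum κ k) = hcNumNeg κ k := by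
  simp only [hcNum, hcNumNeg, map_prod, map_sub, map_pow, map_add, map_one, map_mul,
    PowerSeries.algebraMap_apply, evalNegHom_C, PowerSeries.evalNegHom_X, lShift]
  exact Finset.prod_congr rfl fun i _ => by ring

theorem negSubst_hcDen : negSubst (hcDen κ k) = hcDenNeg κ k := by
  simp only [hcDen, hcDenNeg, map_prod, map_sub, map_pow, map_add, map_one, map_mul,
    PowerSeries.algebraMap_apply, evalNegHom_C, PowerSeries.evalNegHom_X]
  exact Finset.prod_congr rfl fun i _ => by ring

/-- The factor 1 - 1/(2u) in the formula for the traces is exactly what the quotient of denominators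
removes, so only χ and the trace series remain. -/
theorem hcChi_mul_eq :
    hcChi κ k * ((1 + algebraMap ℂ (PowerSeries HPoly) (shift κ k) * PowerSeries.X)
      * (1 - gser κ k (hcTrace κ k)
        + algebraMap ℂ (PowerSeries HPoly) (eps κ) * hlf * PowerSeries.X))
    = negSubst (hcChi κ k)
      * ((1 - algebraMap ℂ (PowerSeries HPoly) (shift κ k) * PowerSeries.X)
      * (1 - algebraMap ℂ (PowerSeries HPoly) (eps κ) * hlf * PowerSeries.X)) := by
  have h1 := hcChi_mul_hcDen (κ := κ) (k := k)
  have h2 := congrArg negSubst h1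
  rw [map_mul, negSubst_hcNum, negSubst_hcDen] at h2
  have h3 := gser_hcTrace_mul_hcNum (κ := κ) (k := k)
  have h4 := hcDenNeg_mul (κ := κ) (k := k)
  refine mul_right_cancel₀ (hcDen_ne_zero (κ := κ) (k := k)) ?_
  rw [← h1, ← h2] at h3
  linear_combination (1 + algebraMap ℂ (PowerSeries HPoly) (shift κ k) * PowerSeries.X) * h3
    + negSubst (hcChi κ k) * h4

/-- The series `(u - 1)⁻¹`. -/
def geomSer : PowerSeries HPoly := PowerSeries.X * PowerSeries.mk 1

theorem geomSer_mul : geomSer * (1 - PowerSeries.X) = PowerSeries.X := by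
  rw [geomSer, mul_assoc, PowerSeries.mk_one_mul_one_sub_eq_one, mul_one]

theorem hasSubst_geomSer : PowerSeries.HasSubst geomSer :=
  PowerSeries.HasSubst.of_constantCoeff_zero' (by simp [geomSer])

/-- The substitution `u ↦ u - 1`. -/
def shiftSubst : PowerSeries HPoly →ₐ[HPoly] PowerSeries HPoly :=
  PowerSeries.substAlgHom hasSubst_geomSer

theorem shiftSubst_X : shiftSubst PowerSeries.X = geomSer :=
  PowerSeries.substAlgHom_X hasSubst_geomSer

theorem shiftSubst_C (z : HPoly) : shiftSubst (PowerSeries.C z) = PowerSeries.C z :=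
  AlgHom.commutes shiftSubst z

theorem shiftSubst_prod {B : Type*} (T : Finset B) (l : B → HPoly) :
    (1 - PowerSeries.X) ^ (2 * T.card) * shiftSubst (∏ i ∈ T,
      ((1 + hlf * PowerSeries.X) ^ 2 - PowerSeries.C (l i) ^ 2 * PowerSeries.X ^ 2))
      = ∏ i ∈ T, ((1 - hlf * PowerSeries.X) ^ 2 - PowerSeries.C (l i) ^ 2 * PowerSeries.X ^ 2) := by
  simp only [map_prod, map_sub, map_pow, map_add, map_one, map_mul]
  rw [pow_mul, ← Finset.prod_const, ← Finset.prod_mul_distrib]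
  refine Finset.prod_congr rfl fun i _ => ?_
  have h5 := two_hlf
  have h6 : shiftSubst hlf = hlf := by
    rw [hlf, PowerSeries.algebraMap_apply, shiftSubst_C]
  have h7 := geomSer_mul
  rw [h6, shiftSubst_C, shiftSubst_X]
  generalize geomSer = G at *
  generalize hlf = H at *
  generalize PowerSeries.C (l i) = L
  have h8 : (1 - PowerSeries.X) * (1 + H * G) = 1 - H * PowerSeries.X := by
    linear_combination H * h7 + PowerSeries.X * h5
  have h9 : (1 - PowerSeries.X) ^ 2 * ((1 + H * G) ^ 2 - L ^ 2 * G ^ 2)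
      = ((1 - PowerSeries.X) * (1 + H * G)) ^ 2 - L ^ 2 * (G * (1 - PowerSeries.X)) ^ 2 := by ring
  rw [h9, h8, h7]

/-- The image of χ_k is a function of (u + 1/2)², and both u ↦ -u and u ↦ u - 1 turn this into (u -
1/2)². -/
theorem shiftSubst_hcChi : shiftSubst (hcChi κ k) = negSubst (hcChi κ k) := by
  have h1 := hcChi_mul_hcDen (κ := κ) (k := k)
  have h2 := congrArg negSubst h1
  rw [map_mul, negSubst_hcNum, negSubst_hcDen] at h2
  have h3 := congrArg shiftSubst h1
  rw [map_mul] at h3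
  have e1 : (1 - PowerSeries.X) ^ (2 * k) * shiftSubst (hcNum κ k) = hcNumNeg κ k := by
    have := shiftSubst_prod (Finset.range k)
      fun i => (MvPolynomial.X i + algebraMap ℂ HPoly (rho κ (i + 1)))
    rw [Finset.card_range] at this
    simp only [hcNum, hcNumNeg, lShift]
    exact this
  have e2 : (1 - PowerSeries.X) ^ (2 * k) * shiftSubst (hcDen κ k) = hcDenNeg κ k := by
    have := shiftSubst_prod (Finset.range k) fun i => algebraMap ℂ HPoly (rho κ (i + 1))
    rw [Finset.card_range] at this
    simp only [← PowerSeries.algebraMap_apply] at this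
    rw [hcDen, hcDenNeg]
    exact this
  have h4 : hcDenNeg κ k ≠ 0 := by
    intro h
    have := congrArg PowerSeries.constantCoeff h
    simp [hcDenNeg] at this
  refine mul_right_cancel₀ h4 ?_
  rw [h2, ← e1, ← e2, ← h3]
  ring

end product

/-! ### A Newton-type recursion for the coefficients of χ_k -/

section recursion

variable {κ : Series} {k : ℕ}

/-- The series `(1 + c X)(1 + ε X / 2)`. -/
def aSer (κ : Series) (k : ℕ) : PowerSeries ℂ :=
  (1 + PowerSeries.C (shift κ k) * PowerSeries.X)
    * (1 + PowerSeries.C (eps κ * (1 / 2)) * PowerSeries.X)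

/-- The series `(1 - c X)(1 - ε X / 2)`. -/
def bSer (κ : Series) (k : ℕ) : PowerSeries ℂ :=
  (1 - PowerSeries.C (shift κ k) * PowerSeries.X)
    * (1 - PowerSeries.C (eps κ * (1 / 2)) * PowerSeries.X)

/-- The coefficients of `(1 + c X)(1 - ∑ t_r V^{r+1} + ε X / 2)`. -/
def aCoeff {R : Type*} [Ring R] [Algebra ℂ R] (κ : Series) (k : ℕ) (t : ℕ → R) (m : ℕ) : R :=
  algebraMap ℂ R (PowerSeries.coeff m (aSer κ k))
    - ∑ r ∈ Finset.range m, PowerSeries.coeff (m - 1) (Vser κ k ^ r) • t r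

theorem mk_aCoeff {R : Type*} [Ring R] [Algebra ℂ R] (t : ℕ → R) :
    PowerSeries.mk (aCoeff κ k t) = PowerSeries.map (algebraMap ℂ R) (aSer κ k)
      - (1 + algebraMap ℂ (PowerSeries R) (shift κ k) * PowerSeries.X) * gser κ k t := by
  rw [gser_rec]
  ext1 m
  rw [PowerSeries.coeff_mk, map_sub, PowerSeries.coeff_map, aCoeff]
  congr 1
  cases m with
  | zero => simp
  | succ m =>
    rw [PowerSeries.coeff_succ_X_mul, map_add, gser, PowerSeries.coeff_mk, Finset.sum_range_succ',
      add_comm, Nat.add_sub_cancel, pow_zero, PowerSeries.coeff_one, PowerSeries.coeff_C]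
    congr 1
    split_ifs <;> simp

/-- The `m`-th coefficient of `X^j (1 - X)^{-j} (1 - c X)(1 - ε X / 2)`. -/
def gam (κ : Series) (k m j : ℕ) : ℂ :=
  PowerSeries.coeff m ((PowerSeries.X * PowerSeries.mk 1) ^ j * bSer κ k)

theorem gam_self (j : ℕ) : gam κ k j j = 1 := by
  rw [gam, mul_pow, mul_assoc]
  have := PowerSeries.coeff_X_pow_mul (PowerSeries.mk 1 ^ j * bSer κ k) j 0
  rw [zero_add] at this
  rw [this]
  simp [bSer]

theorem gam_succ (j : ℕ) : gam κ k (j + 1) j = j - shift κ k - eps κ * (1 / 2) := by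
  rw [gam, mul_pow, mul_assoc]
  have := PowerSeries.coeff_X_pow_mul (PowerSeries.mk 1 ^ j * bSer κ k) j 1
  rw [add_comm] at this
  rw [this, PowerSeries.coeff_one_mul, PowerSeries.coeff_one_pow, bSer, PowerSeries.coeff_one_mul]
  simp
  ring

theorem map_bSer : PowerSeries.map (algebraMap ℂ HPoly) (bSer κ k)
    = (1 - algebraMap ℂ (PowerSeries HPoly) (shift κ k) * PowerSeries.X)
      * (1 - algebraMap ℂ (PowerSeries HPoly) (eps κ) * hlf * PowerSeries.X) := by
  simp only [bSer, map_mul, map_sub, map_one, PowerSeries.map_C, PowerSeries.map_X,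
    PowerSeries.algebraMap_apply]

theorem mk_aCoeff_hcTrace : PowerSeries.mk (aCoeff κ k (hcTrace κ k))
    = (1 + algebraMap ℂ (PowerSeries HPoly) (shift κ k) * PowerSeries.X)
      * (1 - gser κ k (hcTrace κ k)
        + algebraMap ℂ (PowerSeries HPoly) (eps κ) * hlf * PowerSeries.X) := by
  rw [mk_aCoeff]
  simp only [aSer, map_mul, map_add, map_one, PowerSeries.map_C, PowerSeries.map_X,
    PowerSeries.algebraMap_apply]
  ring

theorem coeff_shiftSubst_mul (P : PowerSeries HPoly) (m : ℕ) :
    PowerSeries.coeff m (shiftSubst P * PowerSeries.map (algebraMap ℂ HPoly) (bSer κ k))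
      = ∑ j ∈ Finset.range (m + 1), gam κ k m j • PowerSeries.coeff j P := by
  have hg : geomSer = PowerSeries.map (algebraMap ℂ HPoly) (PowerSeries.X * PowerSeries.mk 1) := by
    rw [geomSer, map_mul, PowerSeries.map_X]
    congr 1
  have h1 : ∀ i ≤ m, PowerSeries.coeff i (shiftSubst P)
      = ∑ j ∈ Finset.range (m + 1), PowerSeries.coeff j P * PowerSeries.coeff i (geomSer ^ j) := by
    intro i hi
    have := PowerSeries.coeff_subst' hasSubst_geomSer P i
    rw [shiftSubst, PowerSeries.coe_substAlgHom]
    refine this.trans (finsum_eq_sum_of_support_subset _ fun j hj => ?_)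
    rw [Finset.coe_range, Set.mem_Iio]
    by_contra hj'
    refine hj ?_
    have : PowerSeries.coeff i (geomSer ^ j) = 0 := by
      rw [geomSer, mul_pow, PowerSeries.coeff_X_pow_mul', if_neg (by omega)]
    simp only
    rw [this, smul_zero]
  have h2 : ∀ j, algebraMap ℂ HPoly (gam κ k m j) = PowerSeries.coeff m
      (geomSer ^ j * PowerSeries.map (algebraMap ℂ HPoly) (bSer κ k)) := by
    intro j
    rw [gam, ← PowerSeries.coeff_map, map_mul, map_pow, hg]
  simp only [Algebra.smul_def, h2]
  simp only [PowerSeries.coeff_mul]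
  simp only [Finset.sum_mul]
  rw [Finset.sum_comm]
  refine Finset.sum_congr rfl fun p hp => ?_
  rw [h1 _ (by have := Finset.HasAntidiagonal.mem_antidiagonal.1 hp; omega), Finset.sum_mul]
  exact Finset.sum_congr rfl fun j _ => by ring

theorem hcTrace_zero : hcTrace κ k 0 = algebraMap ℂ HPoly (2 * shift κ k + eps κ) := by
  rw [← card_idx]; simp [hcTrace, hcPow]

theorem coeff_zero_hcChi : PowerSeries.coeff 0 (hcChi κ k) = 1 := by
  have h := congrArg PowerSeries.constantCoeff (hcChi_mul_hcDen (κ := κ) (k := k))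
  simpa [hcDen, hcNum] using h

theorem aCoeff_zero {R : Type*} [Ring R] [Algebra ℂ R] (t : ℕ → R) : aCoeff κ k t 0 = 1 := by
  simp [aCoeff, aSer]

theorem aCoeff_one {R : Type*} [Ring R] [Algebra ℂ R] (t : ℕ → R) :
    aCoeff κ k t 1 = algebraMap ℂ R (shift κ k + eps κ * (1 / 2)) - t 0 := by
  rw [aCoeff, aSer, PowerSeries.coeff_one_mul]
  simp

/-- After the replacement of χ(-u) by χ(u - 1), the functional equation is a difference equation.
Comparing coefficients of order r + 1 determines χ_r from the lower ones. The recursion is used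
twice: for the existence of χ_r and for its symbol. -/
theorem hcChi_rec (r : ℕ) : (r : ℂ) • PowerSeries.coeff r (hcChi κ k)
    = ∑ j ∈ Finset.range r, PowerSeries.coeff j (hcChi κ k)
      * (aCoeff κ k (hcTrace κ k) (r + 1 - j) - algebraMap ℂ HPoly (gam κ k (r + 1) j)) := by
  have h := hcChi_mul_eq (κ := κ) (k := k)
  rw [← shiftSubst_hcChi, ← map_bSer, ← mk_aCoeff_hcTrace] at h
  have h := congrArg (PowerSeries.coeff (r + 1)) h
  rw [coeff_shiftSubst_mul, PowerSeries.coeff_mul,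
    Finset.Nat.sum_antidiagonal_eq_sum_range_succ_mk, ← sub_eq_zero, ← Finset.sum_sub_distrib,
    Finset.sum_range_succ, Finset.sum_range_succ] at h
  -- The terms with index r + 1 cancel. Those with index r have coefficient 2c + ε - N - r, which is
  -- -r because Tr 1 = N = 2c + ε.
  simp only [PowerSeries.coeff_mk, Nat.sub_self, gam_self, aCoeff_zero, mul_one, one_smul,
    sub_self, add_zero, gam_succ, show r + 1 - r = 1 by omega, aCoeff_one, hcTrace_zero] at h
  simp only [mul_sub, Finset.sum_sub_distrib] at h ⊢
  have e : ∀ j, PowerSeries.coeff j (hcChi κ k) * algebraMap ℂ HPoly (gam κ k (r + 1) j)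
      = gam κ k (r + 1) j • PowerSeries.coeff j (hcChi κ k) := fun j => by
    rw [Algebra.smul_def, mul_comm]
  simp only [e]
  simp only [Algebra.smul_def, map_add, map_sub, map_mul, map_natCast] at h ⊢
  have h2 : (2 : HPoly) * algebraMap ℂ HPoly (1 / 2) = 1 := by
    rw [show (2 : HPoly) = algebraMap ℂ _ 2 from (map_ofNat _ 2).symm, ← map_mul]; norm_num
  have h3 : algebraMap ℂ HPoly 2 = 2 := map_ofNat _ 2
  rw [h3] at h
  linear_combination -h + PowerSeries.coeff r (hcChi κ k) * algebraMap ℂ HPoly (eps κ) * h2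

end recursion

/-! ### Lifting the identities for χ_k to the center of U(g_k) -/

section chi

variable {κ : Series} {n k : ℕ}

/-- The traces `Tr (𝓕^{(k)})^r`. -/
def trPow (κ : Series) (n k r : ℕ) : U κ n := (calF κ n k ^ r).trace

theorem hasHC_aCoeff (hk : k ≤ n) (m : ℕ) :
    HasHC κ n k (aCoeff κ k (trPow κ n k) m) (aCoeff κ k (hcTrace κ k) m) :=
  (hasHC_algebraMap _).sub (HasHC.sum _ fun r _ => (hasHC_trace hk r).smul _)

/-- By the recursion, the prescribed image is a polynomial in the images of the traces; the same
polynomial in the traces themselves is the required central element. -/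
theorem exists_hasHC_hcChi (hk : k ≤ n) (r : ℕ) :
    ∃ z, HasHC κ n k z (PowerSeries.coeff r (hcChi κ k)) := by
  induction r using Nat.strong_induction_on with
  | _ r ih =>
    rcases Nat.eq_zero_or_pos r with rfl | hr
    · rw [coeff_zero_hcChi]
      exact ⟨_, by simpa using hasHC_algebraMap (κ := κ) (n := n) (k := k) 1⟩
    · choose! z hz using ih
      have h0 : (r : ℂ) ≠ 0 := Nat.cast_ne_zero.2 hr.ne'
      have h := hcChi_rec (κ := κ) (k := k) r
      rw [← eq_inv_smul_iff₀ h0] at h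
      rw [h]
      exact ⟨_, (HasHC.sum _ fun j hj => (hz j (Finset.mem_range.1 hj)).mul hk
        ((hasHC_aCoeff hk _).sub (hasHC_algebraMap _))).smul _⟩

theorem hasHC_chiCoeff (hk : k ≤ n) (r : ℕ) :
    HasHC κ n k (chiCoeff κ n k r) (PowerSeries.coeff r (hcChi κ k)) := by
  have e : PowerSeries.coeff r (cartanSeries κ n k)
      = cartanHom κ n (PowerSeries.coeff r (hcChi κ k)) := by
    rw [← map_cartanHom_hcChi hk, PowerSeries.coeff_map]; rfl
  obtain ⟨z, hz⟩ := exists_hasHC_hcChi (κ := κ) hk r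
  refine ⟨hz.1, ?_⟩
  have h : ∃ z, HasHCImage κ n k z (PowerSeries.coeff r (cartanSeries κ n k)) := by
    rw [e]; exact ⟨z, hz.2⟩
  rw [← e, chiCoeff, dif_pos h]
  exact h.choose_spec

theorem chiCoeff_zero (hk : k ≤ n) : chiCoeff κ n k 0 = 1 := by
  have h := hasHC_chiCoeff (κ := κ) hk 0
  rw [coeff_zero_hcChi] at h
  exact h.eq_of_eq (by simpa using hasHC_algebraMap (κ := κ) (n := n) (k := k) 1)

/-- Both sides are central with the same Harish-Chandra image, hence equal. -/
theorem chiCoeff_rec (hk : k ≤ n) (r : ℕ) : (r : ℂ) • chiCoeff κ n k r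
    = ∑ j ∈ Finset.range r, chiCoeff κ n k j
      * (aCoeff κ k (trPow κ n k) (r + 1 - j) - algebraMap ℂ (U κ n) (gam κ k (r + 1) j)) := by
  have h := (hasHC_chiCoeff (κ := κ) hk r).smul r
  rw [hcChi_rec] at h
  exact h.eq_of_eq (HasHC.sum _ fun j _ => (hasHC_chiCoeff hk j).mul hk
    ((hasHC_aCoeff hk _).sub (hasHC_algebraMap _)))

theorem chi_mul_eq (hk : k ≤ n) : chi κ n k * PowerSeries.mk (aCoeff κ k (trPow κ n k))
    = PowerSeries.mk (fun i => (-1 : ℂ) ^ i • chiCoeff κ n k i)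
      * PowerSeries.map (algebraMap ℂ (U κ n)) (bSer κ k) := by
  ext1 m
  have h := congrArg (PowerSeries.coeff m) (hcChi_mul_eq (κ := κ) (k := k))
  rw [← map_bSer, ← mk_aCoeff_hcTrace, PowerSeries.coeff_mul, PowerSeries.coeff_mul] at h
  rw [PowerSeries.coeff_mul, PowerSeries.coeff_mul]
  refine HasHC.eq_of_eq (p := ∑ p ∈ Finset.HasAntidiagonal.antidiagonal m,
    PowerSeries.coeff p.1 (hcChi κ k) * PowerSeries.coeff p.2
      (PowerSeries.mk (aCoeff κ k (hcTrace κ k)))) (k := k) ?_ ?_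
  · refine HasHC.sum _ fun p _ => ?_
    rw [chi, PowerSeries.coeff_mk, PowerSeries.coeff_mk, PowerSeries.coeff_mk]
    exact (hasHC_chiCoeff hk _).mul hk (hasHC_aCoeff hk _)
  · rw [h]
    refine HasHC.sum _ fun p _ => ?_
    rw [PowerSeries.coeff_mk, PowerSeries.coeff_map, PowerSeries.coeff_map]
    refine HasHC.mul hk ?_ (hasHC_algebraMap _)
    have e : PowerSeries.coeff p.1 (negSubst (hcChi κ k))
        = (-1 : ℂ) ^ p.1 • PowerSeries.coeff p.1 (hcChi κ k) := by
      rw [negSubst, PowerSeries.evalNegHom, PowerSeries.coeff_rescale, Algebra.smul_def, map_pow,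
        map_neg, map_one]
    rw [e]
    exact (hasHC_chiCoeff hk _).smul _

end chi

/-! ### The symmetry relation for the transposed resolvent -/

section symmetry

theorem gser_shift {R : Type*} [Ring R] [Algebra ℂ R] (κ : Series) (k : ℕ) (c : ℕ → R) :
    (1 + algebraMap ℂ (PowerSeries R) (shift κ k) * PowerSeries.X) * gser κ k c
      = PowerSeries.X * PowerSeries.mk fun i =>
        ∑ r ∈ Finset.range (i + 1), PowerSeries.coeff i (Vser κ k ^ r) • c r := by
  rw [gser_rec]
  congr 1
  ext1 m
  rw [map_add, gser, PowerSeries.coeff_mk, PowerSeries.coeff_mk, Finset.sum_range_succ',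
    add_comm, pow_zero, PowerSeries.coeff_one, PowerSeries.coeff_C]
  congr 1
  split_ifs <;> simp

theorem evalNegHom_algebraMap {R : Type*} [CommRing R] [Algebra ℂ R] (z : ℂ) :
    PowerSeries.evalNegHom (algebraMap ℂ (PowerSeries R) z) = algebraMap ℂ (PowerSeries R) z := by
  ext1 i
  rw [PowerSeries.evalNegHom, PowerSeries.coeff_rescale, PowerSeries.algebraMap_apply,
    PowerSeries.coeff_C]
  split_ifs with h
  · rw [h]; simp
  · simp

/-- This is the symmetry relation of the twisted Yangian over a commutative ring, with G_r in the
role of the transpose of M^r. With f = (u + c - M)⁻¹, the recursion for G determines its generating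
series from f and the traces, and the hypothesis on χ eliminates the traces. -/
theorem resolvent_transpose {R : Type*} [CommRing R] [Algebra ℂ R] {κ : Series} {k : ℕ}
    (M : R) (G T chi : ℕ → R) (hG0 : G 0 = 1)
    (hG : ∀ r, G (r + 1) = -(G r * M) + (2 * shift κ k : ℂ) • G r + eps κ • M ^ r - T r)
    (hchi : PowerSeries.mk chi * PowerSeries.mk (aCoeff κ k T)
      = PowerSeries.mk (fun i => (-1 : ℂ) ^ i • chi i)
        * PowerSeries.map (algebraMap ℂ R) (bSer κ k)) :
    (PowerSeries.mk chi * PowerSeries.mk fun i =>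
        ∑ r ∈ Finset.range (i + 1), PowerSeries.coeff i (Vser κ k ^ r) • G r)
      = algebraMap ℂ (PowerSeries R) (eps κ * (1 / 2)) * PowerSeries.X
        * (PowerSeries.mk chi * PowerSeries.mk fun i =>
          ∑ r ∈ Finset.range (i + 1), PowerSeries.coeff i (Vser κ k ^ r) • M ^ r)
        + (1 - algebraMap ℂ (PowerSeries R) (eps κ * (1 / 2)) * PowerSeries.X)
        * PowerSeries.evalNegHom (PowerSeries.mk chi * PowerSeries.mk fun i =>
          ∑ r ∈ Finset.range (i + 1), PowerSeries.coeff i (Vser κ k ^ r) • M ^ r) := by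
  have E6 := gser_shift κ k fun r => M ^ r
  have E5 := gser_shift κ k G
  have E1 := gser_rec κ k fun r => M ^ r
  have E3 := gser_rec κ k G
  simp only [pow_succ'] at E1
  rw [gser_mul, pow_zero, map_one] at E1
  have hG' : (fun r => G (r + 1)) = fun r => -(M * G r) + algebraMap ℂ R (2 * shift κ k) * G r
      + algebraMap ℂ R (eps κ) * M ^ r - T r := by
    funext r; rw [hG, Algebra.smul_def, Algebra.smul_def, mul_comm (G r)]
  rw [hG', gser_sub, gser_add, gser_add, gser_neg, gser_mul, gser_mul, gser_mul, hG0, map_one,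
    ← PowerSeries.algebraMap_apply, ← PowerSeries.algebraMap_apply] at E3
  have E2 := congrArg PowerSeries.evalNegHom E1
  have E7 := congrArg PowerSeries.evalNegHom E6
  simp only [map_mul, map_add, map_one, evalNegHom_algebraMap, evalNegHom_C,
    PowerSeries.evalNegHom_X] at E2 E7
  have hn : PowerSeries.evalNegHom (PowerSeries.mk chi)
      = PowerSeries.mk (fun i => (-1 : ℂ) ^ i • chi i) := by
    ext1 i
    rw [PowerSeries.evalNegHom, PowerSeries.coeff_rescale, PowerSeries.coeff_mk,
      PowerSeries.coeff_mk, Algebra.smul_def, map_pow, map_neg, map_one]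
  rw [mk_aCoeff, ← hn, aSer, bSer] at hchi
  simp only [map_mul, map_add, map_sub, map_one, PowerSeries.map_C, PowerSeries.map_X,
    ← PowerSeries.algebraMap_apply] at hchi
  simp only [map_mul, map_ofNat] at E3 ⊢
  have H : 2 * algebraMap ℂ (PowerSeries R) (1 / 2) = 1 := by
    rw [show (2 : PowerSeries R) = algebraMap ℂ _ 2 from (map_ofNat _ 2).symm, ← map_mul]; norm_num
  generalize (PowerSeries.mk fun i => ∑ r ∈ Finset.range (i + 1),
    PowerSeries.coeff i (Vser κ k ^ r) • G r) = RG at *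
  generalize (PowerSeries.mk fun i => ∑ r ∈ Finset.range (i + 1),
    PowerSeries.coeff i (Vser κ k ^ r) • M ^ r) = Rs at *
  generalize PowerSeries.evalNegHom Rs = Rs' at *
  generalize PowerSeries.evalNegHom (PowerSeries.mk chi) = χ' at *
  generalize PowerSeries.mk chi = χ at *
  generalize PowerSeries.evalNegHom (gser κ k fun r => M ^ r) = f' at *
  generalize (gser κ k fun r => M ^ r) = f at *
  generalize gser κ k G = g at *
  generalize gser κ k T = τ at *
  generalize algebraMap ℂ (PowerSeries R) (1 / 2) = h at *
  generalize algebraMap ℂ (PowerSeries R) (eps κ) = e at *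
  generalize algebraMap ℂ (PowerSeries R) (shift κ k) = c at *
  generalize PowerSeries.C M = m at *
  -- Here f' = (-u + c - M)⁻¹ is f at -u, and -f' inverts the factor that multiplies g in the
  -- recursion.
  have A1 : g = -(1 + e * f - τ) * f' := by
    refine PowerSeries.X_mul_cancel ?_
    linear_combination g * E2 - E3 * f'
  -- Partial fractions: the inverses of f and f' differ by 2u.
  have A2 : 2 * (f * f') = PowerSeries.X * (f' - f) := by
    linear_combination E1 * f' + E2 * f
  refine PowerSeries.X_mul_cancel ?_
  linear_combination -χ * E5 + χ * (1 + c * PowerSeries.X) * A1 - χ * (1 + c * PowerSeries.X) * e * h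
    * A2 + χ * (1 + c * PowerSeries.X) * e * f * f' * H
    - f' * hchi + e * h * PowerSeries.X * χ * E6 - χ' * (1 - e * h * PowerSeries.X) * E7

/-- The coefficients of `(∑ χ_i X^i) (∑ G_r V^r)`. -/
def resCoeff {R : Type*} [Ring R] [Algebra ℂ R] (κ : Series) (k : ℕ) (χ G : ℕ → R) (i : ℕ) : R :=
  ∑ p ∈ Finset.HasAntidiagonal.antidiagonal i,
    χ p.1 * ∑ r ∈ Finset.range (p.2 + 1), PowerSeries.coeff p.2 (Vser κ k ^ r) • G r

theorem coeff_mk_mul_mk {R : Type*} [Ring R] [Algebra ℂ R] (κ : Series) (k : ℕ) (χ G : ℕ → R)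
    (i : ℕ) : PowerSeries.coeff i (PowerSeries.mk χ * PowerSeries.mk fun i =>
        ∑ r ∈ Finset.range (i + 1), PowerSeries.coeff i (Vser κ k ^ r) • G r)
      = resCoeff κ k χ G i := by
  rw [PowerSeries.coeff_mul, resCoeff]
  simp only [PowerSeries.coeff_mk]

theorem resCoeff_transpose {R : Type*} [CommRing R] [Algebra ℂ R] {κ : Series} {k : ℕ}
    (M : R) (G T chi : ℕ → R) (hG0 : G 0 = 1)
    (hG : ∀ r, G (r + 1) = -(G r * M) + (2 * shift κ k : ℂ) • G r + eps κ • M ^ r - T r)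
    (hchi : ∀ m, ∑ p ∈ Finset.HasAntidiagonal.antidiagonal m, chi p.1 * aCoeff κ k T p.2
      = ∑ p ∈ Finset.HasAntidiagonal.antidiagonal m,
        ((-1 : ℂ) ^ p.1 • chi p.1) * algebraMap ℂ R (PowerSeries.coeff p.2 (bSer κ k))) (i : ℕ) :
    resCoeff κ k chi G i = (-1 : ℂ) ^ i • resCoeff κ k chi (fun r => M ^ r) i
      + if 0 < i then ((1 + (-1 : ℂ) ^ i) * (eps κ * (1 / 2)))
          • resCoeff κ k chi (fun r => M ^ r) (i - 1) else 0 := by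
  have hchi' : PowerSeries.mk chi * PowerSeries.mk (aCoeff κ k T)
      = PowerSeries.mk (fun i => (-1 : ℂ) ^ i • chi i)
        * PowerSeries.map (algebraMap ℂ R) (bSer κ k) := by
    ext1 m
    rw [PowerSeries.coeff_mul, PowerSeries.coeff_mul]
    simp only [PowerSeries.coeff_mk, PowerSeries.coeff_map]
    exact hchi m
  have key := resolvent_transpose (κ := κ) (k := k) M G T chi hG0 hG hchi'
  have h2 := coeff_mk_mul_mk κ k chi fun r => M ^ r
  rw [← coeff_mk_mul_mk, key]
  generalize (PowerSeries.mk chi * PowerSeries.mk fun i =>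
    ∑ r ∈ Finset.range (i + 1), PowerSeries.coeff i (Vser κ k ^ r) • M ^ r) = P at h2 ⊢
  have hn : ∀ j, PowerSeries.coeff j (PowerSeries.evalNegHom P)
      = (-1 : ℂ) ^ j • resCoeff κ k chi (fun r => M ^ r) j := by
    intro j
    rw [PowerSeries.evalNegHom, PowerSeries.coeff_rescale, Algebra.smul_def, map_pow, map_neg,
      map_one, h2]
  rw [sub_mul, one_mul, PowerSeries.algebraMap_apply, mul_assoc, mul_assoc, map_add, map_sub,
    PowerSeries.coeff_C_mul, PowerSeries.coeff_C_mul, hn, ← Algebra.smul_def, ← Algebra.smul_def]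
  cases i with
  | zero => simp
  | succ i =>
    rw [PowerSeries.coeff_succ_X_mul, PowerSeries.coeff_succ_X_mul, hn, h2,
      if_pos (Nat.succ_pos i), Nat.add_sub_cancel]
    module

variable {κ : Series} {n k : ℕ}

/-- The commutative algebra of matrices generated by `𝓕^{(k)}` and the central scalars. -/
def calFAlg (κ : Series) (n k : ℕ) : Subalgebra ℂ (Matrix (Idx κ k) (Idx κ k) (U κ n)) :=
  Algebra.adjoin ℂ (insert (calF κ n k) ((Matrix.scalar (Idx κ k)) '' (Ucenter κ n k : Set (U κ n))))

theorem calF_mem_calFAlg : calF κ n k ∈ calFAlg κ n k :=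
  Algebra.subset_adjoin (Set.mem_insert _ _)

theorem scalar_mem_calFAlg {z : U κ n} (hz : z ∈ Ucenter κ n k) :
    Matrix.scalar (Idx κ k) z ∈ calFAlg κ n k :=
  Algebra.subset_adjoin (Set.mem_insert_of_mem _ ⟨z, hz, rfl⟩)

/-- The matrix 𝓕 commutes with scalar matrices of central elements. The transposed powers lie in
this algebra too, so commutative computations apply to matrices over U(g_n). -/
theorem calFAlg_comm : IsMulCommutative (calFAlg κ n k) := by
  have h1 : ∀ z ∈ Ucenter κ n k, Matrix.scalar (Idx κ k) z * calF κ n k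
      = calF κ n k * Matrix.scalar (Idx κ k) z := by
    intro z hz
    ext i j
    simp only [Matrix.scalar_apply, Matrix.diagonal_mul, Matrix.mul_diagonal]
    exact (Ucenter_comm hz (UF_mem_Usub i j)).symm
  refine Algebra.isMulCommutative_adjoin ℂ ?_
  rintro _ (rfl | ⟨z, hz, rfl⟩) _ (rfl | ⟨w, hw, rfl⟩)
  · rfl
  · exact (h1 w hw).symm
  · exact h1 z hz
  · rw [← map_mul, ← map_mul, Ucenter_comm hw hz.1]

theorem tT_pow_mem_calFAlg (hk : k ≤ n) (r : ℕ) : tT (calF κ n k ^ r) ∈ calFAlg κ n k := by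
  induction r with
  | zero => rw [pow_zero, tT_one]; exact one_mem _
  | succ r ih =>
    rw [(calF_isFMatrix hk).tT_pow_succ]
    exact sub_mem (add_mem (add_mem (neg_mem (mul_mem ih calF_mem_calFAlg))
      (Subalgebra.smul_mem _ ih _)) (Subalgebra.smul_mem _ (pow_mem calF_mem_calFAlg r) _))
      (scalar_mem_calFAlg (trace_pow_mem_Ucenter hk r))

theorem scalar_algebraMap (z : ℂ) :
    Matrix.scalar (Idx κ k) (algebraMap ℂ (U κ n) z) = algebraMap ℂ _ z :=
  AlgHom.commutes (Matrix.scalarAlgHom (Idx κ k) ℂ) z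

theorem scalar_smul (z : ℂ) (u : U κ n) : Matrix.scalar (Idx κ k) (z • u)
    = z • Matrix.scalar (Idx κ k) u :=
  map_smul (Matrix.scalarAlgHom (Idx κ k) ℂ) z u

theorem resCoeff_apply {G : ℕ → Matrix (Idx κ k) (Idx κ k) (U κ n)} {w : ℂ} {a b : Idx κ k}
    (h : ∀ r, G r a b = w • (calF κ n k ^ r) a b) (i : ℕ) :
    resCoeff κ k (fun r => Matrix.scalar (Idx κ k) (chiCoeff κ n k r)) G i a b
      = w • phiCoeff κ n k i a b := by
  rw [phiCoeff, phiSeries, PowerSeries.coeff_mul, resCoeff, Finset.smul_sum, Matrix.sum_apply]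
  refine Finset.sum_congr rfl fun p _ => ?_
  rw [Matrix.scalar_apply, Matrix.diagonal_mul, chi, PowerSeries.coeff_mk, PowerSeries.coeff_mk,
    coeff_resolvent, ← mul_smul_comm, Matrix.sum_apply, Matrix.sum_apply, Finset.smul_sum]
  congr 1
  refine Finset.sum_congr rfl fun r _ => ?_
  rw [Matrix.smul_apply, Matrix.smul_apply, h, smul_comm]

theorem coe_resCoeff (S : Subalgebra ℂ (Matrix (Idx κ k) (Idx κ k) (U κ n))) (χ G : ℕ → S)
    (i : ℕ) : (resCoeff κ k χ G i).1
      = resCoeff κ k (fun r => (χ r).1) (fun r => (G r).1) i := by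
  simp only [resCoeff, AddSubmonoidClass.coe_finsetSum, MulMemClass.coe_mul, SetLike.val_smul]

theorem coe_aCoeff (S : Subalgebra ℂ (Matrix (Idx κ k) (Idx κ k) (U κ n))) (T : ℕ → S)
    (i : ℕ) : (aCoeff κ k T i).1
      = aCoeff κ k (fun r => (T r).1) i := by
  simp only [aCoeff, AddSubgroupClass.coe_sub, AddSubmonoidClass.coe_finsetSum, SetLike.val_smul,
    Subalgebra.coe_algebraMap]

theorem scalar_aCoeff (T : ℕ → U κ n) (i : ℕ) : Matrix.scalar (Idx κ k) (aCoeff κ k T i)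
    = aCoeff κ k (fun r => Matrix.scalar (Idx κ k) (T r)) i := by
  simp only [aCoeff, map_sub, map_sum, scalar_smul, scalar_algebraMap]

theorem scalar_chi_mul (hk : k ≤ n) (m : ℕ) :
    ∑ p ∈ Finset.HasAntidiagonal.antidiagonal m, Matrix.scalar (Idx κ k) (chiCoeff κ n k p.1)
        * aCoeff κ k (fun r => Matrix.scalar (Idx κ k) (trPow κ n k r)) p.2
      = ∑ p ∈ Finset.HasAntidiagonal.antidiagonal m,
        ((-1 : ℂ) ^ p.1 • Matrix.scalar (Idx κ k) (chiCoeff κ n k p.1))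
          * algebraMap ℂ _ (PowerSeries.coeff p.2 (bSer κ k)) := by
  have h := congrArg (PowerSeries.coeff m) (chi_mul_eq (κ := κ) hk)
  rw [PowerSeries.coeff_mul, PowerSeries.coeff_mul] at h
  simp only [chi, PowerSeries.coeff_mk, PowerSeries.coeff_map] at h
  have h := congrArg (Matrix.scalar (Idx κ k)) h
  simp only [map_sum, map_mul, scalar_aCoeff, scalar_smul, scalar_algebraMap] at h
  exact h

open scoped IsMulCommutative in
theorem resCoeff_tT (hk : k ≤ n) (i : ℕ) :
    resCoeff κ k (fun r => Matrix.scalar (Idx κ k) (chiCoeff κ n k r))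
        (fun r => tT (calF κ n k ^ r)) i
      = (-1 : ℂ) ^ i • resCoeff κ k (fun r => Matrix.scalar (Idx κ k) (chiCoeff κ n k r))
        (fun r => calF κ n k ^ r) i
        + if 0 < i then ((1 + (-1 : ℂ) ^ i) * (eps κ * (1 / 2)))
          • resCoeff κ k (fun r => Matrix.scalar (Idx κ k) (chiCoeff κ n k r))
        (fun r => calF κ n k ^ r) (i - 1) else 0 := by
  have := calFAlg_comm (κ := κ) (n := n) (k := k)
  let M : calFAlg κ n k := ⟨calF κ n k, calF_mem_calFAlg⟩
  let G : ℕ → calFAlg κ n k := fun r => ⟨_, tT_pow_mem_calFAlg hk r⟩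
  let T : ℕ → calFAlg κ n k := fun r => ⟨_, scalar_mem_calFAlg (trace_pow_mem_Ucenter hk r)⟩
  let χ : ℕ → calFAlg κ n k := fun r => ⟨_, scalar_mem_calFAlg (chiCoeff_mem_Ucenter r)⟩
  have key := resCoeff_transpose (κ := κ) (k := k) M G T χ
    (Subtype.ext (by simp only [G, pow_zero, tT_one]; rfl))
    (fun r => Subtype.ext ((calF_isFMatrix hk).tT_pow_succ r))
    (fun m => Subtype.ext (by
      have h := scalar_chi_mul (κ := κ) hk m
      simp only [AddSubmonoidClass.coe_finsetSum, MulMemClass.coe_mul, coe_aCoeff,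
        SetLike.val_smul, Subalgebra.coe_algebraMap]
      exact h)) i
  have key := congrArg Subtype.val key
  rw [coe_resCoeff] at key
  refine key.trans ?_
  rw [AddMemClass.coe_add, SetLike.val_smul, coe_resCoeff]
  refine congrArg₂ (· + ·) rfl ?_
  split_ifs
  · rw [SetLike.val_smul, coe_resCoeff]; rfl
  · rfl

/-- At the entry (t,-t) transposition is multiplication by ε, so the symmetry relation becomes a
relation of the entry with itself. -/
theorem phiCoeff_off_diagonal (hk : k ≤ n) (t : Idx κ k) (i : ℕ) :
    eps κ • phiCoeff κ n k i t (negIdx t)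
      = (-1 : ℂ) ^ i • phiCoeff κ n k i t (negIdx t)
        + if 0 < i then ((1 + (-1 : ℂ) ^ i) * (eps κ * (1 / 2)))
          • phiCoeff κ n k (i - 1) t (negIdx t) else 0 := by
  have h := congrFun (congrFun (resCoeff_tT (κ := κ) hk i) t) (negIdx t)
  have h2 := resCoeff_apply (κ := κ) (n := n) (G := fun r => calF κ n k ^ r) (w := 1) (a := t)
    (b := negIdx t) fun r => (one_smul _ _).symm
  simp only [one_smul] at h2
  rw [resCoeff_apply (w := eps κ) fun r => by
    rw [tT_apply, negIdx_negIdx, th_self_negIdx], Matrix.add_apply, Matrix.smul_apply, h2] at h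
  rw [h]
  congr 1
  split_ifs
  · rw [Matrix.smul_apply, h2]
  · rfl

end symmetry

/-! ### Commutativity of the odd coefficients at one level -/

section commutativity

variable {κ : Series} {n k : ℕ}

/-- Coefficient form of (1 + cX)V^{r+1} = XV^r. -/
theorem phiScalar_succ (i r : ℕ) : phiScalar κ n k (i + 1) (r + 1)
    + shift κ k • phiScalar κ n k i (r + 1) = phiScalar κ n k i r := by
  simp only [phiScalar]
  rw [Finset.Nat.antidiagonal_succ']
  simp only [Finset.sum_cons, Finset.sum_map, Finset.smul_sum]
  rw [coeff_Vser_pow_of_lt (Nat.succ_pos r), zero_smul, zero_add, ← Finset.sum_add_distrib]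
  refine Finset.sum_congr rfl fun p _ => ?_
  simp only [Function.Embedding.prodMap, Function.Embedding.coeFn_mk, Prod.map,
    Function.Embedding.refl_apply]
  rw [smul_smul, ← add_smul]
  exact congrArg (· • _) (coeff_succ_Vser_pow κ k p.2 r)

theorem phiScalar_zero (i : ℕ) : phiScalar κ n k i 0 = chiCoeff κ n k i := by
  rw [phiScalar, Finset.sum_eq_single (i, 0)]
  · simp
  · rintro ⟨a, b⟩ h hne
    rw [Finset.HasAntidiagonal.mem_antidiagonal] at h
    have : b ≠ 0 := by rintro rfl; exact hne (by simp at h; rw [h])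
    simp [PowerSeries.coeff_one, this]
  · intro h; exact absurd (Finset.HasAntidiagonal.mem_antidiagonal.2 (by simp)) h

theorem phiCoeff_succ {i N : ℕ} (hN : i ≤ N) (t : Idx κ k) :
    phiCoeff κ n k (i + 1) t t + shift κ k • phiCoeff κ n k i t t
      = (chiCoeff κ n k (i + 1) + shift κ k • chiCoeff κ n k i)
        + ∑ r ∈ Finset.range (N + 1), phiScalar κ n k i r * (calF κ n k ^ (r + 1)) t t := by
  rw [phiCoeff_eq (i + 1) (N + 1) (by omega), phiCoeff_eq i (N + 1) (by omega),
    Finset.sum_range_succ' _ (N + 1), Finset.sum_range_succ' _ (N + 1)]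
  simp only [phiScalar_zero, pow_zero, Matrix.one_apply_eq, mul_one]
  have e : ∑ r ∈ Finset.range (N + 1), phiScalar κ n k i r * (calF κ n k ^ (r + 1)) t t
      = ∑ r ∈ Finset.range (N + 1), phiScalar κ n k (i + 1) (r + 1) * (calF κ n k ^ (r + 1)) t t
        + shift κ k • ∑ r ∈ Finset.range (N + 1),
          phiScalar κ n k i (r + 1) * (calF κ n k ^ (r + 1)) t t := by
    rw [Finset.smul_sum, ← Finset.sum_add_distrib]
    refine Finset.sum_congr rfl fun r _ => ?_
    rw [← phiScalar_succ, add_mul, smul_mul_assoc]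
  rw [e, smul_add]
  abel

theorem sum_mul_sum_central {B : Type*} (R : Finset B) {z w x y : B → U κ n}
    (hx : ∀ r, x r ∈ Usub κ n k) (hw : ∀ r, w r ∈ Ucenter κ n k) :
    (∑ r ∈ R, z r * x r) * (∑ s ∈ R, w s * y s) = ∑ r ∈ R, ∑ s ∈ R, z r * w s * (x r * y s) := by
  rw [Finset.sum_mul_sum]
  refine Finset.sum_congr rfl fun r _ => Finset.sum_congr rfl fun s _ => ?_
  rw [mul_assoc, ← mul_assoc (x r), Ucenter_comm (hw s) (hx r), mul_assoc, mul_assoc]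

theorem sum_mul_sum_central' {B : Type*} (R : Finset B) {z w x y : B → U κ n}
    (hy : ∀ r, y r ∈ Usub κ n k) (hz : ∀ r, z r ∈ Ucenter κ n k) (hw : ∀ r, w r ∈ Ucenter κ n k) :
    (∑ s ∈ R, w s * y s) * (∑ r ∈ R, z r * x r) = ∑ r ∈ R, ∑ s ∈ R, z r * w s * (y s * x r) := by
  rw [sum_mul_sum_central R hy hz, Finset.sum_comm]
  refine Finset.sum_congr rfl fun r _ => Finset.sum_congr rfl fun s _ => ?_
  rw [Ucenter_comm (hz r) (hw s).1]

theorem phiCoeff_mem_Usub (i : ℕ) (a b : Idx κ k) : phiCoeff κ n k i a b ∈ Usub κ n k := by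
  rw [phiCoeff_eq i i le_rfl]
  exact sum_mem fun r _ => mul_mem (phiScalar_mem_Ucenter i r).1 (calF_pow_mem_Usub r a b)

/-- The quaternary relation for the moments is multiplied by the central coefficients and summed.
Raising the power by one corresponds to s_{i+1} + c s_i up to a central term, and the two
contributions with c cancel the term with 2c. -/
theorem phiCoeff_bracket (hk : k ≤ n) (t : Idx κ k) (i j : ℕ) :
    (phiCoeff κ n k (i + 1) t t * phiCoeff κ n k j t t
        - phiCoeff κ n k j t t * phiCoeff κ n k (i + 1) t t)
      + (phiCoeff κ n k i t t * phiCoeff κ n k (j + 1) t t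
        - phiCoeff κ n k (j + 1) t t * phiCoeff κ n k i t t)
      + eps κ • (phiCoeff κ n k i t (negIdx t) * phiCoeff κ n k j (negIdx t) t
        - phiCoeff κ n k j t (negIdx t) * phiCoeff κ n k i (negIdx t) t) = 0 := by
  have hi := phiCoeff_succ (κ := κ) (n := n) (i := i) (N := i + j) (by omega) t
  have hj := phiCoeff_succ (κ := κ) (n := n) (i := j) (N := i + j) (by omega) t
  have h0 : ∀ l a b, l ≤ i + j → phiCoeff κ n k l a b
    = ∑ r ∈ Finset.range (i + j + 1), phiScalar κ n k l r * (calF κ n k ^ r) a b :=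
    fun l a b h => phiCoeff_eq l _ h a b
  have hz : ∀ l, chiCoeff κ n k (l + 1) + shift κ k • chiCoeff κ n k l ∈ Ucenter κ n k :=
    fun l => add_mem (chiCoeff_mem_Ucenter _) (Subalgebra.smul_mem _ (chiCoeff_mem_Ucenter _) _)
  have hzi := Ucenter_comm (hz i) (phiCoeff_mem_Usub (n := n) j t t)
  have hzj := Ucenter_comm (hz j) (phiCoeff_mem_Usub (n := n) i t t)
  generalize chiCoeff κ n k (i + 1) + shift κ k • chiCoeff κ n k i = zi at *
  generalize chiCoeff κ n k (j + 1) + shift κ k • chiCoeff κ n k j = zj at *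
  have hm : ∀ (a b : Idx κ k) (r : ℕ), (calF κ n k ^ r) a b ∈ Usub κ n k :=
    fun a b r => calF_pow_mem_Usub _ a b
  have hm1 : ∀ r, (calF κ n k ^ (r + 1)) t t ∈ Usub κ n k := fun r => calF_pow_mem_Usub _ t t
  have hc := fun l => phiScalar_mem_Ucenter (κ := κ) (n := n) (k := k) l
  have key : ∑ r ∈ Finset.range (i + j + 1), ∑ s ∈ Finset.range (i + j + 1),
      phiScalar κ n k i r * phiScalar κ n k j s *
      (((calF κ n k ^ (r + 1)) t t * (calF κ n k ^ s) t t
          - (calF κ n k ^ s) t t * (calF κ n k ^ (r + 1)) t t)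
      + ((calF κ n k ^ r) t t * (calF κ n k ^ (s + 1)) t t
          - (calF κ n k ^ (s + 1)) t t * (calF κ n k ^ r) t t)
      - (2 * shift κ k : ℂ) • ((calF κ n k ^ r) t t * (calF κ n k ^ s) t t
          - (calF κ n k ^ s) t t * (calF κ n k ^ r) t t)
      + eps κ • ((calF κ n k ^ r) t (negIdx t) * (calF κ n k ^ s) (negIdx t) t
        - (calF κ n k ^ s) t (negIdx t) * (calF κ n k ^ r) (negIdx t) t)) = 0 := by
    refine Finset.sum_eq_zero fun r _ => Finset.sum_eq_zero fun s _ => ?_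
    rw [(calF_isFMatrix hk).quaternary t r s, mul_zero]
  simp only [mul_add, mul_sub, mul_smul_comm, Finset.sum_add_distrib, Finset.sum_sub_distrib,
    ← Finset.smul_sum] at key
  rw [← sum_mul_sum_central _ hm1 (hc j), ← sum_mul_sum_central' _ (hm t t) (hc i) (hc j),
    ← sum_mul_sum_central _ (hm t t) (hc j), ← sum_mul_sum_central' _ hm1 (hc i) (hc j),
    ← sum_mul_sum_central _ (hm t t) (hc j), ← sum_mul_sum_central' _ (hm t t) (hc i) (hc j),
    ← sum_mul_sum_central _ (hm t (negIdx t)) (hc j),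
    ← sum_mul_sum_central' _ (hm t (negIdx t)) (hc i) (hc j)] at key
  rw [← h0 i t t (by omega), ← h0 j t t (by omega), ← h0 i _ _ (by omega), ← h0 j _ _ (by omega),
    ← h0 i _ _ (by omega), ← h0 j _ _ (by omega)] at key
  rw [← sub_eq_iff_eq_add'] at hi hj
  rw [← hi, ← hj] at key
  rw [← key]
  simp only [sub_mul, mul_sub, add_mul, mul_add, smul_mul_assoc, mul_smul_comm, hzi, hzj]
  module

theorem phiCoeff_off_diagonal' (hk : k ≤ n) (t : Idx κ k) (i : ℕ) :
    eps κ • phiCoeff κ n k i (negIdx t) t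
      = (-1 : ℂ) ^ i • phiCoeff κ n k i (negIdx t) t
        + if 0 < i then ((1 + (-1 : ℂ) ^ i) * (eps κ * (1 / 2)))
          • phiCoeff κ n k (i - 1) (negIdx t) t else 0 := by
  simpa using phiCoeff_off_diagonal hk (negIdx t) i

/-- One looks only at the orders in which the terms a_i on the two sides have opposite signs: even
orders for ε = -1, odd orders for ε = 1. -/
theorem even_relation {A : Type*} [AddCommGroup A] [Module ℂ A] {a : ℕ → A}
    (ha : ∀ i, eps κ • a i = (-1 : ℂ) ^ i • a i
      + if 0 < i then ((1 + (-1 : ℂ) ^ i) * (eps κ * (1 / 2))) • a (i - 1) else 0) :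
    (κ = .C ∧ a 0 = 0 ∧ ∀ i, a (2 * i + 2) = (1 / 2 : ℂ) • a (2 * i + 1))
      ∨ (κ = .B ∧ ∀ i, a (2 * i + 1) = 0) := by
  cases κ
  · refine Or.inl ⟨rfl, ?_, ?_⟩
    · have h := ha 0
      simp only [eps, lt_irrefl, if_false, pow_zero, one_smul, add_zero] at h
      have : (2 : ℂ) • a 0 = 0 := by
        have := sub_eq_zero.2 h.symm
        rw [← this]; module
      exact (smul_eq_zero_iff_right two_ne_zero).1 this
    · intro i
      have h := ha (2 * i + 2)
      have e : (-1 : ℂ) ^ (2 * i + 2) = 1 := by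
        rw [show 2 * i + 2 = 2 * (i + 1) by ring, pow_mul]; norm_num
      simp only [eps, if_pos (show 0 < 2 * i + 2 by omega), e,
        show 2 * i + 2 - 1 = 2 * i + 1 by omega] at h
      have : (2 : ℂ) • (a (2 * i + 2) - (1 / 2 : ℂ) • a (2 * i + 1)) = 0 := by
        have := sub_eq_zero.2 h.symm
        rw [← this]; module
      exact sub_eq_zero.1 ((smul_eq_zero_iff_right two_ne_zero).1 this)
  · refine Or.inr ⟨rfl, fun i => ?_⟩
    have h := ha (2 * i + 1)
    have e : (-1 : ℂ) ^ (2 * i + 1) = -1 := by rw [pow_succ, pow_mul]; norm_num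
    simp only [eps, if_pos (show 0 < 2 * i + 1 by omega), e] at h
    have : (2 : ℂ) • a (2 * i + 1) = 0 := by
      have := sub_eq_zero.2 h
      rw [← this]; module
    exact (smul_eq_zero_iff_right two_ne_zero).1 this

/-- Subtracting the bracket relation at (2i+1, 2j+2) from that at (2i+2, 2j+1) eliminates the
commutator of even coefficients. The corrections agree by the parity relations on a and b, and the
remaining commutator is known by induction. -/
theorem commute_of_bracket {A : Type*} [Ring A] [Algebra ℂ A] (κ : Series) (s a b : ℕ → A)
    (hs : ∀ j, Commute (s 0) (s j))
    (h : ∀ i j, (s (i + 1) * s j - s j * s (i + 1)) + (s i * s (j + 1) - s (j + 1) * s i)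
      + eps κ • (a i * b j - a j * b i) = 0)
    (hab : ((a 0 = 0 ∧ ∀ i, a (2 * i + 2) = (1 / 2 : ℂ) • a (2 * i + 1))
      ∧ b 0 = 0 ∧ ∀ i, b (2 * i + 2) = (1 / 2 : ℂ) • b (2 * i + 1))
      ∨ ((∀ i, a (2 * i + 1) = 0) ∧ ∀ i, b (2 * i + 1) = 0))
    (i j : ℕ) : Commute (s (2 * i + 1)) (s (2 * j + 1)) := by
  have hD0 : ∀ j, a 0 * b (2 * j + 1) - a (2 * j + 1) * b 0 = 0 := by
    intro j
    rcases hab with ⟨⟨h1, -⟩, h2, -⟩ | ⟨h1, h2⟩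
    · rw [h1, h2]; simp
    · rw [h1, h2]; simp
  have hD : ∀ i j, a (2 * i + 2) * b (2 * j + 1) - a (2 * j + 1) * b (2 * i + 2)
      = a (2 * i + 1) * b (2 * j + 2) - a (2 * j + 2) * b (2 * i + 1) := by
    intro i j
    rcases hab with ⟨⟨-, h1⟩, -, h2⟩ | ⟨h1, h2⟩
    · rw [h1, h2, h1, h2]; simp only [smul_mul_assoc, mul_smul_comm]
    · rw [h1, h2, h1, h2]; simp
  rw [commute_iff_eq, ← sub_eq_zero]
  induction i generalizing j with
  | zero =>
    have := h 0 (2 * j + 1)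
    rw [hD0, (hs _).eq, sub_self, smul_zero, add_zero, add_zero] at this
    exact this
  | succ i ih =>
    have h1 := h (2 * i + 2) (2 * j + 1)
    have h2 := h (2 * i + 1) (2 * j + 2)
    rw [hD] at h1
    have h3 := ih (j + 1)
    rw [show 2 * (j + 1) + 1 = 2 * j + 2 + 1 by ring] at h3
    rw [show 2 * (i + 1) + 1 = 2 * i + 2 + 1 by ring]
    rw [h3, add_zero] at h2
    have h4 := sub_eq_zero.2 (h1.trans h2.symm)
    rw [← h4]
    simp only [show 2 * j + 1 + 1 = 2 * j + 2 by ring, show 2 * i + 1 + 1 = 2 * i + 2 by ring]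
    abel

theorem phiCoeff_odd_commute (hk : k ≤ n) (t : Idx κ k) (i j : ℕ) :
    Commute (phiCoeff κ n k (2 * i + 1) t t) (phiCoeff κ n k (2 * j + 1) t t) := by
  refine commute_of_bracket κ (fun i => phiCoeff κ n k i t t)
    (fun i => phiCoeff κ n k i t (negIdx t)) (fun i => phiCoeff κ n k i (negIdx t) t) ?_
    (phiCoeff_bracket hk t) ?_ i j
  · intro j
    have : phiCoeff κ n k 0 t t = 1 := by
      rw [phiCoeff_eq 0 0 le_rfl]
      simp [phiScalar_zero, chiCoeff_zero hk]
    simp only [this]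
    exact Commute.one_left _
  · rcases even_relation (phiCoeff_off_diagonal (κ := κ) hk t) with ⟨h, h1⟩ | ⟨h, h1⟩ <;>
    rcases even_relation (phiCoeff_off_diagonal' (κ := κ) hk t) with ⟨h', h2⟩ | ⟨h', h2⟩
    · exact Or.inl ⟨h1, h2⟩
    · rw [h] at h'; cases h'
    · rw [h] at h'; cases h'
    · exact Or.inr ⟨h1, h2⟩

end commutativity

/-! ### Skew Hessenberg matrices -/

section hess

variable {κ : Series} {k : ℕ}

/-- The position of an index. -/
def pos (i : Idx κ k) : ℤ := match κ with
  | .C => if 0 < i.1 then i.1 else i.1 + 1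
  | .B => i.1

theorem pos_lt_pos {i j : Idx κ k} : pos i < pos j ↔ i.1 < j.1 := by
  cases κ
  · have hi := (Finset.mem_erase.1 i.2).1
    have hj := (Finset.mem_erase.1 j.2).1
    simp only [pos]; split_ifs <;> omega
  · rfl

theorem pos_inj {i j : Idx κ k} : pos i = pos j ↔ i = j := by
  constructor
  · intro h
    have h1 := pos_lt_pos (i := i) (j := j)
    have h2 := pos_lt_pos (i := j) (j := i)
    exact Subtype.ext (by omega)
  · rintro rfl; rfl

theorem pos_negIdx (i j : Idx κ k) : pos (negIdx i) + pos i = pos (negIdx j) + pos j := by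
  cases κ
  · have hi := (Finset.mem_erase.1 i.2).1
    have hj := (Finset.mem_erase.1 j.2).1
    simp only [pos, negIdx]; split_ifs <;> omega
  · simp [pos, negIdx]

theorem pos_topIdx (hk : 1 ≤ k) : pos (topIdx κ hk) = k := by
  cases κ
  · simp only [pos, topIdx]; split_ifs <;> omega
  · rfl

theorem pos_le_topIdx (hk : 1 ≤ k) (i : Idx κ k) : pos i ≤ pos (topIdx κ hk) := by
  by_contra h
  rw [not_le, pos_lt_pos] at h
  have := idx_le i
  simp only [topIdx] at h
  omega

theorem exists_pos_eq {p : ℤ} (h1 : 1 - (k : ℤ) ≤ p) (h2 : p ≤ k) : ∃ i : Idx κ k, pos i = p := by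
  cases κ
  · by_cases hp : 0 < p
    · exact ⟨⟨p, by simp only [idxSet, Finset.mem_erase, Finset.mem_Icc]; omega⟩,
        by simp only [pos]; split_ifs; omega⟩
    · exact ⟨⟨p - 1, by simp only [idxSet, Finset.mem_erase, Finset.mem_Icc]; omega⟩,
        by simp only [pos]; split_ifs <;> omega⟩
  · exact ⟨⟨p, by simp only [idxSet, Finset.mem_Icc]; omega⟩, rfl⟩

theorem tT_mul_of_comm (X Y : Matrix (Idx κ k) (Idx κ k) ℂ) : tT (X * Y) = tT Y * tT X := by
  ext i j
  rw [tT_apply, Matrix.mul_apply, Matrix.mul_apply, Finset.smul_sum]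
  refine Finset.sum_nbij' negIdx negIdx (by simp) (by simp) (by simp) (by simp) fun l _ => ?_
  rw [tT_apply, tT_apply, negIdx_negIdx, ← th_mul_th i (negIdx l) j]
  simp only [smul_eq_mul]; ring

theorem trace_tT (X : Matrix (Idx κ k) (Idx κ k) ℂ) : (tT X).trace = X.trace := by
  rw [Matrix.trace, Matrix.trace]
  refine Finset.sum_nbij' negIdx negIdx (by simp) (by simp) (by simp) (by simp) fun l _ => ?_
  rw [Matrix.diag_apply, Matrix.diag_apply, tT_apply, th_self, one_smul]

/-- All entries `(i, j)` with `pos j - pos i < c` vanish. -/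
def DegGE (c : ℤ) (X : Matrix (Idx κ k) (Idx κ k) ℂ) : Prop := ∀ i j, pos j - pos i < c → X i j = 0

theorem DegGE.mul {c c' : ℤ} {X Y : Matrix (Idx κ k) (Idx κ k) ℂ} (hX : DegGE c X)
    (hY : DegGE c' Y) : DegGE (c + c') (X * Y) := by
  intro i j h
  rw [Matrix.mul_apply]
  refine Finset.sum_eq_zero fun l _ => ?_
  by_cases h1 : pos l - pos i < c
  · rw [hX _ _ h1, zero_mul]
  · rw [hY l j (by omega), mul_zero]

theorem DegGE.add {c : ℤ} {X Y : Matrix (Idx κ k) (Idx κ k) ℂ} (hX : DegGE c X)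
    (hY : DegGE c Y) : DegGE c (X + Y) := fun i j h => by
  rw [Matrix.add_apply, hX _ _ h, hY _ _ h, add_zero]

theorem DegGE.smul {c : ℤ} {X : Matrix (Idx κ k) (Idx κ k) ℂ} (hX : DegGE c X) (z : ℂ) :
    DegGE c (z • X) := fun i j h => by
  rw [Matrix.smul_apply, hX _ _ h, smul_zero]

theorem DegGE.mono {c c' : ℤ} {X : Matrix (Idx κ k) (Idx κ k) ℂ} (hX : DegGE c X) (h : c' ≤ c) :
    DegGE c' X := fun i j hij => hX i j (by omega)

theorem DegGE.one : DegGE 0 (1 : Matrix (Idx κ k) (Idx κ k) ℂ) := fun i j h => by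
  rw [Matrix.one_apply, if_neg (by rintro rfl; omega)]

theorem DegGE.pow {X : Matrix (Idx κ k) (Idx κ k) ℂ} (hX : DegGE (-1) X) (s : ℕ) :
    DegGE (-(s : ℤ)) (X ^ s) := by
  induction s with
  | zero => simpa using DegGE.one
  | succ s ih => rw [pow_succ]; exact (ih.mul hX).mono (by push_cast; omega)

theorem DegGE.trace_eq_zero {c : ℤ} {X : Matrix (Idx κ k) (Idx κ k) ℂ} (hX : DegGE c X)
    (h : 0 < c) : X.trace = 0 :=
  Finset.sum_eq_zero fun i _ => hX i i (by omega)

/-- A skew matrix which is upper triangular up to a nonvanishing subdiagonal. -/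
structure IsHess (Y : Matrix (Idx κ k) (Idx κ k) ℂ) : Prop where
  skew : tT Y = -Y
  deg : DegGE (-1) Y
  sub : ∀ i j, pos i = pos j + 1 → Y i j ≠ 0

theorem IsHess.tT_pow {Y : Matrix (Idx κ k) (Idx κ k) ℂ} (hY : IsHess Y) (s : ℕ) :
    tT (Y ^ s) = (-1 : ℂ) ^ s • Y ^ s := by
  induction s with
  | zero => simp [tT_one]
  | succ s ih =>
    rw [pow_succ, tT_mul_of_comm, ih, hY.skew, mul_smul_comm, neg_mul, ← pow_succ', ← pow_succ,
      pow_succ (-1 : ℂ)]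
    module

/-- Transposition preserves the trace and changes the sign of an odd power. -/
theorem IsHess.trace_pow_odd {Y : Matrix (Idx κ k) (Idx κ k) ℂ} (hY : IsHess Y) {s : ℕ}
    (hs : Odd s) : (Y ^ s).trace = 0 := by
  have h := trace_tT (Y ^ s)
  rw [hY.tT_pow, hs.neg_one_pow, neg_smul, one_smul, Matrix.trace_neg] at h
  exact self_eq_neg.1 h.symm

/-- Each factor descends by at most one position, so a descent by s in s steps has a single path:
the entry is a product of subdiagonal entries. -/
theorem IsHess.pow_ne_zero {Y : Matrix (Idx κ k) (Idx κ k) ℂ} (hY : IsHess Y) {s : ℕ}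
    {i j : Idx κ k} (h : pos i = pos j + s) : (Y ^ s) i j ≠ 0 := by
  induction s generalizing j with
  | zero =>
    obtain rfl : i = j := pos_inj.1 (by simpa using h)
    simp
  | succ s ih =>
    have hk : 1 ≤ k := by
      by_contra hk
      have h1 := idx_le i
      have h2 := neg_le_idx j
      have h3 := pos_lt_pos (i := j) (j := i)
      push_cast at h
      omega
    have hb : ∀ i : Idx κ k, -(k : ℤ) ≤ pos i ∧ pos i ≤ k := by
      intro i
      have h1 := idx_le i
      have h2 := neg_le_idx i
      constructor
      · cases κ
        · simp only [pos]; split_ifs <;> omega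
        · exact h2
      · rw [← pos_topIdx (κ := κ) hk]; exact pos_le_topIdx hk i
    have h1 := hb i
    have h2 := hb j
    push_cast at h
    obtain ⟨l, hl⟩ := exists_pos_eq (κ := κ) (k := k) (p := pos j + 1) (by omega) (by omega)
    rw [pow_succ, Matrix.mul_apply, Finset.sum_eq_single l]
    · exact mul_ne_zero (ih (by omega)) (hY.sub l j hl)
    · intro l' _ hne
      have hne' : pos l' ≠ pos l := fun h => hne (pos_inj.1 h)
      by_cases h3 : pos l' < pos l
      · rw [hY.deg.pow s i l' (by omega), zero_mul]
      · rw [hY.deg l' j (by omega), mul_zero]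
    · simp

theorem Fmat_degGE (i j : Idx κ k) : DegGE (pos j - pos i) (Fmat κ k i.1 j.1) := by
  intro a b h
  rw [Fmat_eq, Matrix.sub_apply, Matrix.smul_apply, Matrix.single_apply, Matrix.single_apply,
    if_neg, if_neg, smul_zero, sub_zero]
  · rintro ⟨rfl, rfl⟩
    have := pos_negIdx i j
    omega
  · rintro ⟨rfl, rfl⟩
    omega

theorem tT_Fmat (i j : Idx κ k) : tT (Fmat κ k i.1 j.1) = -Fmat κ k i.1 j.1 := by
  ext a b
  rw [Fmat_eq, tT_apply, Matrix.neg_apply, Matrix.sub_apply, Matrix.smul_apply, Matrix.single_apply,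
    Matrix.single_apply, Matrix.sub_apply, Matrix.smul_apply, Matrix.single_apply,
    Matrix.single_apply]
  have e1 : (i = negIdx b ∧ j = negIdx a) ↔ (negIdx j = a ∧ negIdx i = b) := by
    rw [negIdx_eq_iff, negIdx_eq_iff, and_comm]
  have e2 : (negIdx j = negIdx b ∧ negIdx i = negIdx a) ↔ (i = a ∧ j = b) := by
    rw [negIdx_inj, negIdx_inj, and_comm]
  simp only [e1, e2]
  have h1 : (i = a ∧ j = b) → th a b * th i j = 1 := by rintro ⟨rfl, rfl⟩; exact th_mul_self _ _
  have h2 : (negIdx j = a ∧ negIdx i = b) → th a b = th i j := by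
    rintro ⟨rfl, rfl⟩; rw [th_negIdx_negIdx, th_comm]
  split_ifs with h h' h'
  · simp only [smul_eq_mul, mul_one, mul_sub]; rw [h1 h', h2 h]; ring
  · simp only [smul_eq_mul, mul_one, mul_zero]; rw [h2 h]; ring
  · simp only [smul_eq_mul, mul_one, mul_zero, zero_sub, mul_neg]; rw [h1 h']; ring
  · simp

theorem IsHess.add_Fmat {Y : Matrix (Idx κ k) (Idx κ k) ℂ} (hY : IsHess Y) {i j : Idx κ k}
    (h : pos i ≤ pos j) (δ : ℂ) : IsHess (Y + δ • Fmat κ k i.1 j.1) where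
  skew := by rw [map_add, map_smul, hY.skew, tT_Fmat]; module
  deg := hY.deg.add (((Fmat_degGE i j).mono (by omega)).smul δ)
  sub a b hab := by
    rw [Matrix.add_apply, ((Fmat_degGE i j).smul δ) a b (by omega), add_zero]
    exact hY.sub a b hab

/-- The matrix with entries `±1` on the subdiagonal. -/
def hessBase (κ : Series) (k : ℕ) : Matrix (Idx κ k) (Idx κ k) ℂ :=
  Matrix.of fun i j => if pos i = pos j + 1 then if 0 < i.1 then 1 else -1 else 0

/-- Transposition pairs the subdiagonal entry (i,j) with (-j,-i), which has the opposite sign in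
`hessBase`. The exception is the middle entry (1,-1) in the symplectic case; it is paired with
itself, and there θ = -1. -/
theorem isHess_hessBase : IsHess (hessBase κ k) where
  skew := by
    ext i j
    have h1 := pos_negIdx i j
    have e : pos (negIdx j) = pos (negIdx i) + 1 ↔ pos i = pos j + 1 := by omega
    simp only [tT_apply, hessBase, Matrix.of_apply, Matrix.neg_apply, e]
    by_cases h : pos i = pos j + 1
    · rw [if_pos h, if_pos h]
      cases κ
      · have hi := (Finset.mem_erase.1 i.2).1
        have hj := (Finset.mem_erase.1 j.2).1
        simp only [pos] at h
        simp only [th, theta, negIdx]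
        rcases lt_or_gt_of_ne hi with h2 | h2 <;> rcases lt_or_gt_of_ne hj with h3 | h3
        · simp [Int.sign_eq_neg_one_of_neg, h2, h3, h2.not_gt]
        · split_ifs at h <;> omega
        · simp [Int.sign_eq_neg_one_of_neg, Int.sign_eq_one_of_pos, h2, h3]
        · simp [Int.sign_eq_one_of_pos, h2, h3, h3.not_gt]
      · simp only [pos] at h
        have hn : (negIdx j).1 = -j.1 := rfl
        by_cases h2 : 0 < i.1
        · rw [if_pos h2, if_neg (by omega)]; simp [th, theta]
        · rw [if_neg h2, if_pos (by omega)]; simp [th, theta]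
    · rw [if_neg h, if_neg h]; simp
  deg i j h := by
    simp only [hessBase, Matrix.of_apply]
    rw [if_neg (by omega)]
  sub i j h := by
    simp only [hessBase, Matrix.of_apply]
    rw [if_pos h]
    split_ifs <;> simp

end hess

/-! ### Adjusting one symbol by one entry -/

section step

variable {κ : Series} {k : ℕ}

/-- Every term of the difference contains a factor Z of degree at least d, and each of the other s -
1 factors lowers the degree by at most one. -/
theorem DegGE.pow_sub_pow {Y Z : Matrix (Idx κ k) (Idx κ k) ℂ} {d : ℤ} (hY : DegGE (-1) Y)
    (hd : -1 ≤ d) (hZ : DegGE d Z) (s : ℕ) : DegGE (d - s + 1) ((Y + Z) ^ s - Y ^ s) := by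
  induction s with
  | zero => intro i j _; simp
  | succ s ih =>
    have e : (Y + Z) ^ (s + 1) - Y ^ (s + 1) = (Y + Z) ^ s * Z + ((Y + Z) ^ s - Y ^ s) * Y := by
      rw [pow_succ, pow_succ]; noncomm_ring
    rw [e]
    exact ((((hY.add (hZ.mono hd)).pow s).mul hZ).mono (by push_cast; omega)).add
      ((ih.mul hY).mono (by push_cast; omega))

/-- The solution of `r e_r = -∑_{j < r} e_j p_{r-j}`, `e_0 = 1`. -/
def newtonE (p : ℕ → ℂ) : ℕ → ℂ
  | 0 => 1
  | r + 1 => -((r + 1 : ℕ) : ℂ)⁻¹ * ∑ j : Fin (r + 1), newtonE p j * p (r + 1 - j)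
  decreasing_by exact j.2

theorem newtonE_congr {p q : ℕ → ℂ} (r : ℕ) (h : ∀ j ≤ r, p j = q j) :
    newtonE p r = newtonE q r := by
  induction r using Nat.strong_induction_on with
  | _ r ih =>
    cases r with
    | zero => simp [newtonE]
    | succ r =>
      rw [newtonE, newtonE]
      congr 1
      refine Finset.sum_congr rfl fun j _ => ?_
      rw [ih j j.2 fun i hi => h i (by omega), h _ (by omega)]

/-- The symbol of the coefficient of `u^{-r}` in a diagonal entry of
`χ(u) (1 - 𝓕 / (u + c))⁻¹`. -/
def resSymbol (T : Matrix (Idx κ k) (Idx κ k) ℂ) (t : Idx κ k) (r : ℕ) : ℂ :=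
  ∑ s ∈ Finset.range (r + 1), newtonE (fun j => (T ^ j).trace) (r - s) * (T ^ s) t t

/-- The symbols of the elements under consideration. -/
def levelSymbol (T : Matrix (Idx κ k) (Idx κ k) ℂ) (t : Idx κ k) (r : ℕ) : ℂ :=
  if Odd r then resSymbol T t r else (T ^ r).trace

/-- Only the top power can differ, and its coefficient is e_0 = 1. -/
theorem resSymbol_congr {T T' : Matrix (Idx κ k) (Idx κ k) ℂ} {t : Idx κ k} {r : ℕ}
    (h1 : ∀ s ≤ r, (T' ^ s).trace = (T ^ s).trace) (h2 : ∀ s < r, (T' ^ s) t t = (T ^ s) t t) :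
    resSymbol T' t r - resSymbol T t r = (T' ^ r) t t - (T ^ r) t t := by
  rw [resSymbol, resSymbol, Finset.sum_range_succ, Finset.sum_range_succ, Nat.sub_self,
    newtonE, newtonE]
  have : ∑ s ∈ Finset.range r, newtonE (fun j => (T' ^ j).trace) (r - s) * (T' ^ s) t t
      = ∑ s ∈ Finset.range r, newtonE (fun j => (T ^ j).trace) (r - s) * (T ^ s) t t := by
    refine Finset.sum_congr rfl fun s hs => ?_
    rw [h2 s (Finset.mem_range.1 hs), newtonE_congr _ fun j hj => h1 j (by omega)]
  rw [this]; ring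

theorem trace_mul_Fmat (Z : Matrix (Idx κ k) (Idx κ k) ℂ) (i j : Idx κ k) :
    (Z * Fmat κ k i.1 j.1).trace = Z j i - tT Z j i := by
  rw [Fmat_eq, mul_sub, mul_smul_comm, Matrix.trace_sub, Matrix.trace_smul,
    Matrix.trace_mul_single, Matrix.trace_mul_single, tT_apply, th_comm j i]
  simp

variable {T : Matrix (Idx κ k) (Idx κ k) ℂ} {i j : Idx κ k} {d : ℕ}

theorem IsHess.add_pow_diag (hT : IsHess T) (h : pos j = pos i + d) (δ : ℂ) {s : ℕ} (hs : s ≤ d)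
    (a : Idx κ k) : ((T + δ • Fmat κ k i.1 j.1) ^ s) a a = (T ^ s) a a := by
  have := hT.deg.pow_sub_pow (by omega) ((Fmat_degGE i j).smul δ) s a a (by omega)
  rwa [Matrix.sub_apply, sub_eq_zero] at this

theorem IsHess.add_pow_trace (hT : IsHess T) (h : pos j = pos i + d) (δ : ℂ) {s : ℕ} (hs : s ≤ d) :
    ((T + δ • Fmat κ k i.1 j.1) ^ s).trace = (T ^ s).trace :=
  Finset.sum_congr rfl fun a _ => hT.add_pow_diag h δ hs a

theorem IsHess.levelSymbol_of_le (hT : IsHess T) (h : pos j = pos i + d) (δ : ℂ) (t : Idx κ k)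
    {r : ℕ} (hr : r ≤ d) :
    levelSymbol (T + δ • Fmat κ k i.1 j.1) t r = levelSymbol T t r := by
  rw [levelSymbol, levelSymbol, hT.add_pow_trace h δ hr]
  split_ifs
  · rw [← sub_eq_zero, resSymbol_congr (fun s hs => hT.add_pow_trace h δ (hs.trans hr))
      (fun s hs => hT.add_pow_diag h δ (hs.le.trans hr) t), hT.add_pow_diag h δ hr, sub_self]
  · rfl

/-- At the odd order d + 1 the traces of T and of its perturbation vanish, so only the diagonal
entry of the power changes. Since j is the last position, the perturbation can act only in the last
factor. -/
theorem IsHess.levelSymbol_of_even (hT : IsHess T) (h : pos j = pos i + d) (hd : Even d)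
    (hj : ∀ a : Idx κ k, pos a ≤ pos j) (hij : i ≠ negIdx j) (δ : ℂ) :
    levelSymbol (T + δ • Fmat κ k i.1 j.1) j (d + 1)
      = levelSymbol T j (d + 1) + δ * (T ^ d) j i := by
  have hT' := hT.add_Fmat (i := i) (j := j) (by omega) δ
  have h1 : (T + δ • Fmat κ k i.1 j.1) ^ (d + 1) = T ^ (d + 1)
      + ((T + δ • Fmat κ k i.1 j.1) ^ d * (δ • Fmat κ k i.1 j.1)
        + ((T + δ • Fmat κ k i.1 j.1) ^ d - T ^ d) * T) := by
    rw [pow_succ, pow_succ]; noncomm_ring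
  have hdeg := hT.deg.pow_sub_pow (by omega) ((Fmat_degGE i j).smul δ) d
  have h2 : (((T + δ • Fmat κ k i.1 j.1) ^ d - T ^ d) * T) j j = 0 := by
    rw [Matrix.mul_apply]
    refine Finset.sum_eq_zero fun a _ => ?_
    have := hj a
    rw [hdeg j a (by omega), zero_mul]
  have h3 : ((T + δ • Fmat κ k i.1 j.1) ^ d) j i = (T ^ d) j i := by
    have := hdeg j i (by omega)
    rwa [Matrix.sub_apply, sub_eq_zero] at this
  have h4 : ((T + δ • Fmat κ k i.1 j.1) ^ d * Fmat κ k i.1 j.1) j j = (T ^ d) j i := by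
    rw [Matrix.mul_apply, Finset.sum_eq_single i, h3, Fmat_eq]
    · have : negIdx i ≠ j := fun e => hij (negIdx_eq_iff.1 e)
      simp [this]
    · intro a _ ha
      have : negIdx i ≠ j := fun e => hij (negIdx_eq_iff.1 e)
      rw [Fmat_eq]
      simp [this, ha.symm]
    · simp
  rw [levelSymbol, levelSymbol, if_pos hd.add_one, if_pos hd.add_one, ← sub_eq_iff_eq_add',
    resSymbol_congr (fun s hs => ?_) (fun s hs => hT.add_pow_diag h δ (by omega) j), h1,
    Matrix.add_apply, Matrix.add_apply, h2, mul_smul_comm, Matrix.smul_apply, h4, smul_eq_mul]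
  · ring
  · rcases Nat.lt_or_ge d s with h5 | h5
    · obtain rfl : s = d + 1 := by omega
      rw [hT.trace_pow_odd hd.add_one, hT'.trace_pow_odd hd.add_one]
    · exact hT.add_pow_trace h δ h5

/-- The change of Tr T^{d+1} is its first-order part (d + 1) δ Tr(T^d F_{ij}). The odd power T^d is
skew, so this trace counts its entry (j,i) twice. -/
theorem IsHess.levelSymbol_of_odd (hT : IsHess T) (h : pos j = pos i + d) (hd : Odd d) (δ : ℂ)
    (t : Idx κ k) : levelSymbol (T + δ • Fmat κ k i.1 j.1) t (d + 1)
      = levelSymbol T t (d + 1) + δ * ((d + 1 : ℕ) * (2 * (T ^ d) j i)) := by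
  have hF : (T ^ d * Fmat κ k i.1 j.1).trace = 2 * (T ^ d) j i := by
    rw [trace_mul_Fmat, hT.tT_pow, hd.neg_one_pow, Matrix.smul_apply, smul_eq_mul]; ring
  have key : ∀ s b : ℕ, b + s = d + 1 →
      (T ^ b * ((T + δ • Fmat κ k i.1 j.1) ^ s - T ^ s)).trace = s * (δ * (2 * (T ^ d) j i)) := by
    intro s
    induction s with
    | zero => intro b _; simp
    | succ s ih =>
      intro b hb
      have e : T ^ b * ((T + δ • Fmat κ k i.1 j.1) ^ (s + 1) - T ^ (s + 1))
          = T ^ (b + s) * (δ • Fmat κ k i.1 j.1)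
            + T ^ b * ((T + δ • Fmat κ k i.1 j.1) ^ s - T ^ s) * (δ • Fmat κ k i.1 j.1)
            + T ^ b * ((T + δ • Fmat κ k i.1 j.1) ^ s - T ^ s) * T := by
        rw [pow_succ, pow_succ, pow_add]
        generalize δ • Fmat κ k i.1 j.1 = Z
        noncomm_ring
      have hdeg := hT.deg.pow_sub_pow (by omega) ((Fmat_degGE i j).smul δ) s
      -- The second-order part has degree at least -b + (d - s + 1) + d = d + 1 > 0, so its trace
      -- vanishes.
      have h0 := ((((hT.deg.pow b).mul hdeg).mul ((Fmat_degGE i j).smul δ)).trace_eq_zero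
        (by omega))
      rw [e, Matrix.trace_add, Matrix.trace_add, h0, Matrix.trace_mul_comm _ T, ← mul_assoc,
        ← pow_succ', ih (b + 1) (by omega), mul_smul_comm, Matrix.trace_smul,
        show b + s = d by omega, hF, smul_eq_mul]
      push_cast; ring
  have h1 := key (d + 1) 0 (by omega)
  rw [pow_zero, one_mul, Matrix.trace_sub, sub_eq_iff_eq_add] at h1
  have h2 : ¬Odd (d + 1) := Nat.not_odd_iff_even.2 hd.add_one
  rw [levelSymbol, levelSymbol, if_neg h2, if_neg h2, h1]
  ring

/-- The entry in the last column, d positions above the diagonal, is the free parameter. The symbol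
of order d + 1 depends on it affinely, with nonzero slope by `IsHess.pow_ne_zero`. -/
theorem IsHess.exists_levelSymbol_eq (hT : IsHess T) (hk : 1 ≤ k) (hd : d < 2 * k) (v : ℂ) :
    ∃ (i : Idx κ k) (δ : ℂ), pos i ≤ pos (topIdx κ hk) ∧
      (∀ r ≤ d, levelSymbol (T + δ • Fmat κ k i.1 k) (topIdx κ hk) r
        = levelSymbol T (topIdx κ hk) r) ∧
      levelSymbol (T + δ • Fmat κ k i.1 k) (topIdx κ hk) (d + 1) = v := by
  obtain ⟨i, hi⟩ := exists_pos_eq (κ := κ) (k := k) (p := k - d) (by omega) (by omega)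
  have h : pos (topIdx κ hk) = pos i + d := by rw [pos_topIdx]; omega
  have hne := hT.pow_ne_zero h
  have htop : (topIdx κ hk).1 = k := rfl
  rcases Nat.even_or_odd d with hd' | hd'
  · have hin : i ≠ negIdx (topIdx κ hk) := by
      rintro rfl
      rw [pos_topIdx] at h
      obtain ⟨e, rfl⟩ := hd'
      cases κ
      · simp only [pos, negIdx, htop] at h
        split_ifs at h <;> omega
      · simp only [pos, negIdx, htop] at h
        omega
    refine ⟨i, (v - levelSymbol T (topIdx κ hk) (d + 1)) / (T ^ d) (topIdx κ hk) i,
      by omega, fun r hr => hT.levelSymbol_of_le h _ _ hr, ?_⟩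
    refine (hT.levelSymbol_of_even h hd' (pos_le_topIdx hk) hin _).trans ?_
    field_simp
    ring
  · have hne2 : ((d + 1 : ℕ) : ℂ) ≠ 0 := Nat.cast_ne_zero.2 (by omega)
    refine ⟨i, (v - levelSymbol T (topIdx κ hk) (d + 1))
        / ((d + 1 : ℕ) * (2 * (T ^ d) (topIdx κ hk) i)),
      by omega, fun r hr => hT.levelSymbol_of_le h _ _ hr, ?_⟩
    refine (hT.levelSymbol_of_odd h hd' _ _).trans ?_
    rw [div_mul_cancel₀ _ (mul_ne_zero hne2 (mul_ne_zero two_ne_zero hne))]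
    ring

end step

/-! ### Prescribing the symbols at all levels simultaneously -/

section levels

variable {κ : Series} {n k : ℕ}

/-- The block of a matrix with indices in the smaller set. -/
def trunc (h : k ≤ n) (Y : Matrix (Idx κ n) (Idx κ n) ℂ) : Matrix (Idx κ k) (Idx κ k) ℂ :=
  Y.submatrix (up h) (up h)

theorem pos_up (h : k ≤ n) (i : Idx κ k) : pos (up h i) = pos i := by cases κ <;> rfl

theorem IsHess.isHess_trunc {Y : Matrix (Idx κ n) (Idx κ n) ℂ} (hY : IsHess Y) (h : k ≤ n) :
    IsHess (trunc h Y) where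
  skew := by
    ext i j
    exact congrFun (congrFun hY.skew (up h i)) (up h j)
  deg i j hij := hY.deg _ _ (by rwa [pos_up, pos_up])
  sub i j hij := hY.sub _ _ (by rwa [pos_up, pos_up])

theorem trunc_add_Fmat (h : k ≤ n) (Y : Matrix (Idx κ n) (Idx κ n) ℂ) (δ : ℂ) (i j : ℤ) :
    trunc h (Y + δ • Fmat κ n i j) = trunc h Y + δ • Fmat κ k i j := rfl

theorem Fmat_eq_zero_of_lt {l : ℕ} (hl : l < k) (i : ℤ) : Fmat κ l i k = 0 := by
  ext a b
  have h1 := idx_le b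
  have h2 := neg_le_idx a
  have h3 : E κ l i k a b = 0 := if_neg (by rintro ⟨-, h⟩; omega)
  have h4 : E κ l (-k) (-i) a b = 0 := if_neg (by rintro ⟨h, -⟩; omega)
  rw [Fmat, Matrix.sub_apply, Matrix.smul_apply, h3, h4]
  simp

/-- The levels are treated in increasing order, and within a level the orders. A perturbation by
F_{i,K+1} is invisible in the smaller blocks and preserves the orders already settled in the present
one. -/
theorem exists_isHess (κ : Series) (n : ℕ) (v : ℕ → ℕ → ℂ) :
    ∃ Y : Matrix (Idx κ n) (Idx κ n) ℂ, IsHess Y ∧ ∀ k (hk : 1 ≤ k) (hn : k ≤ n) (r : ℕ),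
      1 ≤ r → r ≤ 2 * k → levelSymbol (trunc hn Y) (topIdx κ hk) r = v k r := by
  have key : ∀ K ≤ n, ∃ Y : Matrix (Idx κ n) (Idx κ n) ℂ, IsHess Y ∧
      ∀ k (hk : 1 ≤ k) (hn : k ≤ n) (r : ℕ), k ≤ K → 1 ≤ r → r ≤ 2 * k →
        levelSymbol (trunc hn Y) (topIdx κ hk) r = v k r := by
    intro K
    induction K with
    | zero => exact fun _ => ⟨_, isHess_hessBase, fun k hk _ _ hK => by omega⟩
    | succ K ih =>
      intro hK
      have hK1 : 1 ≤ K + 1 := by omega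
      have key : ∀ D ≤ 2 * (K + 1), ∃ Y : Matrix (Idx κ n) (Idx κ n) ℂ, IsHess Y ∧
          (∀ k (hk : 1 ≤ k) (hn : k ≤ n) (r : ℕ), k ≤ K → 1 ≤ r → r ≤ 2 * k →
            levelSymbol (trunc hn Y) (topIdx κ hk) r = v k r) ∧
          ∀ r, 1 ≤ r → r ≤ D →
            levelSymbol (trunc hK Y) (topIdx κ hK1) r = v (K + 1) r := by
        intro D
        induction D with
        | zero =>
          intro _
          obtain ⟨Y, hY, h⟩ := ih (by omega)
          exact ⟨Y, hY, h, fun r h1 h2 => by omega⟩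
        | succ D ihD =>
          intro hD
          obtain ⟨Y, hY, h, h'⟩ := ihD (by omega)
          obtain ⟨i, δ, hi, h1, h2⟩ := (hY.isHess_trunc hK).exists_levelSymbol_eq hK1
            (show D < 2 * (K + 1) by omega) (v (K + 1) (D + 1))
          refine ⟨Y + δ • Fmat κ n i.1 (K + 1 : ℕ), ?_, ?_, ?_⟩
          · exact hY.add_Fmat (i := up hK i) (j := up hK (topIdx κ hK1))
              (by rwa [pos_up, pos_up]) δ
          · intro k hk hn r hkK hr hr'
            rw [trunc_add_Fmat, Fmat_eq_zero_of_lt (by omega), smul_zero, add_zero]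
            exact h k hk hn r hkK hr hr'
          · intro r hr hr'
            rw [trunc_add_Fmat]
            rcases Nat.lt_or_ge D r with h3 | h3
            · obtain rfl : r = D + 1 := by omega
              exact h2
            · rw [h1 r h3, h' r hr h3]
      obtain ⟨Y, hY, h, h'⟩ := key _ le_rfl
      refine ⟨Y, hY, fun k hk hn r hkK hr hr' => ?_⟩
      rcases Nat.lt_or_ge K k with h3 | h3
      · obtain rfl : k = K + 1 := by omega
        exact h' r hr hr'
      · exact h k hk hn r h3 hr hr'
  obtain ⟨Y, hY, h⟩ := key n le_rfl
  exact ⟨Y, hY, fun k hk hn r => h k hk hn r hn⟩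

end levels

/-! ### Symbols of the traces, of χ_k and of the coefficients of φ_k -/

section symbols

variable {κ : Series} {n k : ℕ} {Y : Matrix (Idx κ n) (Idx κ n) ℂ}

/-- The linear functional on the Lie algebra with values `Y_{ij}` at `F_{ij}`. -/
abbrev dualMat (Y : Matrix (Idx κ n) (Idx κ n) ℂ) : Matrix (Idx κ n) (Idx κ n) ℂ :=
  (1 / 2 : ℂ) • Y.transpose

/-- The trace pairing with F_{ij} sees both the entry and its mirror image, which agree for skew Y;
hence the factor 1/2 in `dualMat`. -/
theorem IsHess.symbolAt_UF (hY : IsHess Y) (i j : Idx κ n) :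
    SymbolAt (dualMat Y) 1 (UF κ n i.1 j.1) (Y i j) := by
  have h := symbolAt_ι (M := dualMat Y) (F κ n i.1 j.1)
  have e : (dualMat Y * (F κ n i.1 j.1).1).trace = Y i j := by
    refine (trace_mul_Fmat _ i j).trans ?_
    have h2 := congrFun (congrFun hY.skew i) j
    rw [tT_apply, Matrix.neg_apply] at h2
    rw [tT_apply, th_comm j i, dualMat, Matrix.smul_apply, Matrix.smul_apply,
      Matrix.transpose_apply, Matrix.transpose_apply]
    simp only [smul_eq_mul] at h2 ⊢
    linear_combination -(1 / 2 : ℂ) * h2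
  rw [e] at h
  exact h

theorem IsHess.symbolAt_calF_pow (hY : IsHess Y) (hk : k ≤ n) (r : ℕ) (a b : Idx κ k) :
    SymbolAt (dualMat Y) r ((calF κ n k ^ r) a b) ((trunc hk Y ^ r) a b) := by
  induction r generalizing b with
  | zero =>
    rw [pow_zero, pow_zero, Matrix.one_apply, Matrix.one_apply]
    split_ifs
    · exact symbolAt_one
    · exact symbolAt_zero
  | succ r ih =>
    rw [pow_succ, pow_succ, Matrix.mul_apply, Matrix.mul_apply]
    exact SymbolAt.sum _ fun l _ => (ih l).mul (hY.symbolAt_UF (up hk l) (up hk b))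

theorem IsHess.symbolAt_trPow (hY : IsHess Y) (hk : k ≤ n) (r : ℕ) :
    SymbolAt (dualMat Y) r (trPow κ n k r) (trunc hk Y ^ r).trace :=
  SymbolAt.sum _ fun a _ => hY.symbolAt_calF_pow hk r a a

theorem SymbolAt.sum_top {ι : Type} [Fintype ι] [DecidableEq ι]
    {L : LieSubalgebra ℂ (Matrix ι ι ℂ)} {M : Matrix ι ι ℂ} {β : Type*} [DecidableEq β]
    {S : Finset β} {b : β} (hb : b ∈ S) {d : ℕ} {w : β → UniversalEnvelopingAlgebra ℂ L} {c : ℂ}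
    (h : SymbolAt M d (w b) c) (h0 : ∀ b' ∈ S, b' ≠ b → SymbolAt M d (w b') 0) :
    SymbolAt M d (∑ b ∈ S, w b) c := by
  have := SymbolAt.sum (M := M) (d := d) S (w := w) (z := fun b' => if b' = b then c else 0)
    fun b' hb' => by
      split_ifs with e
      · rw [e]; exact h
      · exact h0 b' hb' e
  rwa [Finset.sum_ite_eq', if_pos hb] at this

/-- Of all the traces involved only that of 𝓕^m has order m, and it enters with coefficient -1. -/
theorem IsHess.symbolAt_aCoeff (hY : IsHess Y) (hk : k ≤ n) {m : ℕ} (hm : 1 ≤ m) :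
    SymbolAt (dualMat Y) m (aCoeff κ k (trPow κ n k) (m + 1)) (-(trunc hk Y ^ m).trace) := by
  have h1 := (symbolAt_algebraMap (L := g κ n) (M := dualMat Y)
    (PowerSeries.coeff (m + 1) (aSer κ k))).of_lt (show 0 < m by omega)
  have h2 : SymbolAt (dualMat Y) m (∑ r ∈ Finset.range (m + 1),
      PowerSeries.coeff (m + 1 - 1) (Vser κ k ^ r) • trPow κ n k r) (trunc hk Y ^ m).trace := by
    refine SymbolAt.sum_top (b := m) (by simp) ?_ fun r hr hrm => ?_
    · rw [Nat.add_sub_cancel, coeff_Vser_pow_self, one_smul]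
      exact hY.symbolAt_trPow hk m
    · rw [Finset.mem_range] at hr
      exact ((hY.symbolAt_trPow hk r).smul _).of_lt (by omega)
  have := h1.sub h2
  rwa [zero_sub] at this

/-- In top order the recursion for χ becomes Newton's recursion, because the constants `gam` have
order 0 and do not contribute. -/
theorem IsHess.symbolAt_chiCoeff (hY : IsHess Y) (hk : k ≤ n) (r : ℕ) :
    SymbolAt (dualMat Y) r (chiCoeff κ n k r) (newtonE (fun j => (trunc hk Y ^ j).trace) r) := by
  induction r using Nat.strong_induction_on with
  | _ r ih =>
    cases r with
    | zero => rw [chiCoeff_zero hk, newtonE]; exact symbolAt_one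
    | succ r =>
      have h0 : ((r + 1 : ℕ) : ℂ) ≠ 0 := Nat.cast_ne_zero.2 r.succ_ne_zero
      have h := chiCoeff_rec (κ := κ) hk (r + 1)
      rw [← eq_inv_smul_iff₀ h0] at h
      rw [h, newtonE, neg_mul, ← mul_neg, ← Finset.sum_neg_distrib, Finset.sum_range]
      refine SymbolAt.smul _ (SymbolAt.sum _ fun j _ => ?_)
      have h1 : 1 ≤ r + 1 - j := by omega
      have h2 := (hY.symbolAt_aCoeff hk h1).sub ((symbolAt_algebraMap (L := g κ n)
        (gam κ k (r + 1 + 1) j)).of_lt (show 0 < r + 1 - (j : ℕ) by omega))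
      have h3 := (ih j j.2).mul h2
      rw [sub_zero, mul_neg, show (j : ℕ) + (r + 1 - j) = r + 1 by omega,
        show r + 1 - (j : ℕ) + 1 = r + 1 + 1 - j by omega] at h3
      exact h3

theorem IsHess.symbolAt_phiScalar (hY : IsHess Y) (hk : k ≤ n) {i r : ℕ} (hr : r ≤ i) :
    SymbolAt (dualMat Y) (i - r) (phiScalar κ n k i r)
      (newtonE (fun j => (trunc hk Y ^ j).trace) (i - r)) := by
  refine SymbolAt.sum_top (b := (i - r, r))
    (Finset.HasAntidiagonal.mem_antidiagonal.2 (by simp only; omega)) ?_ fun p hp hne => ?_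
  · rw [coeff_Vser_pow_self, one_smul]
    exact hY.symbolAt_chiCoeff hk _
  · rw [Finset.HasAntidiagonal.mem_antidiagonal] at hp
    rcases lt_trichotomy p.2 r with h | h | h
    · rw [coeff_Vser_pow_of_lt h, zero_smul]; exact symbolAt_zero
    · exact absurd (Prod.ext (by simp only; omega) h) hne
    · exact ((hY.symbolAt_chiCoeff hk _).smul _).of_lt (by omega)

/-- The coefficient of 𝓕^r has order i - r, so every term has order i and contributes to the symbol.
-/
theorem IsHess.symbolAt_phiCoeff (hY : IsHess Y) (hk : k ≤ n) (i : ℕ) (t : Idx κ k) :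
    SymbolAt (dualMat Y) i (phiCoeff κ n k i t t) (resSymbol (trunc hk Y) t i) := by
  rw [phiCoeff_eq i i le_rfl]
  refine SymbolAt.sum _ fun r hr => ?_
  have hr : r ≤ i := by rw [Finset.mem_range] at hr; omega
  have := (hY.symbolAt_phiScalar hk hr).mul (hY.symbolAt_calF_pow hk r t t)
  rwa [Nat.sub_add_cancel hr] at this

end symbols

/-! ### From symbols to algebraic independence -/

section independence

variable {ι : Type} [Fintype ι] [DecidableEq ι] {L : LieSubalgebra ℂ (Matrix ι ι ℂ)}

theorem SymbolAt.pow {M : Matrix ι ι ℂ} {d : ℕ} {u : UniversalEnvelopingAlgebra ℂ L} {c : ℂ}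
    (h : SymbolAt M d u c) (r : ℕ) : SymbolAt M (r * d) (u ^ r) (c ^ r) := by
  induction r with
  | zero => simpa using symbolAt_one
  | succ r ih => rw [pow_succ, pow_succ, add_mul, one_mul]; exact ih.mul h

theorem symbolAt_monomial {B : Type*} {a : B → UniversalEnvelopingAlgebra ℂ L} {w : B → ℕ}
    {M : Matrix ι ι ℂ} {v : B → ℂ} (h : ∀ b, SymbolAt M (w b) (a b) (v b))
    {f : MvPolynomial B ℂ →ₐ[ℂ] UniversalEnvelopingAlgebra ℂ L}
    (hf : ∀ b, f (MvPolynomial.X b) = a b) (m : B →₀ ℕ) :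
    SymbolAt M (Finsupp.weight w m) (f (MvPolynomial.monomial m 1))
      (MvPolynomial.eval v (MvPolynomial.monomial m 1)) := by
  induction m using Finsupp.induction with
  | zero => simpa using symbolAt_one
  | single_add b r m _ _ ih =>
    rw [MvPolynomial.monomial_single_add, map_mul, map_pow, hf, map_mul, map_pow,
      MvPolynomial.eval_X, map_add, Finsupp.weight_single, smul_eq_mul]
    exact ((h b).pow r).mul ih

/-- If a nonzero polynomial vanished at the elements, its component of highest weight would be the
symbol of zero at every point v, hence the zero polynomial. -/
theorem algIndep_of_symbolAt {B : Type*} (a : B → UniversalEnvelopingAlgebra ℂ L) (w : B → ℕ)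
    (hcomm : ∀ b b', a b * a b' = a b' * a b)
    (h : ∀ v : B → ℂ, ∃ M, ∀ b, SymbolAt M (w b) (a b) (v b)) : AlgIndep a := by
  obtain ⟨f, hf⟩ := exists_algHom_of_commute a hcomm
  refine ⟨f, hf, (injective_iff_map_eq_zero f).2 fun P hP => ?_⟩
  by_contra hP0
  obtain ⟨m₀, hm₀, hmax⟩ := Finset.exists_max_image P.support (Finsupp.weight w)
    (MvPolynomial.support_nonempty.2 hP0)
  set d := Finsupp.weight w m₀ with hd
  have key : MvPolynomial.weightedHomogeneousComponent w d P = 0 := by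
    refine MvPolynomial.funext fun v => ?_
    obtain ⟨M, hM⟩ := h v
    have h1 : SymbolAt M d (f P)
        (MvPolynomial.eval v (MvPolynomial.weightedHomogeneousComponent w d P)) := by
      rw [MvPolynomial.weightedHomogeneousComponent_apply, Finset.sum_filter, map_sum]
      nth_rw 1 [P.as_sum]
      rw [map_sum]
      refine SymbolAt.sum _ fun m hm => ?_
      have h2 := (symbolAt_monomial hM hf m).smul (P.coeff m)
      rw [← MvPolynomial.smul_eval, ← map_smul, MvPolynomial.smul_monomial,
        smul_eq_mul, mul_one] at h2
      split_ifs with e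
      · rwa [e] at h2
      · rw [map_zero]
        exact h2.of_lt (lt_of_le_of_ne (hmax m hm) e)
    rw [map_zero]
    exact h1.eq_zero (by rw [hP, map_zero])
  have h3 := congrArg (MvPolynomial.coeff m₀) key
  rw [MvPolynomial.coeff_weightedHomogeneousComponent, if_pos rfl, MvPolynomial.coeff_zero] at h3
  exact MvPolynomial.mem_support_iff.1 hm₀ h3

variable {κ : Series} {n : ℕ}

/-- The elements `φ_k(s_{11}^{(2m-1)})` and `S_m^{(k)}`. -/
abbrev family (κ : Series) (n : ℕ) : Pairs n ⊕ Pairs n → U κ n :=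
  Sum.elim (fun p => phiCoeff κ n p.1.1 (2 * p.1.2 - 1) (p.top κ) (p.top κ))
    (fun p => S κ n p.1.1 p.1.2)

theorem phiCoeff_top_mem_Ucentralizer (p : Pairs n) (i : ℕ) :
    phiCoeff κ n p.1.1 i (p.top κ) (p.top κ) ∈ Ucentralizer κ n p.1.1 :=
  phiCoeff_mem_Ucentralizer p.2.2.1 p.2.1 i

theorem family_mem_Ucentralizer (b : Pairs n ⊕ Pairs n) :
    family κ n b ∈ Ucentralizer κ n (b.elim (fun p => p.1.1) fun p => p.1.1) := by
  rcases b with p | p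
  · exact phiCoeff_top_mem_Ucentralizer p _
  · exact Ucenter_le_Ucentralizer (S_mem_Ucenter p.2.2.1 _)

theorem commute_of_mem_Ucentralizer {k l : ℕ} (h : k < l) {x y : U κ n}
    (hx : x ∈ Ucentralizer κ n k) (hy : y ∈ Ucentralizer κ n l) : x * y = y * x :=
  (Subalgebra.mem_centralizer_iff ℂ).1 hy.2 x (Usub_mono (by omega) hx.1)

/-- Different levels commute because the higher element centralizes the lower algebra. Within a
level the traces are central, which leaves only pairs of odd coefficients. -/
theorem family_comm (b b' : Pairs n ⊕ Pairs n) :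
    family κ n b * family κ n b' = family κ n b' * family κ n b := by
  have hb := family_mem_Ucentralizer (κ := κ) b
  have hb' := family_mem_Ucentralizer (κ := κ) b'
  rcases lt_trichotomy (b.elim (fun p => p.1.1) fun p => p.1.1)
    (b'.elim (fun p => p.1.1) fun p => p.1.1) with h | h | h
  · exact commute_of_mem_Ucentralizer h hb hb'
  · rcases b with ⟨⟨k, m⟩, h1, h2, h3, h4⟩ | p <;> rcases b' with ⟨⟨k', m'⟩, h1', h2', h3', h4'⟩ | p'
    · simp only [Sum.elim_inl] at h
      subst h
      have := phiCoeff_odd_commute (κ := κ) h2 (topIdx κ h1) (m - 1) (m' - 1)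
      simp only at h3 h3'
      rw [show 2 * (m - 1) + 1 = 2 * m - 1 by omega, show 2 * (m' - 1) + 1 = 2 * m' - 1 by omega]
        at this
      exact this
    · rw [h] at hb
      exact Ucenter_comm (S_mem_Ucenter p'.2.2.1 _) hb.1
    · rw [← h] at hb'
      exact (Ucenter_comm (S_mem_Ucenter p.2.2.1 _) hb'.1).symm
    · rw [h] at hb
      exact Ucenter_comm (S_mem_Ucenter p'.2.2.1 _) hb.1
  · exact (commute_of_mem_Ucentralizer h hb' hb).symm

theorem family_algIndep (κ : Series) (n : ℕ) : AlgIndep (family κ n) := by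
  refine algIndep_of_symbolAt (family κ n)
    (Sum.elim (fun p => 2 * p.1.2 - 1) fun p => 2 * p.1.2) family_comm fun v => ?_
  classical
  -- The orders 2m - 1 and 2m both give (r + 1)/2 = m; the parity of r selects the coefficient of
  -- φ_k or the trace. The value 0 outside the range is immaterial.
  obtain ⟨Y, hY, h⟩ := exists_isHess κ n fun k r =>
    if hp : 1 ≤ k ∧ k ≤ n ∧ 1 ≤ (r + 1) / 2 ∧ (r + 1) / 2 ≤ k then
      if Odd r then v (Sum.inl ⟨(k, (r + 1) / 2), hp⟩) else v (Sum.inr ⟨(k, (r + 1) / 2), hp⟩)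
    else 0
  refine ⟨dualMat Y, ?_⟩
  rintro (⟨⟨k, m⟩, h1, h2, h3, h4⟩ | ⟨⟨k, m⟩, h1, h2, h3, h4⟩)
  · simp only at h1 h2 h3 h4
    have h5 := h k h1 h2 (2 * m - 1) (by omega) (by omega)
    have h6 : (2 * m - 1 + 1) / 2 = m := by omega
    have h7 : Odd (2 * m - 1) := ⟨m - 1, by omega⟩
    rw [levelSymbol, if_pos h7] at h5
    simp only [h6, if_pos h7] at h5
    rw [dif_pos ⟨h1, h2, h3, h4⟩] at h5
    have := hY.symbolAt_phiCoeff h2 (2 * m - 1) (topIdx κ h1)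
    rw [h5] at this
    exact this
  · simp only at h1 h2 h3 h4
    have h5 := h k h1 h2 (2 * m) (by omega) (by omega)
    have h6 : (2 * m + 1) / 2 = m := by omega
    have h7 : ¬Odd (2 * m) := by simp
    rw [levelSymbol, if_neg h7] at h5
    simp only [h6, if_neg h7] at h5
    rw [dif_pos ⟨h1, h2, h3, h4⟩] at h5
    have := hY.symbolAt_trPow h2 (2 * m)
    rw [h5] at this
    exact this

end independence

end GTLimit

end

theorem mainTheorem3 (κ : GTLimit.Series) (n : ℕ) :
    (∀ p : GTLimit.Pairs n,
      GTLimit.phiCoeff κ n p.1.1 (2 * p.1.2 - 1) (p.top κ) (p.top κ) ∈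
          GTLimit.Ucentralizer κ n p.1.1 ∧
        GTLimit.S κ n p.1.1 p.1.2 ∈ GTLimit.Ucenter κ n p.1.1) ∧
    GTLimit.AlgIndep (Sum.elim
      (fun p : GTLimit.Pairs n =>
        GTLimit.phiCoeff κ n p.1.1 (2 * p.1.2 - 1) (p.top κ) (p.top κ))
      (fun p : GTLimit.Pairs n => GTLimit.S κ n p.1.1 p.1.2)) ∧
    ∀ φ : (k : ℕ) → GTLimit.twistedYangian κ k →ₐ[ℂ] GTLimit.U κ n,
      (∀ k, 1 ≤ k → k ≤ n → GTLimit.IsPhi κ n k (φ k)) →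
      GTLimit.AlgIndep (Sum.elim
        (fun p : GTLimit.Pairs n =>
          φ p.1.1 (GTLimit.sGen κ p.1.1 (2 * p.1.2 - 1) (p.top κ) (p.top κ)))
        (fun p : GTLimit.Pairs n => GTLimit.S κ n p.1.1 p.1.2)) := by
  open GTLimit in
  refine ⟨fun p => ⟨phiCoeff_top_mem_Ucentralizer p _, S_mem_Ucenter p.2.2.1 _⟩,
    family_algIndep κ n, fun φ hφ => ?_⟩
  have e : (fun p : GTLimit.Pairs n =>
      φ p.1.1 (GTLimit.sGen κ p.1.1 (2 * p.1.2 - 1) (p.top κ) (p.top κ)))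
      = fun p => GTLimit.phiCoeff κ n p.1.1 (2 * p.1.2 - 1) (p.top κ) (p.top κ) :=
    funext fun p => hφ p.1.1 p.2.1 p.2.2.1 _ _ _
  rw [e]
  exact GTLimit.family_algIndep κ n
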